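/- Let $D$ be a densely ordered set without least or greatest element containing the rationals (e.g. $\mathbb{Q}$ or $\mathbb{R}$). A \emph{conjunctive query with arithmetic comparisons} (CQAC) $Q=Q_0+\beta$ has a head (a tuple of variables and constants), a finite set $Q_0$ of relational atoms over variables and constants (its relational subgoals), and a finite conjunction $\beta$ of arithmetic comparisons (ACs) $X\,\theta\,Y$, where $X$ is a variable, $Y$ is a variable or a constant and $\theta\in\{<,\le,>,\ge,=,\ne\}$; constants are rational. All variables of the head and of $\beta$ occur in $Q_0$, and $\beta$ is satisfiable in $D$. For a finite database $I$ with values in $D$, $Q(I)$ is the set of head tuples obtained from the assignments of values in $D$ to the variables that make all atoms of $Q_0$ facts of $I$ and make $\beta$ true; $Q_2\sqsubseteq Q_1$ means $Q_2(I)\subseteq Q_1(I)$ for all $I$. With $X$ a variable and $c$ a constant, a \emph{left semi-interval} (LSI) comparison is $X<c$ (open) or $X\le c$ (closed); a \emph{right semi-interval} (RSI) comparison is $X>c$ (open) or $X\ge c$ (closed); both are called semi-interval (SI) comparisons. Fix one of the four choices in which $\lhd$ is one of $\le,<$ and $\rhd$ is one of $\ge,>$. Consider pairs $(Q_2,Q_1)$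 of CQACs such that $Q_2=Q_{20}+\beta_2$ is arbitrary, every AC of $Q_1=Q_{10}+\beta_1$ has one of the forms $X\lhd c$, $X\rhd c$, $X=Y$, $X=c$, with at most one AC of the form $X\rhd c$, and (a) the constant of an RSI of $Q_1$ is different from each constant of an LSI of $Q_1$; (b) no constant $c$ of an open SI of $Q_1$ appears in a closed SI of $Q_2$, where the ACs of $Q_2$ are read up to implication: there is no variable $X$ such that $\beta_2$ implies $X\le c$ but neither $X<c$ nor $X=c$, and none such that $\beta_2$ implies $X\ge c$ but neither $X>c$ nor $X=c$. Then: 1. The problem of deciding, given such a pair $(Q_2,Q_1)$, whether $Q_2\sqsubseteq Q_1$ is in NP: the set of all pairs that satisfy these conditions and $Q_2\sqsubseteq Q_1$ belongs to NP, where queries are encoded with all numbers in binary. 2. Normalization is not needed: for $i=1,2$ let $Q_i'=Q_{i0}'+\beta_i'$ arise from $Q_i$ by replacing all variables that $\beta_i$ forces to be equal by a single one of them, or by the constant $c$ if $\beta_i$ forces them to equal $c$. Then, for every such pair, $Q_2\sqsubseteq Q_1$ if and only if $$\beta_2'\;\Rightarrow\;\bigvee_{\mu}\mu(\beta_1')$$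 holds for all assignments in $D$, where $\mu$ ranges over the containment mappings from $Q_1'$ to $Q_2'$ (maps of variables to variables or constants, fixing constants, that send each relational subgoal of $Q_1'$ to a relational subgoal of $Q_2'$ and the head of $Q_1'$ to the head of $Q_2'$). -/

import Mathlib

/-! ### Conjunctive queries with arithmetic comparisons: syntax -/

/-- The comparison symbols `<, ≤, >, ≥, =, ≠`. -/
inductive CompOp
  | lt | le | gt | ge | eq | ne
  deriving DecidableEq

/-- A term is a variable (variables are named by natural numbers) or a rational constant. -/
inductive QTerm
  | var (x : ℕ)
  | const (c : ℚ)
  deriving DecidableEq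

/-- A relational atom `r(t₁, …, tₖ)`. Relation names are natural numbers. -/
structure QAtom where
  rel : ℕ
  args : List QTerm

/-- An arithmetic comparison `lhs op rhs`. In a query, `lhs` is required to be a variable
(see `CQAC.WellFormed`). -/
structure Comparison where
  lhs : QTerm
  op : CompOp
  rhs : QTerm

/-- A conjunctive query with arithmetic comparisons: the tuple of head terms, the relational
subgoals and the comparison subgoals. -/
structure CQAC where
  head : List QTerm
  body : List QAtom
  acs : List Comparison

/-! ### Semantics over a dense linear order `D`, in which the rational constants are interpreted by
an order embedding `ι` -/

/-- The interpretation of a comparison symbol in a linear order. -/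
def CompOp.Rel {D : Type*} [LinearOrder D] : CompOp → D → D → Prop
  | .lt, x, y => x < y
  | .le, x, y => x ≤ y
  | .gt, x, y => x > y
  | .ge, x, y => x ≥ y
  | .eq, x, y => x = y
  | .ne, x, y => x ≠ y

/-- The value of a term under an assignment `v` of the variables. -/
def QTerm.val {D : Type*} [LinearOrder D] (ι : ℚ ↪o D) (v : ℕ → D) : QTerm → D
  | .var x => v x
  | .const c => ι c

/-- The comparison is true under the assignment `v`. -/
def Comparison.Holds {D : Type*} [LinearOrder D] (ι : ℚ ↪o D) (v : ℕ → D) (a : Comparison) :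
    Prop :=
  a.op.Rel (a.lhs.val ι v) (a.rhs.val ι v)

/-- All comparisons in the list are true under the assignment `v`. -/
def AllHold {D : Type*} [LinearOrder D] (ι : ℚ ↪o D) (v : ℕ → D) (β : List Comparison) : Prop :=
  ∀ a ∈ β, a.Holds ι v

/-- The conjunction `β` of comparisons implies the comparison `a`, i.e. `a` is in the closure
of `β`. -/
def Implied {D : Type*} [LinearOrder D] (ι : ℚ ↪o D) (β : List Comparison) (a : Comparison) :
    Prop :=
  ∀ v : ℕ → D, AllHold ι v β → a.Holds ι v

/-- A fact: a relation name with a tuple of values. -/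
abbrev DBFact (D : Type*) := ℕ × List D

/-- The fact obtained from an atom by an assignment. -/
def QAtom.toFact {D : Type*} [LinearOrder D] (ι : ℚ ↪o D) (v : ℕ → D) (a : QAtom) : DBFact D :=
  (a.rel, a.args.map (QTerm.val ι v))

/-- The answer `Q(I)` of a query on a database instance `I` (a set of facts). -/
def CQAC.answer {D : Type*} [LinearOrder D] (ι : ℚ ↪o D) (Q : CQAC) (I : Set (DBFact D)) :
    Set (List D) :=
  {t | ∃ v : ℕ → D, (∀ a ∈ Q.body, a.toFact ι v ∈ I) ∧ AllHold ι v Q.acs ∧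
    t = Q.head.map (QTerm.val ι v)}

/-- Query containment `Q₂ ⊑ Q₁`: on every (finite) database, every answer of `Q₂` is an answer
of `Q₁`. -/
def Contained {D : Type*} [LinearOrder D] (ι : ℚ ↪o D) (Q₂ Q₁ : CQAC) : Prop :=
  ∀ I : Set (DBFact D), I.Finite → Q₂.answer ι I ⊆ Q₁.answer ι I

/-- The variable `x` occurs in some relational subgoal of `Q`. -/
def CQAC.InBody (Q : CQAC) (x : ℕ) : Prop :=
  ∃ a ∈ Q.body, QTerm.var x ∈ a.args

/-- The standing conventions on queries: heads are safe, every comparison relates a variable to a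
variable or a constant, comparisons are safe, and the comparisons are consistent. -/
structure CQAC.WellFormed {D : Type*} [LinearOrder D] (ι : ℚ ↪o D) (Q : CQAC) : Prop where
  head_safe : ∀ x, QTerm.var x ∈ Q.head → Q.InBody x
  lhs_var : ∀ a ∈ Q.acs, ∃ x, a.lhs = .var x
  acs_safe : ∀ a ∈ Q.acs, ∀ x, (a.lhs = .var x ∨ a.rhs = .var x) → Q.InBody x
  consistent : ∃ v : ℕ → D, AllHold ι v Q.acs

/-! ### The classes of queries -/

/-- The comparison is a semi-interval comparison `X op c` with a variable `X`, for the given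
comparison symbol `op` and constant `c`. -/
def Comparison.IsSI (a : Comparison) (op : CompOp) (c : ℚ) : Prop :=
  ∃ x, a = ⟨.var x, op, .const c⟩

/-- A left semi-interval comparison (`X < c` or `X ≤ c`) with constant `c`. -/
def Comparison.IsLSI (a : Comparison) (c : ℚ) : Prop :=
  a.IsSI .lt c ∨ a.IsSI .le c

/-- A right semi-interval comparison (`X > c` or `X ≥ c`) with constant `c`. -/
def Comparison.IsRSI (a : Comparison) (c : ℚ) : Prop :=
  a.IsSI .gt c ∨ a.IsSI .ge c

/-- An open semi-interval comparison (`X < c` or `X > c`) with constant `c`. -/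
def Comparison.IsOpenSI (a : Comparison) (c : ℚ) : Prop :=
  a.IsSI .lt c ∨ a.IsSI .gt c

open Classical in
/-- The class of queries using only comparisons of types `var lsi const`, `var rsi const`,
`var = var` and `var = const`, at most one of them an RSI. (Normalizing a query only adds
comparisons of the last two types, so a query is in the class if and only if its normalized version
is.) -/
def InClassRSI1 (lsi rsi : CompOp) (Q : CQAC) : Prop :=
  (∀ a ∈ Q.acs, (∃ c, a.IsSI lsi c) ∨ (∃ c, a.IsSI rsi c) ∨ a.op = .eq) ∧
  Q.acs.countP (fun a => decide (∃ c, a.IsRSI c)) ≤ 1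

/-- The constant `c` appears in a closed semi-interval comparison of `β`, where `β` is read up to
the comparisons it implies: for some variable `X`, `X ≤ c` follows from `β` but neither `X < c` nor
`X = c` does, or the same with `≥` and `>`. -/
def InClosedSI {D : Type*} [LinearOrder D] (ι : ℚ ↪o D) (β : List Comparison) (c : ℚ) : Prop :=
  ∃ x : ℕ, ¬ Implied ι β ⟨.var x, .eq, .const c⟩ ∧
    ((Implied ι β ⟨.var x, .le, .const c⟩ ∧ ¬ Implied ι β ⟨.var x, .lt, .const c⟩) ∨
     (Implied ι β ⟨.var x, .ge, .const c⟩ ∧ ¬ Implied ι β ⟨.var x, .gt, .const c⟩))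

/-- The instances of the containment problem: an arbitrary query `Q₂` and a query `Q₁` of the class
above, such that RSI constants of `Q₁` differ from LSI constants of `Q₁`, and constants of open SIs
of `Q₁` do not appear in closed SIs of `Q₂`. -/
structure IsInstance {D : Type*} [LinearOrder D] (ι : ℚ ↪o D) (lsi rsi : CompOp)
    (Q₂ Q₁ : CQAC) : Prop where
  wf₂ : Q₂.WellFormed ι
  wf₁ : Q₁.WellFormed ι
  inClass : InClassRSI1 lsi rsi Q₁
  rsi_ne_lsi : ∀ a ∈ Q₁.acs, ∀ b ∈ Q₁.acs, ∀ c d, a.IsRSI c → b.IsLSI d → c ≠ d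
  open_closed : ∀ a ∈ Q₁.acs, ∀ c, a.IsOpenSI c → ¬ InClosedSI ι Q₂.acs c

/-! ### The containment test without normalization -/

/-- Apply a substitution of the variables to a term; constants are fixed. -/
def QTerm.subst (σ : ℕ → QTerm) : QTerm → QTerm
  | .var x => σ x
  | .const c => .const c

/-- Apply a substitution to an atom. -/
def QAtom.subst (σ : ℕ → QTerm) (a : QAtom) : QAtom :=
  ⟨a.rel, a.args.map (QTerm.subst σ)⟩

/-- Apply a substitution to a comparison. -/
def Comparison.subst (σ : ℕ → QTerm) (a : Comparison) : Comparison :=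
  ⟨a.lhs.subst σ, a.op, a.rhs.subst σ⟩

/-- Apply a substitution to a query. -/
def CQAC.subst (σ : ℕ → QTerm) (Q : CQAC) : CQAC :=
  ⟨Q.head.map (QTerm.subst σ), Q.body.map (QAtom.subst σ), Q.acs.map (Comparison.subst σ)⟩

open Classical in
/-- The representative of the variable `x` modulo the equations implied by `β`: the constant that
`x` is forced to equal if there is one, and otherwise the least variable that `x` is forced to
equal. -/
noncomputable def eqRepr {D : Type*} [LinearOrder D] (ι : ℚ ↪o D) (β : List Comparison) (x : ℕ) :
    QTerm :=
  if h : ∃ c : ℚ, Implied ι β ⟨.var x, .eq, .const c⟩ then .const h.choose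
  else .var (sInf {y : ℕ | Implied ι β ⟨.var x, .eq, .var y⟩})

/-- The non-normalized form of `Q`: all variables shown equal by the comparisons of `Q` are
replaced by a single variable or constant. (Equations of `Q` become trivial equations `t = t`.) -/
noncomputable def CQAC.collapse {D : Type*} [LinearOrder D] (ι : ℚ ↪o D) (Q : CQAC) : CQAC :=
  Q.subst (eqRepr ι Q.acs)

/-- `μ` is a containment mapping from `Q₁` to `Q₂`: it maps every relational subgoal of `Q₁` to a
relational subgoal of `Q₂`, and the head of `Q₁` to the head of `Q₂`. -/
def IsContainmentMapping (μ : ℕ → QTerm) (Q₁ Q₂ : CQAC) : Prop :=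
  (∀ a ∈ Q₁.body, a.subst μ ∈ Q₂.body) ∧ Q₁.head.map (QTerm.subst μ) = Q₂.head

/-- The containment entailment `β₂ ⇒ μ₁(β₁) ∨ ⋯ ∨ μₖ(β₁)`, where `μ₁, …, μₖ` are all containment
mappings from `Q₁` to `Q₂`. -/
def ContainmentEntailment {D : Type*} [LinearOrder D] (ι : ℚ ↪o D) (Q₂ Q₁ : CQAC) : Prop :=
  ∀ v : ℕ → D, AllHold ι v Q₂.acs →
    ∃ μ : ℕ → QTerm, IsContainmentMapping μ Q₁ Q₂ ∧ AllHold ι v (Q₁.acs.map (Comparison.subst μ))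

/-! ### Polynomial time and NP

The machine model consists of WHILE programs whose variables hold binary trees. Evaluating an
expression is charged with the sizes of all the values that are read or built, so that running time
is polynomially related to the running time of Turing machines. -/

/-- Binary trees, the data of the machine model. -/
inductive BTree
  | nil
  | cons (l r : BTree)
  deriving DecidableEq

/-- The number of nodes, leaves included. -/
def BTree.size : BTree → ℕ
  | .nil => 1
  | .cons l r => l.size + r.size + 1

/-- The left subtree (`nil` for `nil`). -/
def BTree.left : BTree → BTree
  | .nil => .nil
  | .cons l _ => l

/-- The right subtree (`nil` for `nil`). -/
def BTree.right : BTree → BTree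
  | .nil => .nil
  | .cons _ r => r

/-- Truth values as trees: `nil` is false. -/
def BTree.ofBool : Bool → BTree
  | false => .nil
  | true => .cons .nil .nil

/-- The contents of the program variables. -/
abbrev Store := ℕ → BTree

/-- Expressions of the programming language. -/
inductive WExpr
  | var (i : ℕ)
  | nil
  | cons (e f : WExpr)
  | left (e : WExpr)
  | right (e : WExpr)
  | equal (e f : WExpr)

/-- The value of an expression. -/
def WExpr.eval (s : Store) : WExpr → BTree
  | .var i => s i
  | .nil => .nil
  | .cons e f => .cons (e.eval s) (f.eval s)
  | .left e => (e.eval s).left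
  | .right e => (e.eval s).right
  | .equal e f => .ofBool (decide (e.eval s = f.eval s))

/-- The cost of evaluating an expression: the total size of the values of its subexpressions. -/
def WExpr.cost (s : Store) : WExpr → ℕ
  | .var i => (s i).size
  | .nil => 1
  | .cons e f => e.cost s + f.cost s + (WExpr.eval s (.cons e f)).size
  | .left e => e.cost s + (WExpr.eval s (.left e)).size
  | .right e => e.cost s + (WExpr.eval s (.right e)).size
  | .equal e f => e.cost s + f.cost s + (WExpr.eval s (.equal e f)).size

/-- Programs. -/
inductive WProg
  | assign (i : ℕ) (e : WExpr)
  | seq (p q : WProg)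
  | cond (e : WExpr) (p q : WProg)
  | loop (e : WExpr) (p : WProg)

/-- `WProg.Run p s s' t`: started in the store `s`, the program `p` halts in the store `s'` after
`t` steps. Tests succeed on all trees except `nil`. -/
inductive WProg.Run : WProg → Store → Store → ℕ → Prop
  | assign (i : ℕ) (e : WExpr) (s : Store) :
      WProg.Run (.assign i e) s (Function.update s i (e.eval s)) (e.cost s + 1)
  | seq {p q : WProg} {s s' s'' : Store} {t t' : ℕ} :
      WProg.Run p s s' t → WProg.Run q s' s'' t' → WProg.Run (.seq p q) s s'' (t + t')
  | cond_true {e : WExpr} {p q : WProg} {s s' : Store} {t : ℕ} :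
      e.eval s ≠ .nil → WProg.Run p s s' t → WProg.Run (.cond e p q) s s' (e.cost s + 1 + t)
  | cond_false {e : WExpr} {p q : WProg} {s s' : Store} {t : ℕ} :
      e.eval s = .nil → WProg.Run q s s' t → WProg.Run (.cond e p q) s s' (e.cost s + 1 + t)
  | loop_done {e : WExpr} {p : WProg} {s : Store} :
      e.eval s = .nil → WProg.Run (.loop e p) s s (e.cost s + 1)
  | loop_step {e : WExpr} {p : WProg} {s s' s'' : Store} {t t' : ℕ} :
      e.eval s ≠ .nil → WProg.Run p s s' t → WProg.Run (.loop e p) s' s'' t' →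
      WProg.Run (.loop e p) s s'' (e.cost s + 1 + t + t')

/-- The initial store: the input in variable `0`, all other variables empty. -/
def inputStore (x : BTree) : Store := fun i => if i = 0 then x else .nil

/-- The program halts on input `x` within `n` steps. -/
def WProg.HaltsWithin (p : WProg) (x : BTree) (n : ℕ) : Prop :=
  ∃ s t, p.Run (inputStore x) s t ∧ t ≤ n

/-- The program halts on input `x` with a non-empty tree in variable `0`. -/
def WProg.Accepts (p : WProg) (x : BTree) : Prop :=
  ∃ s t, p.Run (inputStore x) s t ∧ s 0 ≠ .nil

/-- The set `L` of objects of type `α`, presented to the machine by the encoding `enc`, is in NP: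
there is a polynomial-time verifier, and the members of `L` are the objects for which it accepts
some certificate of polynomial size. -/
def InNP {α : Type*} (enc : α → BTree) (L : Set α) : Prop :=
  ∃ (V : WProg) (p : Polynomial ℕ),
    (∀ a w, V.HaltsWithin (.cons (enc a) w) (p.eval (BTree.cons (enc a) w).size)) ∧
    ∀ a, a ∈ L ↔ ∃ w : BTree, w.size ≤ p.eval (enc a).size ∧ V.Accepts (.cons (enc a) w)

/-! ### Encoding of queries; all numbers are written in binary -/

/-- Encoding of a list, given an encoding of its members. -/
def encList {α : Type*} (enc : α → BTree) : List α → BTree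
  | [] => .nil
  | a :: l => .cons (enc a) (encList enc l)

/-- A natural number as the list of its binary digits, least significant digit first. -/
def encNat (n : ℕ) : BTree := encList BTree.ofBool n.bits

/-- A rational number as sign, numerator and denominator. -/
def encRat (q : ℚ) : BTree :=
  .cons (.ofBool (decide (q < 0))) (.cons (encNat q.num.natAbs) (encNat q.den))

/-- Encoding of terms. -/
def encTerm : QTerm → BTree
  | .var x => .cons (.ofBool false) (encNat x)
  | .const c => .cons (.ofBool true) (encRat c)

/-- Encoding of atoms. -/
def encAtom (a : QAtom) : BTree := .cons (encNat a.rel) (encList encTerm a.args)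

/-- Encoding of comparison symbols. -/
def encOp : CompOp → BTree
  | .lt => encNat 0
  | .le => encNat 1
  | .gt => encNat 2
  | .ge => encNat 3
  | .eq => encNat 4
  | .ne => encNat 5

/-- Encoding of comparisons. -/
def encComparison (a : Comparison) : BTree :=
  .cons (encTerm a.lhs) (.cons (encOp a.op) (encTerm a.rhs))

/-- Encoding of queries. -/
def encQuery (Q : CQAC) : BTree :=
  .cons (encList encTerm Q.head) (.cons (encList encAtom Q.body) (encList encComparison Q.acs))

/-- Encoding of pairs of queries. -/
def encQueryPair (P : CQAC × CQAC) : BTree := .cons (encQuery P.1) (encQuery P.2)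

/-! ### Polynomial-time computable functions between encoded types -/

/-! By `contained_iff`, containment says that for every model `v` of `β₂` there is an assignment `u`
satisfying `β₁` that sends the subgoals of `Q₁` to facts which `v` makes of subgoals of `Q₂`, and
that agrees with `v` on the heads. If `v` identifies only terms that `β₂` forces to be equal, `u`
can be read as a containment mapping. Both claims therefore reduce to replacing a model by a generic
one while keeping control of `β₁`. The tool is `exists_refines`: the ties of an assignment on
finitely many terms can be broken in any prescribed way, because a dense order without endpoints
realises the lexicographic order with the constants in place.

For the entailment (`containmentEntailment_of_contained`), a model is refined twice. The first
refinement takes the terms that are tied with the constant `c` of an open SI of `Q₁`, but not forced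
to equal `c`, and moves them to the side of `c` where that SI fails. Condition (a) makes the
direction unambiguous (`exists_shift`); condition (b) ensures that no non-strict bound of `β₂` is
broken (`shiftedVal_rel`). The second refinement falsifies every equation that is not forced. The
comparisons satisfied by `u` at the refined model then hold for the resulting mapping at the
original one: strict inequalities survive refinement, and a tie would have been broken against an
open SI. Equations of `Q₁` become trivial by the collapse.

For NP, a certificate is a list of mappings that acts as a refutation (`refutationTest`). Starting
with `β = β₂`, each mapping has to be a containment mapping modulo the equations implied by `β`, and
`β` has to imply the images of all comparisons of `Q₁` except the RSI, whose negated image is then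
added to `β`; at the end `β` must be contradictory. Soundness: a model of `β₂` violates one of the
negations, and the first mapping where this happens serves it. Completeness: while `β` is
satisfiable, `exists_generic_model` gives a model in which, among the relevant equations and bounds
`t ≤ c`, only the implied ones hold, and `exists_mapping` reads a mapping off it. Open LSIs are
handled by the same shift (`implied_lt_or_eq_of_implied_le`). The RSI holds for this mapping at that
model, so its negation is new. With a single RSI, the possible negations are at most as many as the
terms in the body of `Q₂`, so the refutation is short.

The tests are polynomial: implication reduces to satisfiability, which is a reachability question
(`satTest_iff`), and running times follow from closure properties of `PolyTime`, above all closure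
under folds over lists. -/

theorem WExpr.size_eval_le_cost (s : Store) (e : WExpr) : (e.eval s).size ≤ e.cost s := by
  cases e <;> simp [WExpr.cost, WExpr.eval, BTree.size]

/-- An assignment pays for the size of the value that it stores, so time bounds growth. Hence
polynomial-time programs have results of polynomial size. -/
theorem WProg.Run.size_le {P : WProg} {s s' : Store} {t : ℕ} (h : P.Run s s' t) (i : ℕ) :
    (s' i).size ≤ (s i).size + t := by
  induction h with
  | assign j e s =>
    have := WExpr.size_eval_le_cost s e
    by_cases hij : i = j
    · subst hij; simp only [Function.update_self]; omega
    · simp [Function.update_of_ne hij]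
  | seq _ _ ih₁ ih₂ => omega
  | cond_true _ _ ih => omega
  | cond_false _ _ ih => omega
  | loop_done _ => omega
  | loop_step _ _ _ ih₁ ih₂ => omega

theorem WProg.Run.assign_eq {i : ℕ} {e : WExpr} {s s' : Store} {t : ℕ}
    (h : s' = Function.update s i (e.eval s)) (ht : t = e.cost s + 1) :
    WProg.Run (.assign i e) s s' t := by
  subst h ht
  exact .assign i e s

theorem Polynomial.eval_le_eval_of_le (p : Polynomial ℕ) {m n : ℕ} (h : m ≤ n) :
    p.eval m ≤ p.eval n := by
  simp only [Polynomial.eval_eq_sum, Polynomial.sum]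
  gcongr

/-- Types whose elements are presented to the machine as binary trees. -/
class TreeCode (α : Type*) where
  code : α → BTree
  code_injective : Function.Injective code

open TreeCode (code code_injective)

/-- The size of the code of an object. -/
def codeSize {α : Type*} [TreeCode α] (a : α) : ℕ := (code a).size

instance : TreeCode BTree := ⟨id, Function.injective_id⟩

instance : TreeCode Bool :=
  ⟨BTree.ofBool, fun a b h => by cases a <;> cases b <;> simp_all [BTree.ofBool]⟩

instance {α β : Type*} [TreeCode α] [TreeCode β] : TreeCode (α × β) :=
  ⟨fun x => .cons (code x.1) (code x.2), fun x y h => by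
    simp only [BTree.cons.injEq] at h
    exact Prod.ext (code_injective h.1) (code_injective h.2)⟩

theorem encList_injective {α : Type*} {enc : α → BTree} (h : Function.Injective enc) :
    Function.Injective (encList enc) := by
  intro l
  induction l with
  | nil => intro m hm; cases m <;> simp_all [encList]
  | cons a l ih =>
    intro m hm
    cases m with
    | nil => simp [encList] at hm
    | cons b m =>
      simp only [encList, BTree.cons.injEq] at hm
      rw [h hm.1, ih hm.2]

instance {α : Type*} [TreeCode α] : TreeCode (List α) :=
  ⟨encList code, encList_injective code_injective⟩

theorem code_pair {α β : Type*} [TreeCode α] [TreeCode β] (a : α) (b : β) :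
    code (a, b) = .cons (code a) (code b) := rfl

theorem code_nil {α : Type*} [TreeCode α] : code ([] : List α) = .nil := rfl

theorem code_cons {α : Type*} [TreeCode α] (a : α) (l : List α) :
    code (a :: l) = .cons (code a) (code l) := rfl

theorem codeSize_pair {α β : Type*} [TreeCode α] [TreeCode β] (a : α) (b : β) :
    codeSize (a, b) = codeSize a + codeSize b + 1 := rfl

theorem codeSize_nil {α : Type*} [TreeCode α] : codeSize ([] : List α) = 1 := rfl

theorem codeSize_cons {α : Type*} [TreeCode α] (a : α) (l : List α) :
    codeSize (a :: l) = codeSize a + codeSize l + 1 := rfl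

theorem length_lt_codeSize {α : Type*} [TreeCode α] (l : List α) : l.length < codeSize l := by
  induction l with
  | nil => simp [codeSize_nil]
  | cons a l ih => rw [codeSize_cons, List.length_cons]; omega

theorem codeSize_le_of_mem {α : Type*} [TreeCode α] {a : α} {l : List α} (h : a ∈ l) :
    codeSize a ≤ codeSize l := by
  induction l with
  | nil => simp at h
  | cons b l ih =>
    rw [codeSize_cons]
    rcases List.mem_cons.1 h with rfl | h
    · omega
    · have := ih h; omega

/-- The function `f` is computed, on the codes of its arguments, by a program that uses finitely
many variables and runs in polynomial time. -/
def PolyTime {α β : Type*} [TreeCode α] [TreeCode β] (f : α → β) : Prop :=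
  ∃ (P : WProg) (k : ℕ) (p : Polynomial ℕ), 0 < k ∧ ∀ a (s : Store), s 0 = code a →
    ∃ s' t, P.Run s s' t ∧ t ≤ p.eval (codeSize a) ∧ s' 0 = code (f a) ∧ ∀ i, k ≤ i → s' i = s i

namespace PolyTime

variable {α β γ δ σ : Type*} [TreeCode α] [TreeCode β] [TreeCode γ] [TreeCode δ] [TreeCode σ]

theorem codeSize_le {f : α → β} (hf : PolyTime f) :
    ∃ p : Polynomial ℕ, ∀ a, codeSize (f a) ≤ p.eval (codeSize a) := by
  obtain ⟨P, k, p, hk, hP⟩ := hf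
  refine ⟨Polynomial.X + p, fun a => ?_⟩
  obtain ⟨s', t, r, ht, h0, -⟩ := hP a (fun _ => code a) rfl
  have := r.size_le 0
  rw [h0] at this
  simp only [Polynomial.eval_add, Polynomial.eval_X]
  unfold codeSize at *
  omega

theorem comp {g : β → γ} {f : α → β} (hg : PolyTime g) (hf : PolyTime f) :
    PolyTime fun a => g (f a) := by
  obtain ⟨P, k, p, hk, hP⟩ := hf
  obtain ⟨Q, l, q, hl, hQ⟩ := hg
  refine ⟨.seq P Q, max k l, p + q.comp (Polynomial.X + p), by omega, fun a s hs => ?_⟩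
  obtain ⟨s₁, t₁, r₁, ht₁, h₁, f₁⟩ := hP a s hs
  obtain ⟨s₂, t₂, r₂, ht₂, h₂, f₂⟩ := hQ (f a) s₁ h₁
  have hsz : codeSize (f a) ≤ codeSize a + p.eval (codeSize a) := by
    have := r₁.size_le 0
    rw [h₁, hs] at this
    unfold codeSize at *
    omega
  have := q.eval_le_eval_of_le hsz
  refine ⟨s₂, _, .seq r₁ r₂, ?_, h₂, fun i hi => ?_⟩
  · simp only [Polynomial.eval_add, Polynomial.eval_comp, Polynomial.eval_X]
    omega
  · rw [f₂ i (by omega), f₁ i (by omega)]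

/-- A function whose values have the same codes as those of a polynomial-time function. -/
theorem recode {f : α → β} {g : α → γ} (hg : PolyTime g) (h : ∀ a, code (f a) = code (g a)) :
    PolyTime f := by
  obtain ⟨P, k, p, hk, hP⟩ := hg
  refine ⟨P, k, p, hk, fun a s hs => ?_⟩
  obtain ⟨s₁, t₁, r₁, ht₁, h₁, f₁⟩ := hP a s hs
  exact ⟨s₁, t₁, r₁, ht₁, h₁.trans (h a).symm, f₁⟩

/-- A function that is evaluated by a single expression. -/
theorem of_expr {f : α → β} (e : WExpr) (p : Polynomial ℕ)
    (h : ∀ a (s : Store), s 0 = code a → e.eval s = code (f a) ∧ e.cost s ≤ p.eval (codeSize a)) :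
    PolyTime f := by
  refine ⟨.assign 0 e, 1, p + 1, one_pos, fun a s hs => ?_⟩
  obtain ⟨h₁, h₂⟩ := h a s hs
  refine ⟨_, _, .assign 0 e s, ?_, ?_, fun i hi => ?_⟩
  · simp only [Polynomial.eval_add, Polynomial.eval_one]; omega
  · simp [h₁]
  · rw [Function.update_of_ne (by omega)]

protected theorem id : PolyTime fun a : α => a :=
  of_expr (.var 0) Polynomial.X fun a s hs => by
    simp [WExpr.eval, WExpr.cost, hs, codeSize]

/-- The expression that builds a given tree. -/
def quoteTree : BTree → WExpr
  | .nil => .nil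
  | .cons l r => .cons (quoteTree l) (quoteTree r)

theorem eval_quoteTree (s : Store) (x : BTree) : (quoteTree x).eval s = x := by
  induction x with
  | nil => rfl
  | cons l r ihl ihr => simp [quoteTree, WExpr.eval, ihl, ihr]

theorem cost_quoteTree (s s' : Store) (x : BTree) :
    (quoteTree x).cost s = (quoteTree x).cost s' := by
  induction x with
  | nil => rfl
  | cons l r ihl ihr =>
    simp [quoteTree, WExpr.cost, WExpr.eval, eval_quoteTree, ihl, ihr]

protected theorem const (b : β) : PolyTime fun _ : α => b :=
  of_expr (quoteTree (code b)) (Polynomial.C ((quoteTree (code b)).cost fun _ => .nil))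
    fun a s _ => by
      simp only [eval_quoteTree, Polynomial.eval_C, true_and]
      exact (cost_quoteTree _ _ _).le

/-- `left` and `right` cover all operations whose value is coded by a subtree of the argument's
code: projections, `tail`, parity and halving, and the fields of structures. -/
theorem left {f : α → β} {g : α → γ} (hg : PolyTime g)
    (h : ∀ a, code (f a) = (code (g a)).left) : PolyTime f := by
  have key : PolyTime fun x : BTree => x.left := by
    refine of_expr (.left (.var 0)) (2 * Polynomial.X) fun x s hs => ?_
    have : x.left.size ≤ x.size := by cases x <;> simp [BTree.left, BTree.size]; omega
    simp only [code, id_eq] at hs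
    refine ⟨by simp [WExpr.eval, code, hs], ?_⟩
    simp [WExpr.cost, WExpr.eval, codeSize, code, hs]
    omega
  exact (key.comp (hg.recode (f := fun a => code (g a)) fun _ => rfl)).recode h

theorem right {f : α → β} {g : α → γ} (hg : PolyTime g)
    (h : ∀ a, code (f a) = (code (g a)).right) : PolyTime f := by
  have key : PolyTime fun x : BTree => x.right := by
    refine of_expr (.right (.var 0)) (2 * Polynomial.X) fun x s hs => ?_
    have : x.right.size ≤ x.size := by cases x <;> simp [BTree.right, BTree.size]; omega
    simp only [code, id_eq] at hs
    refine ⟨by simp [WExpr.eval, code, hs], ?_⟩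
    simp [WExpr.cost, WExpr.eval, codeSize, code, hs]
    omega
  exact (key.comp (hg.recode (f := fun a => code (g a)) fun _ => rfl)).recode h

theorem fst {f : α → β × γ} (hf : PolyTime f) : PolyTime fun a => (f a).1 :=
  hf.left fun _ => rfl

theorem snd {f : α → β × γ} (hf : PolyTime f) : PolyTime fun a => (f a).2 :=
  hf.right fun _ => rfl

theorem pair {f : α → β} {g : α → γ} (hf : PolyTime f) (hg : PolyTime g) :
    PolyTime fun a => (f a, g a) := by
  obtain ⟨P, k, p, hk, hP⟩ := hf
  obtain ⟨Q, l, q, hl, hQ⟩ := hg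
  -- Neither program touches variables from `m` on, so `m` can keep the argument and `m + 1` the
  -- first result.
  let m := max k l
  refine ⟨.seq (.assign m (.var 0)) (.seq P (.seq (.assign (m + 1) (.var 0))
      (.seq (.assign 0 (.var m)) (.seq Q (.assign 0 (.cons (.var (m + 1)) (.var 0))))))), m + 2,
    10 * Polynomial.X + 4 * p + 4 * q + 10, by omega, fun a s hs => ?_⟩
  obtain ⟨s₁, t₁, r₁, ht₁, h₁, f₁⟩ := hP a (Function.update s m (s 0))
    (by rw [Function.update_of_ne (by omega), hs])
  obtain ⟨s₂, t₂, r₂, ht₂, h₂, f₂⟩ := hQ a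
    (Function.update (Function.update s₁ (m + 1) (s₁ 0)) 0 (s₁ m))
    (by rw [Function.update_self, f₁ m (by omega), Function.update_self, hs])
  have e₁ : s₁ m = code a := by rw [f₁ m (by omega), Function.update_self, hs]
  have e₂ : s₂ (m + 1) = code (f a) := by
    rw [f₂ _ (by omega), Function.update_of_ne (by omega), Function.update_self, h₁]
  have z₁ := r₁.size_le 0
  have z₂ := r₂.size_le 0
  rw [Function.update_of_ne (by omega), hs, h₁] at z₁
  rw [Function.update_self, h₂, e₁] at z₂
  refine ⟨_, _, .seq (.assign _ _ _) (.seq r₁ (.seq (.assign _ _ _) (.seq (.assign _ _ _)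
    (.seq (s' := s₂) (t := t₂) ?_ (.assign _ _ _))))), ?_, ?_, fun i hi => ?_⟩
  · convert r₂ using 1
    simp only [WExpr.eval]
    rw [Function.update_of_ne (by omega : m ≠ m + 1)]
  · simp only [WExpr.cost, WExpr.eval, BTree.size, Polynomial.eval_add, Polynomial.eval_mul,
      Polynomial.eval_ofNat, Polynomial.eval_X, hs, h₁, h₂, e₂,
      Function.update_of_ne (by omega : m ≠ m + 1), e₁]
    unfold codeSize at *
    omega
  · simp [WExpr.eval, e₂, h₂, code_pair]
  · rw [Function.update_of_ne (by omega), f₂ i (by omega), Function.update_of_ne (by omega),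
      Function.update_of_ne (by omega), f₁ i (by omega), Function.update_of_ne (by omega)]

/-- Equality test, performed on the codes. -/
def sameCode (a b : α) : Bool := decide (code a = code b)

theorem sameCode_iff {a b : α} : sameCode a b = true ↔ a = b := by
  simp [sameCode, code_injective.eq_iff]

theorem same {f g : α → β} (hf : PolyTime f) (hg : PolyTime g) :
    PolyTime fun a => sameCode (f a) (g a) := by
  have key : PolyTime fun x : BTree × BTree => decide (x.1 = x.2) := by
    refine of_expr (.equal (.left (.var 0)) (.right (.var 0))) (5 * Polynomial.X + 3)
      fun x s hs => ?_
    refine ⟨by simp [WExpr.eval, code, hs, BTree.left, BTree.right], ?_⟩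
    have : ∀ b, (BTree.ofBool b).size ≤ 3 := by intro b; cases b <;> simp [BTree.ofBool, BTree.size]
    have := this (decide (x.1 = x.2))
    simp only [WExpr.cost, hs, code, WExpr.eval, BTree.left, id_eq, BTree.size, BTree.right,
      codeSize, Polynomial.eval_add, Polynomial.eval_mul, Polynomial.eval_ofNat,
      Polynomial.eval_X]
    omega
  exact key.comp ((hf.recode (f := fun a => code (f a)) fun _ => rfl).pair
    (hg.recode (f := fun a => code (g a)) fun _ => rfl))

theorem cond {c : α → Bool} {f g : α → β} (hc : PolyTime c) (hf : PolyTime f) (hg : PolyTime g) :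
    PolyTime fun a => bif c a then f a else g a := by
  obtain ⟨R, j, r, hj, hR⟩ := hc
  obtain ⟨P, k, p, hk, hP⟩ := hf
  obtain ⟨Q, l, q, hl, hQ⟩ := hg
  let m := max j (max k l)
  refine ⟨.seq (.assign m (.var 0)) (.seq R (.seq (.assign (m + 1) (.var 0))
      (.seq (.assign 0 (.var m)) (.cond (.var (m + 1)) P Q)))), m + 2,
    2 * Polynomial.X + r + p + q + 20, by omega, fun a s hs => ?_⟩
  obtain ⟨s₁, t₁, r₁, ht₁, h₁, f₁⟩ := hR a (Function.update s m (s 0))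
    (by rw [Function.update_of_ne (by omega), hs])
  have e₁ : s₁ m = code a := by rw [f₁ m (by omega), Function.update_self, hs]
  have hb : ∀ b : Bool, (code b).size ≤ 3 := by
    intro b; cases b <;> simp [code, BTree.ofBool, BTree.size]
  have hb := hb (c a)
  set s₂ := Function.update (Function.update s₁ (m + 1) (s₁ 0)) 0 (s₁ m) with hs₂
  have e₂ : s₂ 0 = code a := by simp [hs₂, e₁]
  have e₃ : s₂ (m + 1) = code (c a) := by simp [hs₂, h₁]
  have hpre : ∀ {s' t}, WProg.Run (.cond (.var (m + 1)) P Q) s₂ s' t → WProg.Run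
      (.seq (.assign m (.var 0)) (.seq R (.seq (.assign (m + 1) (.var 0))
      (.seq (.assign 0 (.var m)) (.cond (.var (m + 1)) P Q))))) s s'
      ((s 0).size + 1 + (t₁ + ((s₁ 0).size + 1 + ((s₁ m).size + 1 + t)))) := by
    intro s' t h
    refine .seq (.assign _ _ _) (.seq r₁ (.seq (.assign _ _ _) (.seq (.assign_eq ?_ ?_) h)))
    · simp only [WExpr.eval, hs₂]
      rw [Function.update_of_ne (by omega : m ≠ m + 1)]
    · simp only [WExpr.eval, WExpr.cost]
      rw [Function.update_of_ne (by omega : m ≠ m + 1)]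
  have hfr : ∀ i, m + 2 ≤ i → s₂ i = s i := fun i hi => by
    rw [hs₂, Function.update_of_ne (by omega), Function.update_of_ne (by omega), f₁ i (by omega),
      Function.update_of_ne (by omega)]
  rw [hs, h₁, e₁] at hpre
  cases hca : c a with
  | true =>
    obtain ⟨s₃, t₃, r₃, ht₃, h₃, f₃⟩ := hP a s₂ e₂
    refine ⟨s₃, _, hpre (.cond_true ?_ r₃), ?_, by simp only [hca, cond_true, h₃], fun i hi => ?_⟩
    · simp [WExpr.eval, e₃, hca, code, BTree.ofBool]
    · simp only [WExpr.cost, e₃, Polynomial.eval_add, Polynomial.eval_mul,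
        Polynomial.eval_ofNat, Polynomial.eval_X]
      unfold codeSize at *
      omega
    · rw [f₃ i (by omega), hfr i hi]
  | false =>
    obtain ⟨s₃, t₃, r₃, ht₃, h₃, f₃⟩ := hQ a s₂ e₂
    refine ⟨s₃, _, hpre (.cond_false ?_ r₃), ?_, by simp only [hca, cond_false, h₃], fun i hi => ?_⟩
    · simp [WExpr.eval, e₃, hca, code, BTree.ofBool]
    · simp only [WExpr.cost, e₃, Polynomial.eval_add, Polynomial.eval_mul,
        Polynomial.eval_ofNat, Polynomial.eval_X]
      unfold codeSize at *
      omega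
    · rw [f₃ i (by omega), hfr i hi]

/-- The body of the loop that folds a function computed by `P` over the list in variable `m + 2`,
with the accumulator in variable `m + 1` and the context in variable `m`. -/
def foldBody (P : WProg) (m : ℕ) : WProg :=
  .seq (.assign 0 (.cons (.var m) (.cons (.var (m + 1)) (.left (.var (m + 2))))))
    (.seq P (.seq (.assign (m + 1) (.var 0)) (.assign (m + 2) (.right (.var (m + 2))))))

/-- Loop invariant of the fold. With the context `x` fixed, `B` bounds every accumulator that occurs
and `N` the remaining list, so each round costs at most a fixed amount; one is added to the number
of rounds for the last test. -/
theorem run_foldBody {step : σ → γ → σ} {P : WProg} {k m n B N : ℕ} {p : Polynomial ℕ} {x : BTree}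
    (hk : 0 < k) (hkm : k ≤ m) (hn : x.size = n)
    (hP : ∀ acc e (s : Store), s 0 = .cons x (.cons (code acc) (code e)) → ∃ s' t, P.Run s s' t ∧
      t ≤ p.eval (n + (codeSize acc + codeSize e + 1) + 1) ∧ s' 0 = code (step acc e) ∧
      ∀ i, k ≤ i → s' i = s i)
    (l : List γ) : ∀ (acc : σ) (s : Store), s m = x → s (m + 1) = code acc → s (m + 2) = code l →
      (∀ l', l' <+: l → codeSize (l'.foldl step acc) ≤ B) → codeSize l ≤ N →
      ∃ s' t, WProg.Run (.loop (.var (m + 2)) (foldBody P m)) s s' t ∧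
        t ≤ (l.length + 1) * (p.eval (n + B + N + 2) + 10 * (n + B + N + 10)) ∧
        s' (m + 1) = code (l.foldl step acc) ∧ ∀ i, m + 3 ≤ i → s' i = s i := by
  induction l with
  | nil =>
    intro acc s _ h₁ h₂ _ _
    refine ⟨s, _, .loop_done (by simp [WExpr.eval, h₂, code_nil]), ?_, by simpa using h₁,
      fun _ _ => rfl⟩
    simp only [WExpr.cost, h₂, code_nil, BTree.size, List.length_nil]
    nlinarith [Nat.zero_le (p.eval (n + B + N + 2))]
  | cons e l ih =>
    intro acc s h₀ h₁ h₂ hB hN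
    rw [codeSize_cons] at hN
    have hB₀ := hB [] (List.nil_prefix)
    have hB₁ := hB [e] (by simp)
    simp only [List.foldl_nil, List.foldl_cons] at hB₀ hB₁
    set s₁ := Function.update s 0 (.cons x (.cons (code acc) (code e))) with hs₁
    obtain ⟨s₂, t₂, r₂, ht₂, e₂, f₂⟩ := hP acc e s₁ (by simp [hs₁])
    set s₃ := Function.update s₂ (m + 1) (s₂ 0) with hs₃
    set s₄ := Function.update s₃ (m + 2) (code l) with hs₄
    have hs₁' : ∀ i, 0 < i → s₁ i = s i := fun i hi => Function.update_of_ne (by omega) _ _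
    have g₃ : s₃ (m + 2) = .cons (code e) (code l) := by
      rw [hs₃, Function.update_of_ne (by omega), f₂ _ (by omega), hs₁' _ (by omega), h₂, code_cons]
    obtain ⟨s₅, t₅, r₅, ht₅, e₅, f₅⟩ := ih (step acc e) s₄
      (by rw [hs₄, Function.update_of_ne (by omega), hs₃, Function.update_of_ne (by omega),
        f₂ _ hkm, hs₁' _ (by omega), h₀])
      (by rw [hs₄, Function.update_of_ne (by omega), hs₃, Function.update_self, e₂])
      (by rw [hs₄, Function.update_self])
      (fun l' hl' => by
        have := hB (e :: l') (List.cons_prefix_cons.2 ⟨rfl, hl'⟩)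
        simpa using this)
      (by omega)
    have hp := p.eval_le_eval_of_le
      (show n + (codeSize acc + codeSize e + 1) + 1 ≤ n + B + N + 2 by omega)
    have rbody : (foldBody P m).Run s s₄ ((WExpr.cost s (.cons (.var m) (.cons (.var (m + 1))
        (.left (.var (m + 2)))))) + 1 + (t₂ + ((s₂ 0).size + 1 +
          (WExpr.cost s₃ (.right (.var (m + 2))) + 1)))) := by
      refine .seq (.assign_eq (s' := s₁) ?_ rfl) (.seq r₂ (.seq (.assign_eq (s' := s₃) ?_ rfl)
        (.assign_eq ?_ rfl)))
      · simp [hs₁, WExpr.eval, h₀, h₁, h₂, code_cons, BTree.left]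
      · rfl
      · simp [hs₄, WExpr.eval, g₃, BTree.right]
    refine ⟨s₅, _, .loop_step (by simp [WExpr.eval, h₂, code_cons]) rbody r₅, ?_, by simpa using e₅,
      fun i hi => ?_⟩
    · have hcost : WExpr.cost s (.var (m + 2)) + 1 +
          ((WExpr.cost s (.cons (.var m) (.cons (.var (m + 1)) (.left (.var (m + 2)))))) + 1 +
          (t₂ + ((s₂ 0).size + 1 + (WExpr.cost s₃ (.right (.var (m + 2))) + 1)))) ≤
          p.eval (n + B + N + 2) + 10 * (n + B + N + 10) := by
        simp only [WExpr.cost, WExpr.eval, h₀, h₁, h₂, e₂, g₃, code_cons, BTree.left, BTree.right,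
          BTree.size]
        unfold codeSize at *
        omega
      rw [List.length_cons, add_mul (l.length + 1), one_mul]
      omega
    · rw [f₅ i hi, hs₄, Function.update_of_ne (by omega), hs₃, Function.update_of_ne (by omega),
        f₂ _ (by omega), hs₁' _ (by omega)]

/-- The bound on the accumulators at all prefixes has to be assumed: a polynomial-time step may
square the size in each round, and iterating it would exceed every polynomial. -/
theorem foldl {l : α → List γ} {init : α → σ} {step : α → σ → γ → σ} (hl : PolyTime l)
    (hinit : PolyTime init) (hstep : PolyTime fun z : α × σ × γ => step z.1 z.2.1 z.2.2)
    (hq : ∃ q : Polynomial ℕ, ∀ a l', l' <+: l a →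
      codeSize (l'.foldl (step a) (init a)) ≤ q.eval (codeSize a)) :
    PolyTime fun a => (l a).foldl (step a) (init a) := by
  obtain ⟨q, hq⟩ := hq
  obtain ⟨P, k, p, hk, hP⟩ := hstep
  obtain ⟨P', k', p', hk', hP'⟩ := hinit.pair (PolyTime.id.pair hl)
  obtain ⟨N, hN⟩ := hl.codeSize_le
  let m := max k k'
  refine ⟨.seq P' (.seq (.assign (m + 1) (.left (.var 0))) (.seq (.assign m
      (.left (.right (.var 0)))) (.seq (.assign (m + 2) (.right (.right (.var 0))))
      (.seq (.loop (.var (m + 2)) (foldBody P m)) (.assign 0 (.var (m + 1))))))), m + 3,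
    p' + (N + 1) * (p.comp (Polynomial.X + q + N + 2) + 10 * (Polynomial.X + q + N + 10)) +
      20 * (Polynomial.X + q + N + 10), by omega, fun a s hs => ?_⟩
  obtain ⟨s₁, t₁, r₁, ht₁, e₁, f₁⟩ := hP' a s hs
  simp only [code_pair] at e₁
  set s₂ := Function.update s₁ (m + 1) (code (init a)) with hs₂
  set s₃ := Function.update s₂ m (code a) with hs₃
  set s₄ := Function.update s₃ (m + 2) (code (l a)) with hs₄
  have g₂ : s₂ 0 = s₁ 0 := by rw [hs₂, Function.update_of_ne (by omega)]
  have g₃ : s₃ 0 = s₁ 0 := by rw [hs₃, Function.update_of_ne (by omega), g₂]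
  have hrun := run_foldBody (step := step a) (B := q.eval (codeSize a)) (N := N.eval (codeSize a))
    (p := p) (x := code a) (n := codeSize a) (m := m) hk (by omega) rfl
    (fun acc e s hs => hP (a, acc, e) s hs) (l a) (init a) s₄
    (by rw [hs₄, Function.update_of_ne (by omega), hs₃, Function.update_self])
    (by rw [hs₄, Function.update_of_ne (by omega), hs₃, Function.update_of_ne (by omega), hs₂,
      Function.update_self])
    (by rw [hs₄, Function.update_self]) (hq a) (hN a)
  obtain ⟨s₅, t₅, r₅, ht₅, e₅, f₅⟩ := hrun
  refine ⟨_, _, .seq r₁ (.seq (.assign_eq (s' := s₂) ?_ rfl) (.seq (.assign_eq (s' := s₃) ?_ rfl)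
    (.seq (.assign_eq (s' := s₄) ?_ rfl) (.seq r₅ (.assign _ _ _))))), ?_, ?_, fun i hi => ?_⟩
  · simp [hs₂, WExpr.eval, e₁, BTree.left]
  · simp [hs₃, WExpr.eval, g₂, e₁, BTree.left, BTree.right]
  · simp [hs₄, WExpr.eval, g₃, e₁, BTree.right]
  · have hlen := length_lt_codeSize (l a)
    have hNa := hN a
    have hinit := hq a [] List.nil_prefix
    have hfin := hq a _ (List.prefix_refl _)
    simp only [List.foldl_nil] at hinit
    have hmul := Nat.mul_le_mul_right (p.eval (codeSize a + q.eval (codeSize a) +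
      N.eval (codeSize a) + 2) + 10 * (codeSize a + q.eval (codeSize a) + N.eval (codeSize a) + 10))
      (show (l a).length + 1 ≤ N.eval (codeSize a) + 1 by omega)
    simp only [WExpr.cost, WExpr.eval, g₂, g₃, e₁, e₅, BTree.left, BTree.right, BTree.size,
      Polynomial.eval_add, Polynomial.eval_mul, Polynomial.eval_comp, Polynomial.eval_X,
      Polynomial.eval_ofNat, Polynomial.eval_one]
    unfold codeSize at *
    omega
  · simp [WExpr.eval, e₅]
  · rw [Function.update_of_ne (by omega), f₅ i hi, hs₄, Function.update_of_ne (by omega), hs₃,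
      Function.update_of_ne (by omega), hs₂, Function.update_of_ne (by omega), f₁ i (by omega)]

/-- If a step adds an amount that is bounded in terms of the context and the list member alone, the
total growth is at most the length of the list times that amount. -/
theorem foldl_of_additive {l : α → List γ} {init : α → σ} {step : α → σ → γ → σ} (hl : PolyTime l)
    (hinit : PolyTime init) (hstep : PolyTime fun z : α × σ × γ => step z.1 z.2.1 z.2.2)
    (hr : ∃ r : Polynomial ℕ, ∀ a acc e, codeSize (step a acc e) ≤
      codeSize acc + r.eval (codeSize (a, e))) :
    PolyTime fun a => (l a).foldl (step a) (init a) := by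
  obtain ⟨r, hr⟩ := hr
  obtain ⟨q, hq⟩ := hinit.codeSize_le
  obtain ⟨N, hN⟩ := hl.codeSize_le
  refine foldl hl hinit hstep ⟨q + N * r.comp (Polynomial.X + N + 1), fun a l' hl' => ?_⟩
  have key : ∀ (l' : List γ), (∀ e ∈ l', e ∈ l a) → ∀ acc, codeSize (l'.foldl (step a) acc) ≤
      codeSize acc + l'.length * r.eval (codeSize a + N.eval (codeSize a) + 1) := by
    intro l'
    induction l' with
    | nil => intro _ acc; simp
    | cons e l' ih =>
      intro hmem acc
      have h₁ := ih (fun e he => hmem e (by simp [he])) (step a acc e)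
      have h₂ := hr a acc e
      have h₃ : codeSize e ≤ N.eval (codeSize a) :=
        (codeSize_le_of_mem (hmem e (by simp))).trans (hN a)
      have h₄ := r.eval_le_eval_of_le
        (show codeSize (a, e) ≤ codeSize a + N.eval (codeSize a) + 1 by
          rw [codeSize_pair]; omega)
      rw [List.foldl_cons, List.length_cons, add_mul, one_mul]
      omega
  have h₁ := key l' (fun e he => hl'.subset he) (init a)
  have h₂ := hq a
  have h₃ : l'.length ≤ N.eval (codeSize a) :=
    hl'.length_le.trans ((length_lt_codeSize _).le.trans (hN a))
  have h₄ := Nat.mul_le_mul_right (r.eval (codeSize a + N.eval (codeSize a) + 1)) h₃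
  simp only [Polynomial.eval_add, Polynomial.eval_mul, Polynomial.eval_comp, Polynomial.eval_X,
    Polynomial.eval_one]
  omega

end PolyTime

/-! ### Polynomial-time operations on lists, numbers and queries -/

theorem codeSize_bool_le (b : Bool) : codeSize b ≤ 3 := by
  cases b <;> simp [codeSize, code, BTree.ofBool, BTree.size]

theorem codeSize_append {α : Type*} [TreeCode α] (l m : List α) :
    codeSize (l ++ m) + 1 = codeSize l + codeSize m := by
  induction l with
  | nil => simp [codeSize_nil, add_comm]
  | cons a l ih => simp only [List.cons_append, codeSize_cons]; omega

namespace PolyTime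

variable {α β γ δ σ : Type*} [TreeCode α] [TreeCode β] [TreeCode γ] [TreeCode δ] [TreeCode σ]

theorem not {f : α → Bool} (hf : PolyTime f) : PolyTime fun a => !f a :=
  (hf.cond (.const false) (.const true)).recode fun a => by cases f a <;> rfl

theorem and {f g : α → Bool} (hf : PolyTime f) (hg : PolyTime g) : PolyTime fun a => f a && g a :=
  (hf.cond hg (.const false)).recode fun a => by cases f a <;> rfl

theorem or {f g : α → Bool} (hf : PolyTime f) (hg : PolyTime g) : PolyTime fun a => f a || g a :=
  (hf.cond (.const true) hg).recode fun a => by cases f a <;> rfl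

theorem cons {f : α → β} {l : α → List β} (hf : PolyTime f) (hl : PolyTime l) :
    PolyTime fun a => f a :: l a :=
  (hf.pair hl).recode fun _ => rfl

theorem tail {l : α → List β} (hl : PolyTime l) : PolyTime fun a => (l a).tail :=
  hl.right fun a => by cases l a <;> rfl

theorem reverse {l : α → List β} (hl : PolyTime l) : PolyTime fun a => (l a).reverse := by
  refine (foldl_of_additive (step := fun _ acc e => e :: acc) hl (.const [])
    (.cons (snd (snd .id)) (fst (snd .id))) ⟨Polynomial.X + 1, fun a acc e => ?_⟩).recode
    fun a => ?_
  · simp only [codeSize_cons, codeSize_pair, Polynomial.eval_add, Polynomial.eval_X,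
      Polynomial.eval_one]
    omega
  · congr 1
    simp

theorem foldr {l : α → List γ} {init : α → σ} {step : α → γ → σ → σ} (hl : PolyTime l)
    (hinit : PolyTime init) (hstep : PolyTime fun z : α × σ × γ => step z.1 z.2.2 z.2.1)
    (hq : ∃ q : Polynomial ℕ, ∀ a l', l' <:+ l a →
      codeSize (l'.foldr (step a) (init a)) ≤ q.eval (codeSize a)) :
    PolyTime fun a => (l a).foldr (step a) (init a) := by
  obtain ⟨q, hq⟩ := hq
  refine (foldl (step := fun a acc e => step a e acc) hl.reverse hinit hstep
    ⟨q, fun a l' hl' => ?_⟩).recode fun a => ?_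
  · have := hq a l'.reverse (by rw [← List.reverse_prefix]; simpa using hl')
    rwa [List.foldr_reverse] at this
  · rw [List.foldl_reverse]

theorem foldr_of_additive {l : α → List γ} {init : α → σ} {step : α → γ → σ → σ} (hl : PolyTime l)
    (hinit : PolyTime init) (hstep : PolyTime fun z : α × σ × γ => step z.1 z.2.2 z.2.1)
    (hr : ∃ r : Polynomial ℕ, ∀ a acc e, codeSize (step a e acc) ≤
      codeSize acc + r.eval (codeSize (a, e))) :
    PolyTime fun a => (l a).foldr (step a) (init a) :=
  (foldl_of_additive (step := fun a acc e => step a e acc) hl.reverse hinit hstep hr).recode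
    fun a => by rw [List.foldl_reverse]

theorem append {l m : α → List β} (hl : PolyTime l) (hm : PolyTime m) :
    PolyTime fun a => l a ++ m a := by
  refine (foldr_of_additive (step := fun _ e acc => e :: acc) hl hm
    (.cons (snd (snd .id)) (fst (snd .id))) ⟨Polynomial.X + 1, fun a acc e => ?_⟩).recode
    fun a => by simp
  simp only [codeSize_cons, codeSize_pair, Polynomial.eval_add, Polynomial.eval_X,
    Polynomial.eval_one]
  omega

theorem flatMap {l : α → List γ} {f : α → γ → List δ} (hl : PolyTime l)
    (hf : PolyTime fun z : α × γ => f z.1 z.2) : PolyTime fun a => (l a).flatMap (f a) := by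
  obtain ⟨r, hr⟩ := hf.codeSize_le
  refine (foldr_of_additive (step := fun a e acc => f a e ++ acc) hl (.const [])
    (.append (hf.comp ((fst .id).pair (snd (snd .id)))) (fst (snd .id))) ⟨r, fun a acc e => ?_⟩
    ).recode fun a => ?_
  · have := hr (a, e)
    have := codeSize_append (f a e) acc
    simp only at *
    omega
  · congr 1
    induction l a <;> simp_all

theorem map {l : α → List γ} {f : α → γ → δ} (hl : PolyTime l)
    (hf : PolyTime fun z : α × γ => f z.1 z.2) : PolyTime fun a => (l a).map (f a) :=
  (hl.flatMap (f := fun a e => [f a e]) (hf.cons (.const []))).recode fun a => by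
    rw [List.map_eq_flatMap]

theorem filter {l : α → List γ} {p : α → γ → Bool} (hl : PolyTime l)
    (hp : PolyTime fun z : α × γ => p z.1 z.2) : PolyTime fun a => (l a).filter (p a) :=
  (hl.flatMap (f := fun a e => bif p a e then [e] else [])
    (hp.cond ((snd .id).cons (.const [])) (.const []))).recode fun a => by
    congr 1
    induction l a with
    | nil => rfl
    | cons e l ih => cases h : p a e <;> simp_all

theorem any {l : α → List γ} {p : α → γ → Bool} (hl : PolyTime l)
    (hp : PolyTime fun z : α × γ => p z.1 z.2) : PolyTime fun a => (l a).any (p a) := by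
  refine (foldr_of_additive (step := fun a e acc => p a e || acc) hl (.const false)
    (.or (hp.comp ((fst .id).pair (snd (snd .id)))) (fst (snd .id))) ⟨3, fun a acc e => ?_⟩
    ).recode fun a => ?_
  · have := codeSize_bool_le (p a e || acc)
    rw [Polynomial.eval_ofNat]
    omega
  · congr 1
    induction l a <;> simp_all

theorem all {l : α → List γ} {p : α → γ → Bool} (hl : PolyTime l)
    (hp : PolyTime fun z : α × γ => p z.1 z.2) : PolyTime fun a => (l a).all (p a) :=
  (hl.any hp.not).not.recode fun a => by rw [List.all_eq_not_any_not]

theorem contains {l : α → List β} {f : α → β} (hl : PolyTime l) (hf : PolyTime f) :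
    PolyTime fun a => (l a).any fun b => sameCode (f a) b :=
  hl.any ((hf.comp (fst .id)).same (snd .id))

end PolyTime

/-! ### Binary arithmetic in polynomial time. -/

theorem Nat.foldr_bit_bits (n : ℕ) : n.bits.foldr Nat.bit 0 = n := by
  induction n using Nat.binaryRec' with
  | zero => simp
  | bit b n hn ih => rw [Nat.bits_append_bit n b hn, List.foldr_cons, ih]

instance : TreeCode ℕ :=
  ⟨encNat, fun m n h => by
    have := encList_injective (code_injective (α := Bool)) h
    rw [← Nat.foldr_bit_bits m, this, Nat.foldr_bit_bits]⟩

theorem code_nat (n : ℕ) : code n = code n.bits := rfl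

/-- The least significant digit comes first, so parity is the head of the digit list and halving is
its tail. -/
theorem code_bodd (n : ℕ) : code n.bodd = (code n).left := by
  rw [code_nat, Nat.bodd_eq_bits_head]
  cases n.bits <;> rfl

theorem code_div2 (n : ℕ) : code n.div2 = (code n).right := by
  rw [code_nat, code_nat, Nat.div2_bits_eq_tail]
  cases n.bits <;> rfl

theorem codeSize_div2_le (n : ℕ) : codeSize n.div2 ≤ codeSize n := by
  rw [codeSize, codeSize, code_div2]
  cases code n <;> simp [BTree.right, BTree.size]
  omega

theorem size_le_codeSize (n : ℕ) : n.size ≤ codeSize n := by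
  rw [← Nat.size_eq_bits_len]
  exact (length_lt_codeSize n.bits).le

theorem codeSize_nat_le (n : ℕ) : codeSize n ≤ 4 * n.size + 1 := by
  have : ∀ l : List Bool, codeSize l ≤ 4 * l.length + 1 := by
    intro l
    induction l with
    | nil => simp [codeSize_nil]
    | cons b l ih =>
      have := codeSize_bool_le b
      rw [codeSize_cons, List.length_cons]
      omega
  rw [← Nat.size_eq_bits_len]
  exact this n.bits

theorem Nat.div2_lt_two_pow {n k : ℕ} (h : n < 2 ^ (k + 1)) : n.div2 < 2 ^ k := by
  rw [Nat.div2_val, Nat.div_lt_iff_lt_mul two_pos, ← pow_succ]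
  exact h

/-- One step of the comparison of binary numbers, from the least significant digit on. -/
def Nat.leStep (s : ℕ × ℕ × Bool) : ℕ × ℕ × Bool :=
  (s.1.div2, s.2.1.div2,
    bif PolyTime.sameCode s.1.bodd s.2.1.bodd then s.2.2 else s.2.1.bodd)

/-- The flag records the comparison of the digits already removed, and it matters only if the
remaining numbers agree. Once both numbers are used up, the flag is the answer. -/
theorem Nat.leStep_spec (s : ℕ × ℕ × Bool) :
    ((leStep s).1 < (leStep s).2.1 ∨ (leStep s).1 = (leStep s).2.1 ∧ (leStep s).2.2 = true) ↔
      (s.1 < s.2.1 ∨ s.1 = s.2.1 ∧ s.2.2 = true) := by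
  obtain ⟨m, n, r⟩ := s
  have hm := Nat.bodd_add_div2 m
  have hn := Nat.bodd_add_div2 n
  simp only [leStep]
  cases h₁ : m.bodd <;> cases h₂ : n.bodd <;> cases r <;>
    simp [PolyTime.sameCode, code, BTree.ofBool, h₁, h₂] at hm hn ⊢ <;> omega

theorem Nat.foldl_leStep {β : Type*} (l : List β) (s : ℕ × ℕ × Bool) (h₁ : s.1 < 2 ^ l.length)
    (h₂ : s.2.1 < 2 ^ l.length) : (l.foldl (fun s _ => leStep s) s).2.2 = true ↔
      (s.1 < s.2.1 ∨ s.1 = s.2.1 ∧ s.2.2 = true) := by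
  induction l generalizing s with
  | nil =>
    obtain ⟨m, n, r⟩ := s
    simp at h₁ h₂
    simp [h₁, h₂]
  | cons b l ih =>
    rw [List.foldl_cons, ih _ (Nat.div2_lt_two_pow h₁) (Nat.div2_lt_two_pow h₂), leStep_spec]

/-- One step of the addition of binary numbers: the state consists of the carry, the remaining
digits of both summands, and the digits of the sum that are already known, in reverse order. -/
def Nat.addStep (s : Bool × ℕ × ℕ × List Bool) : Bool × ℕ × ℕ × List Bool :=
  (bif s.1 then s.2.1.bodd || s.2.2.1.bodd else s.2.1.bodd && s.2.2.1.bodd,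
    s.2.1.div2, s.2.2.1.div2,
    (bif s.1 then PolyTime.sameCode s.2.1.bodd s.2.2.1.bodd
      else !PolyTime.sameCode s.2.1.bodd s.2.2.1.bodd) :: s.2.2.2)

/-- The invariant is the number obtained by appending the known digits, as low-order digits, to the
sum of the carry and the remaining summands. -/
theorem Nat.addStep_spec (s : Bool × ℕ × ℕ × List Bool) :
    (addStep s).2.2.2.foldl (fun n b => Nat.bit b n)
      ((addStep s).1.toNat + (addStep s).2.1 + (addStep s).2.2.1) =
    s.2.2.2.foldl (fun n b => Nat.bit b n) (s.1.toNat + s.2.1 + s.2.2.1) := by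
  obtain ⟨c, m, n, o⟩ := s
  have hm := Nat.bodd_add_div2 m
  have hn := Nat.bodd_add_div2 n
  simp only [addStep, List.foldl_cons]
  congr 1
  rw [Nat.bit_val]
  cases h₁ : m.bodd <;> cases h₂ : n.bodd <;> cases c <;>
    simp [PolyTime.sameCode, code, BTree.ofBool, h₁, h₂] at hm hn ⊢ <;> omega

theorem Nat.foldl_addStep {β : Type*} (l : List β) (s : Bool × ℕ × ℕ × List Bool)
    (h₁ : s.2.1 < 2 ^ l.length) (h₂ : s.2.2.1 < 2 ^ l.length) :
    (l.foldl (fun s _ => addStep s) s).2.2.2.foldl (fun n b => Nat.bit b n)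
      (l.foldl (fun s _ => addStep s) s).1.toNat =
    s.2.2.2.foldl (fun n b => Nat.bit b n) (s.1.toNat + s.2.1 + s.2.2.1) := by
  induction l generalizing s with
  | nil =>
    obtain ⟨c, m, n, o⟩ := s
    simp at h₁ h₂
    simp [h₁, h₂]
  | cons b l ih =>
    rw [List.foldl_cons, ih _ (Nat.div2_lt_two_pow h₁) (Nat.div2_lt_two_pow h₂), addStep_spec]

/-- The concatenated digit lists serve only as a clock that runs long enough for either number. -/
theorem Nat.lt_two_pow_length_bits_append_left (m n : ℕ) :
    m < 2 ^ (m.bits ++ n.bits).length := by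
  rw [List.length_append, Nat.size_eq_bits_len, Nat.size_eq_bits_len]
  exact (Nat.lt_size_self m).trans_le (Nat.pow_le_pow_right two_pos (by omega))

theorem Nat.lt_two_pow_length_bits_append_right (m n : ℕ) :
    n < 2 ^ (m.bits ++ n.bits).length := by
  rw [List.length_append, Nat.size_eq_bits_len, Nat.size_eq_bits_len]
  exact (Nat.lt_size_self n).trans_le (Nat.pow_le_pow_right two_pos (by omega))

theorem Nat.foldr_double_add_lt (y : ℕ) (l : List Bool) :
    l.foldr (fun b acc => 2 * acc + bif b then y else 0) 0 < 2 ^ l.length * 2 ^ y.size := by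
  -- The summand `y` on the left makes the induction close: `2 * acc + y + y = 2 * (acc + y)`.
  have key : l.foldr (fun b acc => 2 * acc + bif b then y else 0) 0 + y ≤ 2 ^ l.length * y := by
    induction l with
    | nil => simp
    | cons b l ih =>
      rw [List.foldr_cons, List.length_cons, pow_succ, mul_right_comm]
      cases b <;> simp <;> omega
  rcases Nat.eq_zero_or_pos y with rfl | hy
  · rw [mul_zero, add_zero] at key
    exact key.trans_lt (by positivity)
  · calc _ < 2 ^ l.length * y := by omega
      _ ≤ _ := Nat.mul_le_mul_left _ (Nat.lt_size_self y).le

theorem Nat.foldr_double_add_bits (x y : ℕ) :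
    x.bits.foldr (fun b acc => 2 * acc + bif b then y else 0) 0 = x * y := by
  induction x using Nat.binaryRec' with
  | zero => simp
  | bit b n hn ih =>
    rw [Nat.bits_append_bit n b hn, List.foldr_cons, ih, Nat.bit_val]
    cases b <;> simp <;> ring

namespace PolyTime

variable {α β γ δ σ : Type*} [TreeCode α] [TreeCode β] [TreeCode γ] [TreeCode δ] [TreeCode σ]

theorem bits {f : α → ℕ} (hf : PolyTime f) : PolyTime fun a => (f a).bits :=
  hf.recode fun _ => rfl

theorem bodd {f : α → ℕ} (hf : PolyTime f) : PolyTime fun a => (f a).bodd :=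
  hf.left fun a => code_bodd (f a)

theorem div2 {f : α → ℕ} (hf : PolyTime f) : PolyTime fun a => (f a).div2 :=
  hf.right fun a => code_div2 (f a)

theorem bit {b : α → Bool} {f : α → ℕ} (hb : PolyTime b) (hf : PolyTime f) :
    PolyTime fun a => Nat.bit (b a) (f a) := by
  -- Zero has no digits, so prepending the digit `false` to it would not give the code of a number.
  refine ((hf.same (.const 0)).and hb.not |>.cond (.const [])
    (hb.cons hf.bits)).recode fun a => ?_
  cases h : (sameCode (f a) 0 && !b a) with
  | true =>
    simp only [Bool.and_eq_true, sameCode_iff, Bool.not_eq_true'] at h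
    rw [h.1, h.2]
    rfl
  | false =>
    simp only [Bool.and_eq_false_iff, Bool.not_eq_false'] at h
    rw [cond_false, code_nat, Nat.bits_append_bit]
    intro h0
    rcases h with h | h
    · rw [← Bool.not_eq_true, sameCode_iff] at h
      exact absurd h0 h
    · exact h

theorem natLe {f g : α → ℕ} (hf : PolyTime f) (hg : PolyTime g) :
    PolyTime fun a => decide (f a ≤ g a) := by
  have hs : PolyTime Nat.leStep :=
    .pair (.div2 (.fst .id)) (.pair (.div2 (.fst (.snd .id))) (.cond
      (.same (.bodd (.fst .id)) (.bodd (.fst (.snd .id)))) (.snd (.snd .id))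
      (.bodd (.fst (.snd .id)))))
  have key := (foldl_of_additive (l := fun a => (f a).bits ++ (g a).bits)
    (init := fun a => (f a, g a, true)) (step := fun _ s _ => Nat.leStep s)
    (hf.bits.append hg.bits) (hf.pair (hg.pair (.const true))) (hs.comp (fst (snd .id)))
    ⟨3, fun a s e => by
      have h₁ := codeSize_div2_le s.1
      have h₂ := codeSize_div2_le s.2.1
      have h₃ := codeSize_bool_le (bif sameCode s.1.bodd s.2.1.bodd then s.2.2 else s.2.1.bodd)
      obtain ⟨m, n, r⟩ := s
      simp only [Nat.leStep, codeSize_pair, Polynomial.eval_ofNat] at *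
      omega⟩).snd.snd
  refine key.recode fun a => ?_
  congr 1
  rw [Bool.eq_iff_iff, decide_eq_true_iff, Nat.foldl_leStep _ _
    (Nat.lt_two_pow_length_bits_append_left _ _) (Nat.lt_two_pow_length_bits_append_right _ _)]
  simp [le_iff_lt_or_eq]

theorem natAdd {f g : α → ℕ} (hf : PolyTime f) (hg : PolyTime g) :
    PolyTime fun a => f a + g a := by
  have hx : PolyTime fun s : Bool × ℕ × ℕ × List Bool => s.2.1.bodd := .bodd (.fst (.snd .id))
  have hy : PolyTime fun s : Bool × ℕ × ℕ × List Bool => s.2.2.1.bodd :=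
    .bodd (.fst (.snd (.snd .id)))
  have hs : PolyTime Nat.addStep :=
    .pair (.cond (.fst .id) (.or hx hy) (.and hx hy)) (.pair (.div2 (.fst (.snd .id)))
      (.pair (.div2 (.fst (.snd (.snd .id)))) (.cons (.cond (.fst .id) (.same hx hy)
        (.not (.same hx hy))) (.snd (.snd (.snd .id))))))
  have key := foldl_of_additive (l := fun a => (f a).bits ++ (g a).bits)
    (init := fun a => (false, f a, g a, ([] : List Bool))) (step := fun _ s _ => Nat.addStep s)
    (hf.bits.append hg.bits) (.pair (.const false) (hf.pair (hg.pair (.const []))))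
    (hs.comp (fst (snd .id)))
    ⟨10, fun a s e => by
      have h₁ := codeSize_div2_le s.2.1
      have h₂ := codeSize_div2_le s.2.2.1
      have h₃ := codeSize_bool_le (Nat.addStep s).1
      have h₄ : ∀ b, codeSize (b :: s.2.2.2) ≤ codeSize s.2.2.2 + 4 := fun b => by
        have := codeSize_bool_le b
        rw [codeSize_cons]
        omega
      have h₄ := h₄ (bif s.1 then sameCode s.2.1.bodd s.2.2.1.bodd
        else !sameCode s.2.1.bodd s.2.2.1.bodd)
      obtain ⟨c, m, n, o⟩ := s
      simp only [Nat.addStep, codeSize_pair, Polynomial.eval_ofNat] at *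
      omega⟩
  have key₂ := foldl_of_additive (step := fun _ n b => Nat.bit b n) key.snd.snd.snd
    (key.fst.cond (.const 1) (.const 0)) (.bit (snd (snd .id)) (fst (snd .id)))
    ⟨4, fun a n b => by
      have : codeSize (Nat.bit b n) ≤ codeSize n + 4 := by
        rcases Nat.eq_zero_or_pos n with rfl | hn
        · cases b <;> decide
        · have := codeSize_bool_le b
          have h : codeSize (Nat.bit b n) = codeSize (b :: n.bits) := by
            rw [codeSize, code_nat, Nat.bits_append_bit _ _ (by omega), ← codeSize]
          have h' : codeSize n.bits = codeSize n := rfl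
          rw [h, codeSize_cons, h']
          omega
      simpa using this⟩
  refine key₂.recode fun a => ?_
  congr 1
  have h : ∀ b : Bool, (bif b then 1 else 0) = b.toNat := by decide
  rw [h, Nat.foldl_addStep _ _
    (Nat.lt_two_pow_length_bits_append_left _ _) (Nat.lt_two_pow_length_bits_append_right _ _)]
  simp

theorem natMul {f g : α → ℕ} (hf : PolyTime f) (hg : PolyTime g) :
    PolyTime fun a => f a * g a := by
  obtain ⟨p, hp⟩ := hf.codeSize_le
  obtain ⟨q, hq⟩ := hg.codeSize_le
  refine (foldr (l := fun a => (f a).bits) (init := fun _ => 0)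
    (step := fun a b acc => 2 * acc + bif b then g a else 0) hf.bits (.const 0)
    (natAdd ?_ (.cond (snd (snd .id)) (hg.comp (fst .id)) (.const 0)))
    -- A partial product has at most as many digits as both factors together, and a digit accounts
    -- for at most four nodes.
    ⟨4 * (p + q) + 1, fun a l' hl' => ?_⟩).recode fun a => ?_
  · exact (bit (.const false) (fst (snd .id))).recode fun z => by simp [Nat.bit_val]
  · have h₁ := Nat.foldr_double_add_lt (g a) l'
    rw [← pow_add, ← Nat.size_le] at h₁
    have h₂ := codeSize_nat_le (l'.foldr (fun b acc => 2 * acc + bif b then g a else 0) 0)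
    have h₃ := hl'.length_le
    rw [Nat.size_eq_bits_len] at h₃
    have h₄ := size_le_codeSize (f a)
    have h₅ := size_le_codeSize (g a)
    have h₆ := hp a
    have h₇ := hq a
    simp only [Polynomial.eval_add, Polynomial.eval_mul, Polynomial.eval_ofNat,
      Polynomial.eval_one]
    omega
  · rw [Nat.foldr_double_add_bits]

end PolyTime

/-! ### Codes of rationals, terms, comparisons and queries. -/

instance : TreeCode ℚ :=
  ⟨encRat, fun q r h => by
    simp only [encRat, BTree.cons.injEq] at h
    obtain ⟨h₁, h₂, h₃⟩ := h
    have h₁ := code_injective (α := Bool) h₁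
    have h₂ := code_injective (α := ℕ) h₂
    have h₃ := code_injective (α := ℕ) h₃
    rw [decide_eq_decide, ← Rat.num_neg, ← Rat.num_neg] at h₁
    exact Rat.ext (by omega) h₃⟩

instance : TreeCode QTerm :=
  ⟨encTerm, fun s t h => by
    cases s <;> cases t <;> simp only [encTerm, BTree.cons.injEq] at h
    · rw [code_injective (α := ℕ) h.2]
    · cases h.1
    · cases h.1
    · rw [code_injective (α := ℚ) h.2]⟩

instance : TreeCode QAtom :=
  ⟨encAtom, fun a b h => by
    cases a; cases b
    simp only [encAtom, BTree.cons.injEq] at h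
    rw [code_injective (α := ℕ) h.1, code_injective (α := List QTerm) h.2]⟩

/-- The number by which a comparison symbol is encoded. -/
def CompOp.index : CompOp → ℕ
  | .lt => 0
  | .le => 1
  | .gt => 2
  | .ge => 3
  | .eq => 4
  | .ne => 5

theorem encOp_eq (o : CompOp) : encOp o = code o.index := by cases o <;> rfl

instance : TreeCode CompOp :=
  ⟨encOp, fun o o' h => by
    rw [encOp_eq, encOp_eq] at h
    have := code_injective h
    cases o <;> cases o' <;> simp_all [CompOp.index]⟩

instance : TreeCode Comparison :=
  ⟨encComparison, fun a b h => by
    cases a; cases b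
    simp only [encComparison, BTree.cons.injEq] at h
    rw [code_injective (α := QTerm) h.1, code_injective (α := CompOp) h.2.1,
      code_injective (α := QTerm) h.2.2]⟩

instance : TreeCode CQAC :=
  ⟨encQuery, fun a b h => by
    cases a; cases b
    simp only [encQuery, BTree.cons.injEq] at h
    rw [code_injective (α := List QTerm) h.1, code_injective (α := List QAtom) h.2.1,
      code_injective (α := List Comparison) h.2.2]⟩

/-! ### A satisfiability test for conjunctions of comparisons. -/

/-- Whether a term is a constant. -/
def QTerm.isConst : QTerm → Bool
  | .var _ => false
  | .const _ => true

/-- The value of a constant, and `0` for a variable. -/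
def QTerm.constVal : QTerm → ℚ
  | .var _ => 0
  | .const c => c

/-- Both terms are constants, the first one at most the second. -/
def QTerm.constLE (s t : QTerm) : Bool :=
  s.isConst && t.isConst && decide (s.constVal ≤ t.constVal)

/-- The complementary comparison symbol. -/
def CompOp.neg : CompOp → CompOp
  | .lt => .ge
  | .le => .gt
  | .gt => .le
  | .ge => .lt
  | .eq => .ne
  | .ne => .eq

/-- The negation of a comparison. -/
def Comparison.neg (a : Comparison) : Comparison := ⟨a.lhs, a.op.neg, a.rhs⟩

/-- The inequalities `s ≤ t` that a comparison states. -/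
def Comparison.edges (a : Comparison) : List (QTerm × QTerm) :=
  match a.op with
  | .lt => [(a.lhs, a.rhs)]
  | .le => [(a.lhs, a.rhs)]
  | .gt => [(a.rhs, a.lhs)]
  | .ge => [(a.rhs, a.lhs)]
  | .eq => [(a.lhs, a.rhs), (a.rhs, a.lhs)]
  | .ne => []

/-- The disequalities `s ≠ t` that a comparison states. -/
def Comparison.disequalities (a : Comparison) : List (QTerm × QTerm) :=
  match a.op with
  | .lt => [(a.lhs, a.rhs)]
  | .le => []
  | .gt => [(a.lhs, a.rhs)]
  | .ge => []
  | .eq => []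
  | .ne => [(a.lhs, a.rhs)]

/-- The terms that occur in a list of comparisons. -/
def acTerms (β : List Comparison) : List QTerm := β.flatMap fun a => [a.lhs, a.rhs]

/-- All pairs of members of a list. -/
def allPairs {α : Type*} (l : List α) : List (α × α) := l.flatMap fun a => l.map fun b => (a, b)

/-- Membership test, performed on the codes. -/
def memCode {α : Type*} [TreeCode α] (a : α) (l : List α) : Bool :=
  l.any fun b => PolyTime.sameCode a b

theorem memCode_iff {α : Type*} [TreeCode α] {a : α} {l : List α} :
    memCode a l = true ↔ a ∈ l := by
  simp [memCode, PolyTime.sameCode_iff]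

/-- Extension of a reachability relation `R` on the pairs in `P` by an edge `e`. -/
def addEdge (P R : List (QTerm × QTerm)) (e : QTerm × QTerm) : List (QTerm × QTerm) :=
  P.filter fun p => memCode p R || memCode (p.1, e.1) R && memCode (e.2, p.2) R

/-- The pairs in `P` of equal terms and of constants in increasing order. -/
def initialPairs (P : List (QTerm × QTerm)) : List (QTerm × QTerm) :=
  P.filter fun p => PolyTime.sameCode p.1 p.2 || p.1.constLE p.2

/-- The pairs of terms of `β` for which `s ≤ t` follows from the inequalities in `β`. -/
def lePairs (β : List Comparison) : List (QTerm × QTerm) :=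
  (β.flatMap Comparison.edges).foldl (addEdge (allPairs (acTerms β)))
    (initialPairs (allPairs (acTerms β)))

/-- The pairs of terms of `β` that have to be different. -/
def nePairs (β : List Comparison) : List (QTerm × QTerm) :=
  β.flatMap Comparison.disequalities ++
    (allPairs (acTerms β)).filter fun p =>
      (p.1.isConst && p.2.isConst) && !PolyTime.sameCode p.1 p.2

/-- Decision procedure for the satisfiability of a conjunction of comparisons. -/
def satTest (β : List Comparison) : Bool :=
  (nePairs β).all fun p => !(memCode p (lePairs β) && memCode (p.2, p.1) (lePairs β))

/-- Decision procedure for the implication of a comparison. -/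
def impTest (β : List Comparison) (a : Comparison) : Bool := !satTest (a.neg :: β)

/-! ### The satisfiability test runs in polynomial time. -/

namespace PolyTime

variable {α β γ δ : Type*} [TreeCode α] [TreeCode β] [TreeCode γ] [TreeCode δ]

/-- Once the signs are known, cross-multiplication reduces the question to natural numbers, with the
order reversed if both numbers are negative. -/
theorem ratLe {f g : α → ℚ} (hf : PolyTime f) (hg : PolyTime g) :
    PolyTime fun a => decide (f a ≤ g a) := by
  have hneg : PolyTime fun q : ℚ => decide (q < 0) := left .id fun _ => rfl
  have habs : PolyTime fun q : ℚ => (q.num.natAbs, q.den) := right .id fun _ => rfl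
  have hx : PolyTime fun z : ℚ × ℚ => z.1.num.natAbs * z.2.den :=
    natMul (fst (habs.comp (fst .id))) (snd (habs.comp (snd .id)))
  have hy : PolyTime fun z : ℚ × ℚ => z.2.num.natAbs * z.1.den :=
    natMul (fst (habs.comp (snd .id))) (snd (habs.comp (fst .id)))
  have key : PolyTime fun z : ℚ × ℚ => bif decide (z.1 < 0)
      then bif decide (z.2 < 0)
        then decide (z.2.num.natAbs * z.1.den ≤ z.1.num.natAbs * z.2.den) else true
      else bif decide (z.2 < 0) then false
        else decide (z.1.num.natAbs * z.2.den ≤ z.2.num.natAbs * z.1.den) :=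
    (hneg.comp (fst .id)).cond ((hneg.comp (snd .id)).cond (natLe hy hx) (.const true))
      ((hneg.comp (snd .id)).cond (.const false) (natLe hx hy))
  refine (key.comp (hf.pair hg)).recode fun a => ?_
  congr 1
  simp only
  generalize f a = q
  generalize g a = r
  have hq := q.den_pos
  have hr := r.den_pos
  by_cases h₁ : q < 0 <;> by_cases h₂ : r < 0 <;>
    simp only [h₁, h₂, decide_true, decide_false, cond_true, cond_false, decide_eq_decide,
      decide_eq_true_iff, decide_eq_false_iff_not]
  · rw [Rat.le_iff]
    rw [← Rat.num_neg] at h₁ h₂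
    zify
    rw [abs_of_neg h₁, abs_of_neg h₂]
    constructor <;> intro h <;> linarith
  · linarith
  · linarith
  · rw [Rat.le_iff]
    rw [not_lt, ← Rat.num_nonneg] at h₁ h₂
    zify
    rw [abs_of_nonneg h₁, abs_of_nonneg h₂]

theorem isConst {f : α → QTerm} (hf : PolyTime f) : PolyTime fun a => (f a).isConst :=
  hf.left fun a => by cases f a <;> rfl

theorem constVal {f : α → QTerm} (hf : PolyTime f) : PolyTime fun a => (f a).constVal := by
  refine (hf.isConst.cond (hf.right (f := fun a => (code (f a)).right) fun _ => rfl)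
    (.const (code (0 : ℚ)))).recode fun a => ?_
  cases f a <;> rfl

theorem constLE {f g : α → QTerm} (hf : PolyTime f) (hg : PolyTime g) :
    PolyTime fun a => (f a).constLE (g a) :=
  (hf.isConst.and hg.isConst).and (hf.constVal.ratLe hg.constVal)

theorem compLhs {f : α → Comparison} (hf : PolyTime f) : PolyTime fun a => (f a).lhs :=
  hf.left fun _ => rfl

theorem compOp {f : α → Comparison} (hf : PolyTime f) : PolyTime fun a => (f a).op :=
  (hf.right (f := fun a => ((f a).op, (f a).rhs)) fun _ => rfl).fst

theorem compRhs {f : α → Comparison} (hf : PolyTime f) : PolyTime fun a => (f a).rhs :=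
  (hf.right (f := fun a => ((f a).op, (f a).rhs)) fun _ => rfl).snd

theorem compMk {s t : α → QTerm} {o : α → CompOp} (hs : PolyTime s) (ho : PolyTime o)
    (ht : PolyTime t) : PolyTime fun a => (⟨s a, o a, t a⟩ : Comparison) :=
  (hs.pair (ho.pair ht)).recode fun _ => rfl

theorem atomRel {f : α → QAtom} (hf : PolyTime f) : PolyTime fun a => (f a).rel :=
  hf.left fun _ => rfl

theorem atomArgs {f : α → QAtom} (hf : PolyTime f) : PolyTime fun a => (f a).args :=
  hf.right fun _ => rfl

theorem queryHead {f : α → CQAC} (hf : PolyTime f) : PolyTime fun a => (f a).head :=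
  hf.left fun _ => rfl

theorem queryBody {f : α → CQAC} (hf : PolyTime f) : PolyTime fun a => (f a).body :=
  (hf.right (f := fun a => ((f a).body, (f a).acs)) fun _ => rfl).fst

theorem queryAcs {f : α → CQAC} (hf : PolyTime f) : PolyTime fun a => (f a).acs :=
  (hf.right (f := fun a => ((f a).body, (f a).acs)) fun _ => rfl).snd

/-- Case distinction on a comparison symbol. -/
theorem opCases {o : α → CompOp} {g : CompOp → α → β} (ho : PolyTime o)
    (hg : ∀ c, PolyTime (g c)) : PolyTime fun a => g (o a) a := by
  refine (((ho.same (.const .lt)).cond (hg .lt) ((ho.same (.const .le)).cond (hg .le)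
    ((ho.same (.const .gt)).cond (hg .gt) ((ho.same (.const .ge)).cond (hg .ge)
    ((ho.same (.const .eq)).cond (hg .eq) (hg .ne))))))).recode fun a => ?_
  congr 1
  cases o a <;> rfl

theorem compNeg {f : α → Comparison} (hf : PolyTime f) : PolyTime fun a => (f a).neg :=
  compMk hf.compLhs (opCases (g := fun o _ => o.neg) hf.compOp fun _ => .const _) hf.compRhs

theorem edges : PolyTime Comparison.edges := by
  have hl : PolyTime fun a : Comparison => (a.lhs, a.rhs) := .pair (compLhs .id) (compRhs .id)
  have hr : PolyTime fun a : Comparison => (a.rhs, a.lhs) := .pair (compRhs .id) (compLhs .id)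
  refine opCases (o := Comparison.op) (g := fun o a => Comparison.edges ⟨a.lhs, o, a.rhs⟩)
    (compOp .id) fun o => ?_
  cases o
  · exact hl.cons (.const [])
  · exact hl.cons (.const [])
  · exact hr.cons (.const [])
  · exact hr.cons (.const [])
  · exact hl.cons (hr.cons (.const []))
  · exact .const []

theorem disequalities : PolyTime Comparison.disequalities := by
  have hl : PolyTime fun a : Comparison => (a.lhs, a.rhs) := .pair (compLhs .id) (compRhs .id)
  refine opCases (o := Comparison.op)
    (g := fun o a => Comparison.disequalities ⟨a.lhs, o, a.rhs⟩) (compOp .id) fun o => ?_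
  cases o
  · exact hl.cons (.const [])
  · exact .const []
  · exact hl.cons (.const [])
  · exact .const []
  · exact .const []
  · exact hl.cons (.const [])

theorem acTerms {f : α → List Comparison} (hf : PolyTime f) : PolyTime fun a => acTerms (f a) :=
  hf.flatMap (f := fun _ (c : Comparison) => [c.lhs, c.rhs])
    (.cons (.compLhs (.snd .id)) (.cons (.compRhs (.snd .id)) (.const [])))

theorem allPairs {f : α → List β} (hf : PolyTime f) : PolyTime fun a => allPairs (f a) :=
  hf.flatMap (f := fun a b => (f a).map fun c => (b, c))
    ((hf.comp (fst .id)).map (f := fun (z : α × β) c => (z.2, c))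
      (.pair (.snd (.fst .id)) (.snd .id)))

theorem memCode {f : α → β} {l : α → List β} (hf : PolyTime f) (hl : PolyTime l) :
    PolyTime fun a => memCode (f a) (l a) :=
  hl.contains hf

theorem addEdge {P R : α → List (QTerm × QTerm)} {e : α → QTerm × QTerm} (hP : PolyTime P)
    (hR : PolyTime R) (he : PolyTime e) : PolyTime fun a => addEdge (P a) (R a) (e a) := by
  have hR' : PolyTime fun z : α × QTerm × QTerm => R z.1 := hR.comp (fst .id)
  have he' : PolyTime fun z : α × QTerm × QTerm => e z.1 := he.comp (fst .id)
  exact hP.filter (p := fun a p => _root_.memCode p (R a) ||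
      _root_.memCode (p.1, (e a).1) (R a) && _root_.memCode ((e a).2, p.2) (R a))
    (.or (.memCode (snd .id) hR') (.and (.memCode (.pair (.fst (.snd .id)) (.fst he')) hR')
      (.memCode (.pair (.snd he') (.snd (.snd .id))) hR')))

theorem codeSize_filter_le (l : List α) (p : α → Bool) : codeSize (l.filter p) ≤ codeSize l := by
  induction l with
  | nil => simp
  | cons a l ih =>
    cases h : p a <;> simp only [List.filter_cons, h, codeSize_cons] <;> simp [codeSize_cons] <;>
      omega

theorem lePairs {f : α → List Comparison} (hf : PolyTime f) : PolyTime fun a => lePairs (f a) := by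
  have hP := hf.acTerms.allPairs
  obtain ⟨r, hr⟩ := hP.codeSize_le
  refine foldl_of_additive (step := fun a => _root_.addEdge (_root_.allPairs (_root_.acTerms (f a))))
    (hf.flatMap (f := fun _ => Comparison.edges) (edges.comp (snd .id)))
    (hP.filter (p := fun _ (p : QTerm × QTerm) => sameCode p.1 p.2 || p.1.constLE p.2)
      (.or (.same (.fst (.snd .id)) (.snd (.snd .id)))
        (.constLE (.fst (.snd .id)) (.snd (.snd .id)))))
    (addEdge (hP.comp (fst .id)) (fst (snd .id)) (snd (snd .id))) ⟨r, fun a R e => ?_⟩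
  -- Each intermediate relation is filtered from the same list of all pairs, so it never outgrows
  -- that list.
  have h₁ := codeSize_filter_le (_root_.allPairs (_root_.acTerms (f a)))
    fun p => _root_.memCode p R || _root_.memCode (p.1, e.1) R && _root_.memCode (e.2, p.2) R
  have h₂ := hr a
  have h₃ := r.eval_le_eval_of_le (show codeSize a ≤ codeSize (a, e) by
    rw [codeSize_pair]; omega)
  unfold _root_.addEdge
  omega

theorem nePairs {f : α → List Comparison} (hf : PolyTime f) : PolyTime fun a => nePairs (f a) :=
  .append (hf.flatMap (f := fun _ => Comparison.disequalities) (disequalities.comp (snd .id)))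
    (hf.acTerms.allPairs.filter
      (p := fun _ p => (p.1.isConst && p.2.isConst) && !sameCode p.1 p.2)
      (.and (.and (.isConst (.fst (.snd .id))) (.isConst (.snd (.snd .id))))
        (.not (.same (.fst (.snd .id)) (.snd (.snd .id))))))

theorem satTest {f : α → List Comparison} (hf : PolyTime f) : PolyTime fun a => satTest (f a) := by
  have h : PolyTime fun z : α × QTerm × QTerm => _root_.lePairs (f z.1) :=
    hf.lePairs.comp (fst .id)
  exact hf.nePairs.all (p := fun a p => !(_root_.memCode p (_root_.lePairs (f a)) &&
      _root_.memCode (p.2, p.1) (_root_.lePairs (f a))))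
    (.not (.and (.memCode (snd .id) h) (.memCode (.pair (.snd (.snd .id)) (.fst (.snd .id))) h)))

theorem impTest {f : α → List Comparison} {c : α → Comparison} (hf : PolyTime f)
    (hc : PolyTime c) : PolyTime fun a => impTest (f a) (c a) :=
  .not (satTest (.cons (.compNeg hc) hf))

end PolyTime

/-! ### Assignments in dense linear orders without endpoints -/

/-- The conjunction `β` has a model in `D`. -/
def Satisfiable {D : Type*} [LinearOrder D] (ι : ℚ ↪o D) (β : List Comparison) : Prop :=
  ∃ v : ℕ → D, AllHold ι v β

theorem Comparison.neg_holds {D : Type*} [LinearOrder D] (ι : ℚ ↪o D) (v : ℕ → D)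
    (a : Comparison) : a.neg.Holds ι v ↔ ¬ a.Holds ι v := by
  obtain ⟨l, o, r⟩ := a
  cases o <;> simp [Comparison.Holds, Comparison.neg, CompOp.neg, CompOp.Rel]

theorem allHold_cons {D : Type*} [LinearOrder D] {ι : ℚ ↪o D} {v : ℕ → D} {a : Comparison}
    {β : List Comparison} : AllHold ι v (a :: β) ↔ a.Holds ι v ∧ AllHold ι v β := by
  simp [AllHold]

theorem implied_iff_not_satisfiable {D : Type*} [LinearOrder D] {ι : ℚ ↪o D}
    {β : List Comparison} {a : Comparison} :
    Implied ι β a ↔ ¬ Satisfiable ι (a.neg :: β) := by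
  simp only [Implied, Satisfiable, allHold_cons, Comparison.neg_holds]
  exact ⟨fun h ⟨v, h₁, h₂⟩ => h₁ (h v h₂), fun h v hv => by_contra fun h' => h ⟨v, h', hv⟩⟩

theorem cmp_eq_cmp_of_le_iff {α β : Type*} [LinearOrder α] [LinearOrder β] {a b : α} {c d : β}
    (h₁ : a ≤ b ↔ c ≤ d) (h₂ : b ≤ a ↔ d ≤ c) : cmp a b = cmp c d := by
  rcases lt_trichotomy a b with h | h | h
  · rw [h.cmp_eq_lt, eq_comm, cmp_eq_lt_iff]
    exact not_le.1 fun h' => h.not_ge (h₂.2 h')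
  · rw [h, cmp_self_eq_eq, eq_comm, cmp_eq_eq_iff]
    exact le_antisymm (h₁.1 h.le) (h₂.1 h.ge)
  · rw [h.cmp_eq_gt, eq_comm, cmp_eq_gt_iff]
    exact not_le.1 fun h' => h.not_ge (h₁.2 h')

theorem CompOp.rel_congr {α β : Type*} [LinearOrder α] [LinearOrder β] {a b : α} {c d : β}
    (h₁ : a ≤ b ↔ c ≤ d) (h₂ : b ≤ a ↔ d ≤ c) (o : CompOp) : o.Rel a b ↔ o.Rel c d := by
  cases o <;> simp only [CompOp.Rel, gt_iff_lt, ge_iff_le, ne_eq, le_antisymm_iff, h₁, h₂] <;>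
    rw [← not_le, ← not_le] <;> simp only [h₁, h₂]

/-- The forth half of back and forth: the variables are placed one at a time, since a finite partial
isomorphism into a dense order without endpoints extends by one point. The constants have prescribed
places, and `hc` makes the starting configuration a partial isomorphism. -/
theorem exists_assignment_of_faithful {D α : Type*} [LinearOrder D] [DenselyOrdered D]
    [NoMinOrder D] [NoMaxOrder D] [LinearOrder α] (ι : ℚ ↪o D) (p : QTerm → α) (S : List QTerm)
    (hc : ∀ c d, QTerm.const c ∈ S → QTerm.const d ∈ S → (p (.const c) ≤ p (.const d) ↔ c ≤ d)) :
    ∃ w : ℕ → D, ∀ s ∈ S, ∀ t ∈ S, (s.val ι w ≤ t.val ι w ↔ p s ≤ p t) := by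
  classical
  have hne : Nonempty D := ⟨ι 0⟩
  have key : ∀ X : List ℕ, ∃ w : ℕ → D, ∀ s ∈ S.filter QTerm.isConst ++ X.map QTerm.var,
      ∀ t ∈ S.filter QTerm.isConst ++ X.map QTerm.var,
        (s.val ι w ≤ t.val ι w ↔ p s ≤ p t) := by
    intro X
    induction X with
    | nil =>
      refine ⟨fun _ => ι 0, fun s hs t ht => ?_⟩
      simp only [List.map_nil, List.append_nil, List.mem_filter] at hs ht
      cases s with
      | var x => simp [QTerm.isConst] at hs
      | const c =>
        cases t with
        | var x => simp [QTerm.isConst] at ht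
        | const d => rw [hc c d hs.1 ht.1]; simp [QTerm.val]
    | cons x X ih =>
      obtain ⟨w, hw⟩ := ih
      by_cases hx : x ∈ X
      · refine ⟨w, fun s hs t ht => hw s ?_ t ?_⟩
        · simp only [List.mem_append, List.map_cons, List.mem_cons, List.mem_map] at hs ⊢
          rcases hs with hs | rfl | hs
          exacts [.inl hs, .inr ⟨x, hx, rfl⟩, .inr hs]
        · simp only [List.mem_append, List.map_cons, List.mem_cons, List.mem_map] at ht ⊢
          rcases ht with ht | rfl | ht
          exacts [.inl ht, .inr ⟨x, hx, rfl⟩, .inr ht]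
      set T := S.filter QTerm.isConst ++ X.map QTerm.var with hT
      have hxT : QTerm.var x ∉ T := by
        simp [hT, QTerm.isConst, hx]
      obtain ⟨b, hb⟩ := Order.PartialIso.exists_across (α := α) (β := D)
        ⟨(T.map fun t => (p t, t.val ι w)).toFinset, by
          intro y hy z hz
          simp only [List.mem_toFinset, List.mem_map] at hy hz
          obtain ⟨s, hs, rfl⟩ := hy
          obtain ⟨t, ht, rfl⟩ := hz
          exact cmp_eq_cmp_of_le_iff (hw s hs t ht).symm (hw t ht s hs).symm⟩ (p (.var x))
      have hb : ∀ t ∈ T, cmp (p t) (p (.var x)) = cmp (t.val ι w) b := fun t ht =>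
        hb (p t, t.val ι w) (List.mem_toFinset.2 (List.mem_map.2 ⟨t, ht, rfl⟩))
      have hval : ∀ t ∈ T, t.val ι (Function.update w x b) = t.val ι w := by
        intro t ht
        cases t with
        | const c => rfl
        | var y =>
          have : y ≠ x := fun h => hxT (h ▸ ht)
          simp [QTerm.val, this]
      have hvx : (QTerm.var x).val ι (Function.update w x b) = b := by simp [QTerm.val]
      have hmem : ∀ t ∈ S.filter QTerm.isConst ++ (x :: X).map QTerm.var,
          t = .var x ∨ t ∈ T := by
        intro t ht
        simp only [hT, List.mem_append, List.map_cons, List.mem_cons] at ht ⊢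
        tauto
      refine ⟨Function.update w x b, fun s hs t ht => ?_⟩
      rcases hmem s hs with rfl | hs <;> rcases hmem t ht with rfl | ht
      · simp
      · rw [hvx, hval t ht]
        exact le_iff_le_of_cmp_eq_cmp (cmp_eq_cmp_symm.1 (hb t ht).symm)
      · rw [hvx, hval s hs]
        exact le_iff_le_of_cmp_eq_cmp (hb s hs).symm
      · rw [hval s hs, hval t ht, hw s hs t ht]
  obtain ⟨w, hw⟩ := key (S.filterMap fun t => match t with | .var x => some x | .const _ => none)
  have hmem : ∀ t ∈ S, t ∈ S.filter QTerm.isConst ++ (S.filterMap fun t =>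
      match t with | .var x => some x | .const _ => none).map QTerm.var := by
    intro t ht
    cases t with
    | var x =>
      refine List.mem_append_right _ (List.mem_map.2 ⟨x, List.mem_filterMap.2 ⟨_, ht, rfl⟩, rfl⟩)
    | const c => exact List.mem_append_left _ (List.mem_filter.2 ⟨ht, rfl⟩)
  exact ⟨w, fun s hs t ht => hw s (hmem s hs) t (hmem t ht)⟩

/-- On the terms in `S`, the assignment `w` orders values as `v` does, and breaks ties by `h`. -/
def Refines {D E : Type*} [LinearOrder D] [LinearOrder E] (ι : ℚ ↪o D) (S : List QTerm)
    (w v : ℕ → D) (h : QTerm → E) : Prop :=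
  ∀ s ∈ S, ∀ t ∈ S, (s.val ι w ≤ t.val ι w ↔
    s.val ι v < t.val ι v ∨ s.val ι v = t.val ι v ∧ h s ≤ h t)

/-- In the lexicographic order by value under `v` and then by `h`, distinct constants are already
separated by the first component. So the constants keep their order for every `h`, and the order can
be realised in `D`. -/
theorem exists_refines {D E : Type*} [LinearOrder D] [DenselyOrdered D] [NoMinOrder D]
    [NoMaxOrder D] [LinearOrder E] (ι : ℚ ↪o D) (S : List QTerm) (v : ℕ → D) (h : QTerm → E) :
    ∃ w, Refines ι S w v h := by
  obtain ⟨w, hw⟩ := exists_assignment_of_faithful ι (fun t => toLex (t.val ι v, h t)) S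
    fun c d _ _ => by
      rw [Prod.Lex.toLex_le_toLex]
      simp only [QTerm.val, ι.lt_iff_lt, ι.eq_iff_eq]
      constructor
      · rintro (h | h)
        exacts [h.le, h.1.le]
      · intro h
        rcases h.lt_or_eq with h | rfl
        exacts [.inl h, .inr ⟨rfl, le_rfl⟩]
  exact ⟨w, fun s hs t ht => by rw [hw s hs t ht, Prod.Lex.toLex_le_toLex]⟩

namespace Refines

variable {D E : Type*} [LinearOrder D] [LinearOrder E] {ι : ℚ ↪o D} {S : List QTerm}
  {w v : ℕ → D} {h : QTerm → E}

theorem lt_iff (H : Refines ι S w v h) {s t : QTerm} (hs : s ∈ S) (ht : t ∈ S) :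
    s.val ι w < t.val ι w ↔ s.val ι v < t.val ι v ∨ s.val ι v = t.val ι v ∧ h s < h t := by
  rw [← not_le, H t ht s hs, ← not_le (a := h t)]
  rcases lt_trichotomy (s.val ι v) (t.val ι v) with h' | h' | h'
  · simp [h', h'.not_gt, h'.ne']
  · simp [h']
  · simp [h', h'.not_gt, h'.ne']

theorem eq_iff (H : Refines ι S w v h) {s t : QTerm} (hs : s ∈ S) (ht : t ∈ S) :
    s.val ι w = t.val ι w ↔ s.val ι v = t.val ι v ∧ h s = h t := by
  rw [le_antisymm_iff, H s hs t ht, H t ht s hs, le_antisymm_iff (a := h s)]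
  rcases lt_trichotomy (s.val ι v) (t.val ι v) with h' | h' | h'
  · simp [h'.not_gt, h'.ne, h'.ne']
  · simp [h']
  · simp [h'.not_gt, h'.ne, h'.ne']

/-- Strict inequalities survive refinement, so only ties have to be checked against `h`. -/
theorem rel (H : Refines ι S w v h) {s t : QTerm} (hs : s ∈ S) (ht : t ∈ S) {o : CompOp}
    (h₁ : o.Rel (s.val ι v) (t.val ι v)) (h₂ : s.val ι v = t.val ι v → o.Rel (h s) (h t)) :
    o.Rel (s.val ι w) (t.val ι w) := by
  cases o
  · exact (H.lt_iff hs ht).2 (.inl h₁)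
  · exact (H s hs t ht).2 (h₁.lt_or_eq.imp_right fun h => ⟨h, h₂ h⟩)
  · exact (H.lt_iff ht hs).2 (.inl h₁)
  · exact (H t ht s hs).2 (h₁.lt_or_eq.imp_right fun h => ⟨h, h₂ h.symm⟩)
  · exact (H.eq_iff hs ht).2 ⟨h₁, h₂ h₁⟩
  · exact fun h => h₁ ((H.eq_iff hs ht).1 h).1

end Refines

/-! ### Correctness of the satisfiability test -/

-- A path using the new edge several times can be shortened to use it once. This is why one pass
-- over the edges with `addEdge` computes the transitive closure.
open Relation in
theorem reflTransGen_insert {α : Type*} {r : α → α → Prop} {a b s t : α} :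
    ReflTransGen (fun x y => r x y ∨ (x, y) = (a, b)) s t ↔
      ReflTransGen r s t ∨ ReflTransGen r s a ∧ ReflTransGen r b t := by
  constructor
  · intro h
    induction h with
    | refl => exact .inl .refl
    | tail _ h ih =>
      rcases h with h | h
      · exact ih.imp (·.tail h) fun h' => ⟨h'.1, h'.2.tail h⟩
      · simp only [Prod.mk.injEq] at h
        obtain ⟨rfl, rfl⟩ := h
        exact .inr ⟨ih.elim id (·.1), .refl⟩
  · have hm : ∀ {x y}, ReflTransGen r x y →
        ReflTransGen (fun x y => r x y ∨ (x, y) = (a, b)) x y :=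
      fun h => ReflTransGen.mono (fun _ _ h => Or.inl h) _ _ h
    rintro (h | ⟨h₁, h₂⟩)
    · exact hm h
    · exact ((hm h₁).tail (.inr rfl)).trans (hm h₂)

theorem mem_allPairs {α : Type*} {l : List α} {p : α × α} :
    p ∈ allPairs l ↔ p.1 ∈ l ∧ p.2 ∈ l := by
  obtain ⟨a, b⟩ := p
  simp only [allPairs, List.mem_flatMap, List.mem_map, Prod.mk.injEq]
  constructor
  · rintro ⟨x, hx, y, hy, rfl, rfl⟩
    exact ⟨hx, hy⟩
  · exact fun h => ⟨a, h.1, b, h.2, rfl, rfl⟩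

open Relation in
theorem mem_foldl_addEdge {T : List QTerm} (E : List (QTerm × QTerm)) :
    ∀ {r : QTerm → QTerm → Prop} {R : List (QTerm × QTerm)},
      (∀ e ∈ E, e.1 ∈ T ∧ e.2 ∈ T) →
      (∀ s ∈ T, ∀ t ∈ T, ((s, t) ∈ R ↔ ReflTransGen r s t)) → ∀ s ∈ T, ∀ t ∈ T,
        ((s, t) ∈ E.foldl (addEdge (allPairs T)) R ↔
          ReflTransGen (fun x y => r x y ∨ (x, y) ∈ E) s t) := by
  induction E with
  | nil => intro r R _ hR s hs t ht; simpa using hR s hs t ht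
  | cons e E ih =>
    intro r R hE hR s hs t ht
    have he := hE e (by simp)
    rw [List.foldl_cons, ih (r := fun x y => r x y ∨ (x, y) = e)
      (fun e' he' => hE e' (by simp [he'])) ?_ s hs t ht]
    · simp only [List.mem_cons, or_assoc]
    · intro s hs t ht
      obtain ⟨a, b⟩ := e
      simp only [addEdge, List.mem_filter, mem_allPairs, Bool.or_eq_true, Bool.and_eq_true,
        memCode_iff, hs, ht, hR s hs t ht, hR s hs a he.1, hR b he.2 t ht, and_self, true_and,
        reflTransGen_insert]

/-- The inequalities between terms in `T` that are true or occur in `E`. -/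
def EdgeRel (T : List QTerm) (E : List (QTerm × QTerm)) (s t : QTerm) : Prop :=
  (s ∈ T ∧ t ∈ T ∧ s.constLE t = true) ∨ (s, t) ∈ E

theorem QTerm.constLE_iff {s t : QTerm} :
    s.constLE t = true ↔ ∃ c d, s = .const c ∧ t = .const d ∧ c ≤ d := by
  cases s <;> cases t <;> simp [constLE, isConst, constVal]
  exact decide_eq_true_iff

theorem mem_acTerms {β : List Comparison} {t : QTerm} :
    t ∈ acTerms β ↔ ∃ a ∈ β, t = a.lhs ∨ t = a.rhs := by
  simp [acTerms]

theorem mem_acTerms_of_mem_edges {β : List Comparison} {e : QTerm × QTerm}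
    (he : e ∈ β.flatMap Comparison.edges) : e.1 ∈ acTerms β ∧ e.2 ∈ acTerms β := by
  obtain ⟨a, ha, he⟩ := List.mem_flatMap.1 he
  simp only [mem_acTerms]
  obtain ⟨l, o, r⟩ := a
  cases o <;> simp [Comparison.edges] at he
  case eq =>
    rcases he with rfl | rfl
    exacts [⟨⟨_, ha, .inl rfl⟩, _, ha, .inr rfl⟩, ⟨⟨_, ha, .inr rfl⟩, _, ha, .inl rfl⟩]
  all_goals
    subst he
    first
      | exact ⟨⟨_, ha, .inl rfl⟩, _, ha, .inr rfl⟩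
      | exact ⟨⟨_, ha, .inr rfl⟩, _, ha, .inl rfl⟩

open Relation in
theorem mem_lePairs {β : List Comparison} {s t : QTerm} (hs : s ∈ acTerms β) (ht : t ∈ acTerms β) :
    (s, t) ∈ lePairs β ↔
      ReflTransGen (EdgeRel (acTerms β) (β.flatMap Comparison.edges)) s t := by
  refine mem_foldl_addEdge (r := fun s t => s ∈ acTerms β ∧ t ∈ acTerms β ∧ s.constLE t = true) _
    (fun e he => mem_acTerms_of_mem_edges he) (fun s hs t ht => ?_) s hs t ht
  simp only [initialPairs, List.mem_filter, mem_allPairs, hs, ht, Bool.or_eq_true,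
    PolyTime.sameCode_iff, true_and, and_self]
  constructor
  · rintro (rfl | h)
    · exact .refl
    · exact .single ⟨hs, ht, h⟩
  · intro h
    clear ht
    induction h with
    | refl => exact .inl rfl
    | tail _ h ih =>
      rcases ih with rfl | ih
      · exact .inr h.2.2
      · rw [QTerm.constLE_iff] at ih
        have h := h.2.2
        rw [QTerm.constLE_iff] at h ⊢
        obtain ⟨c, d, rfl, rfl, hcd⟩ := ih
        obtain ⟨d', e, hd, rfl, hde⟩ := h
        simp only [QTerm.const.injEq] at hd
        subst hd
        exact .inr ⟨c, e, rfl, rfl, hcd.trans hde⟩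

open Relation in
/-- A preorder extends to a linear preorder with the same equivalence classes. -/
theorem exists_linear_extension.{u} {α : Type u} (r : α → α → Prop) :
    ∃ (L : Type u) (_ : LinearOrder L) (p : α → L), (∀ s t, ReflTransGen r s t → p s ≤ p t) ∧
      ∀ s t, p s = p t → ReflTransGen r s t ∧ ReflTransGen r t s := by
  let _ : Preorder α :=
    { le := ReflTransGen r, le_refl := fun _ => .refl, le_trans := fun _ _ _ => .trans }
  refine ⟨LinearExtension (Antisymmetrization α (· ≤ ·)), inferInstance,
    fun s => toLinearExtension (toAntisymmetrization (· ≤ ·) s), fun s t h => ?_, fun s t h => ?_⟩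
  · exact toLinearExtension.monotone (toAntisymmetrization_mono (show s ≤ t from h))
  · exact (Quotient.exact h : AntisymmRel (· ≤ ·) s t)

-- A linear extension of the reachability preorder identifies only mutually reachable terms, and the
-- test excludes this for terms that must differ. Distinct constants are among these, which forces
-- the extension to order the constants correctly; it can then be realised in `D`.
open Relation in
theorem satisfiable_of_satTest {D : Type*} [LinearOrder D] [DenselyOrdered D] [NoMinOrder D]
    [NoMaxOrder D] (ι : ℚ ↪o D) {β : List Comparison} (h : satTest β = true) :
    Satisfiable ι β := by
  obtain ⟨L, _, p, hp₁, hp₂⟩ := exists_linear_extension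
    (EdgeRel (acTerms β) (β.flatMap Comparison.edges))
  have hne : ∀ s ∈ acTerms β, ∀ t ∈ acTerms β, (s, t) ∈ nePairs β → p s ≠ p t := by
    intro s hs t ht hst heq
    have h := List.all_eq_true.1 h _ hst
    rw [Bool.not_eq_true', ← Bool.not_eq_true, Bool.and_eq_true, memCode_iff, memCode_iff,
      mem_lePairs hs ht, mem_lePairs ht hs] at h
    exact h (hp₂ s t heq)
  obtain ⟨w, hw⟩ := exists_assignment_of_faithful ι p (acTerms β) fun c d hc hd => by
    have hle : ∀ c d, QTerm.const c ∈ acTerms β → QTerm.const d ∈ acTerms β → c ≤ d →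
        p (.const c) ≤ p (.const d) := fun c d hc hd h =>
      hp₁ _ _ (.single (.inl ⟨hc, hd, QTerm.constLE_iff.2 ⟨c, d, rfl, rfl, h⟩⟩))
    refine ⟨fun h => le_of_not_gt fun h' => ?_, hle c d hc hd⟩
    refine hne _ hc _ hd (List.mem_append_right _ (List.mem_filter.2
      ⟨mem_allPairs.2 ⟨hc, hd⟩, ?_⟩)) (le_antisymm h (hle d c hd hc h'.le))
    simp only [QTerm.isConst, Bool.and_self, Bool.true_and, Bool.not_eq_true', ← Bool.not_eq_true,
      PolyTime.sameCode_iff, QTerm.const.injEq]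
    exact h'.ne'
  refine ⟨w, fun a ha => ?_⟩
  have hl : a.lhs ∈ acTerms β := mem_acTerms.2 ⟨a, ha, .inl rfl⟩
  have hr : a.rhs ∈ acTerms β := mem_acTerms.2 ⟨a, ha, .inr rfl⟩
  have hedge : ∀ e ∈ a.edges, p e.1 ≤ p e.2 := fun e he =>
    hp₁ _ _ (.single (.inr (List.mem_flatMap.2 ⟨a, ha, he⟩)))
  have hdis : (a.lhs, a.rhs) ∈ a.disequalities → p a.lhs ≠ p a.rhs := fun he =>
    hne _ hl _ hr (List.mem_append_left _ (List.mem_flatMap.2 ⟨a, ha, he⟩))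
  rw [Comparison.Holds, CompOp.rel_congr (hw _ hl _ hr) (hw _ hr _ hl)]
  obtain ⟨l, o, r⟩ := a
  cases o <;> simp [Comparison.edges, Comparison.disequalities] at hedge hdis <;>
    simp only [CompOp.Rel]
  · exact lt_of_le_of_ne hedge hdis
  · exact hedge
  · exact lt_of_le_of_ne hedge (Ne.symm hdis)
  · exact hedge
  · exact le_antisymm hedge.1 hedge.2
  · exact hdis

open Relation in
theorem satTest_of_satisfiable {D : Type*} [LinearOrder D] (ι : ℚ ↪o D) {β : List Comparison}
    (h : Satisfiable ι β) : satTest β = true := by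
  obtain ⟨v, hv⟩ := h
  have hle : ∀ s t, ReflTransGen (EdgeRel (acTerms β) (β.flatMap Comparison.edges)) s t →
      s.val ι v ≤ t.val ι v := by
    intro s t h
    induction h with
    | refl => exact le_rfl
    | tail _ h ih =>
      refine ih.trans ?_
      rcases h with h | h
      · obtain ⟨c, d, rfl, rfl, hcd⟩ := QTerm.constLE_iff.1 h.2.2
        exact ι.monotone hcd
      · obtain ⟨a, ha, he⟩ := List.mem_flatMap.1 h
        have := hv a ha
        obtain ⟨l, o, r⟩ := a
        cases o <;> simp [Comparison.edges] at he <;>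
          simp only [Comparison.Holds, CompOp.Rel] at this
        · obtain ⟨rfl, rfl⟩ := he; exact this.le
        · obtain ⟨rfl, rfl⟩ := he; exact this
        · obtain ⟨rfl, rfl⟩ := he; exact this.le
        · obtain ⟨rfl, rfl⟩ := he; exact this
        · rcases he with ⟨rfl, rfl⟩ | ⟨rfl, rfl⟩
          exacts [this.le, this.ge]
  refine List.all_eq_true.2 fun p hp => ?_
  have hne : (p.1 ∈ acTerms β ∧ p.2 ∈ acTerms β) ∧ p.1.val ι v ≠ p.2.val ι v := by
    rcases List.mem_append.1 hp with hp | hp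
    · obtain ⟨a, ha, he⟩ := List.mem_flatMap.1 hp
      have := hv a ha
      simp only [mem_acTerms]
      obtain ⟨l, o, r⟩ := a
      cases o <;> simp [Comparison.disequalities] at he <;>
        simp only [Comparison.Holds, CompOp.Rel] at this <;> subst he
      · exact ⟨⟨⟨_, ha, .inl rfl⟩, _, ha, .inr rfl⟩, this.ne⟩
      · exact ⟨⟨⟨_, ha, .inl rfl⟩, _, ha, .inr rfl⟩, this.ne'⟩
      · exact ⟨⟨⟨_, ha, .inl rfl⟩, _, ha, .inr rfl⟩, this⟩
    · simp only [List.mem_filter, mem_allPairs, Bool.and_eq_true, Bool.not_eq_true',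
        ← Bool.not_eq_true, PolyTime.sameCode_iff] at hp
      obtain ⟨s, t⟩ := p
      refine ⟨hp.1, ?_⟩
      cases s <;> cases t <;> simp [QTerm.isConst] at hp
      simpa [QTerm.val] using hp.2
  rw [Bool.not_eq_true', ← Bool.not_eq_true, Bool.and_eq_true, memCode_iff, memCode_iff]
  intro h
  exact hne.2 (le_antisymm (hle _ _ ((mem_lePairs hne.1.1 hne.1.2).1 h.1))
    (hle _ _ ((mem_lePairs hne.1.2 hne.1.1).1 h.2)))

theorem satTest_iff {D : Type*} [LinearOrder D] [DenselyOrdered D] [NoMinOrder D]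
    [NoMaxOrder D] (ι : ℚ ↪o D) {β : List Comparison} : satTest β = true ↔ Satisfiable ι β :=
  ⟨satisfiable_of_satTest ι, satTest_of_satisfiable ι⟩

theorem impTest_iff {D : Type*} [LinearOrder D] [DenselyOrdered D] [NoMinOrder D]
    [NoMaxOrder D] (ι : ℚ ↪o D) {β : List Comparison} {a : Comparison} :
    impTest β a = true ↔ Implied ι β a := by
  rw [impTest, Bool.not_eq_true', ← Bool.not_eq_true, satTest_iff ι,
    implied_iff_not_satisfiable]

/-! ### Substitutions and canonical databases -/

theorem QTerm.val_subst {D : Type*} [LinearOrder D] (ι : ℚ ↪o D) (v : ℕ → D) (σ : ℕ → QTerm)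
    (t : QTerm) : (t.subst σ).val ι v = t.val ι fun x => (σ x).val ι v := by
  cases t <;> rfl

theorem QAtom.toFact_subst {D : Type*} [LinearOrder D] (ι : ℚ ↪o D) (v : ℕ → D) (σ : ℕ → QTerm)
    (a : QAtom) : (a.subst σ).toFact ι v = a.toFact ι fun x => (σ x).val ι v := by
  simp [QAtom.toFact, QAtom.subst, QTerm.val_subst, Function.comp_def]

theorem Comparison.holds_subst {D : Type*} [LinearOrder D] (ι : ℚ ↪o D) (v : ℕ → D)
    (σ : ℕ → QTerm) (a : Comparison) :
    (a.subst σ).Holds ι v ↔ a.Holds ι fun x => (σ x).val ι v := by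
  simp [Comparison.Holds, Comparison.subst, QTerm.val_subst]

theorem allHold_map_subst {D : Type*} [LinearOrder D] {ι : ℚ ↪o D} {v : ℕ → D} {σ : ℕ → QTerm}
    {β : List Comparison} :
    AllHold ι v (β.map (Comparison.subst σ)) ↔ AllHold ι (fun x => (σ x).val ι v) β := by
  simp [AllHold, Comparison.holds_subst]

/-- The databases that matter are the canonical ones, made of the images of the subgoals of `Q₂`
under a model of its comparisons; every answer of `Q₂` already arises on such a part of the
database. -/
theorem contained_iff {D : Type*} [LinearOrder D] {ι : ℚ ↪o D} {Q₂ Q₁ : CQAC} :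
    Contained ι Q₂ Q₁ ↔ ∀ v, AllHold ι v Q₂.acs → ∃ u : ℕ → D,
      (∀ a ∈ Q₁.body, ∃ b ∈ Q₂.body, a.toFact ι u = b.toFact ι v) ∧ AllHold ι u Q₁.acs ∧
      Q₁.head.map (QTerm.val ι u) = Q₂.head.map (QTerm.val ι v) := by
  constructor
  · intro h v hv
    have hfin : {f | ∃ b ∈ Q₂.body, f = b.toFact ι v}.Finite :=
      (List.finite_toSet (Q₂.body.map (QAtom.toFact ι v))).subset
        fun f ⟨b, hb, hf⟩ => List.mem_map.2 ⟨b, hb, hf.symm⟩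
    obtain ⟨u, h₁, h₂, h₃⟩ := h _ hfin ⟨v, fun b hb => ⟨b, hb, rfl⟩, hv, rfl⟩
    exact ⟨u, h₁, h₂, h₃.symm⟩
  · rintro h I _ t ⟨v, h₁, h₂, rfl⟩
    obtain ⟨u, hu₁, hu₂, hu₃⟩ := h v h₂
    refine ⟨u, fun a ha => ?_, hu₂, hu₃.symm⟩
    obtain ⟨b, hb, hab⟩ := hu₁ a ha
    exact hab ▸ h₁ b hb

theorem implied_of_mem {D : Type*} [LinearOrder D] {ι : ℚ ↪o D} {β : List Comparison}
    {a : Comparison} (h : a ∈ β) : Implied ι β a := fun _ hv => hv a h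

/-! ### Representatives of terms modulo the implied equations -/

theorem implied_eqRepr {D : Type*} [LinearOrder D] (ι : ℚ ↪o D) (β : List Comparison)
    (x : ℕ) : Implied ι β ⟨.var x, .eq, eqRepr ι β x⟩ := by
  unfold eqRepr
  split_ifs with h
  · exact h.choose_spec
  · exact Nat.sInf_mem (s := {y : ℕ | Implied ι β ⟨.var x, .eq, .var y⟩}) ⟨x, fun _ _ => rfl⟩

theorem val_subst_eqRepr {D : Type*} [LinearOrder D] {ι : ℚ ↪o D} {β : List Comparison}
    {v : ℕ → D} (hv : AllHold ι v β) (t : QTerm) :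
    (t.subst (eqRepr ι β)).val ι v = t.val ι v := by
  cases t with
  | const c => rfl
  | var x => exact (implied_eqRepr ι β x v hv).symm

/-- Satisfiability makes the representing constant unique. Terms that are forced to be equal satisfy
the same implied equations, hence have the same representative. -/
theorem subst_eqRepr_eq {D : Type*} [LinearOrder D] {ι : ℚ ↪o D} {β : List Comparison}
    (hβ : Satisfiable ι β) {s t : QTerm} (h : Implied ι β ⟨s, .eq, t⟩) :
    s.subst (eqRepr ι β) = t.subst (eqRepr ι β) := by
  have hconst : ∀ {x c}, Implied ι β ⟨.var x, .eq, .const c⟩ → eqRepr ι β x = .const c := by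
    intro x c hx
    have h' : ∃ c : ℚ, Implied ι β ⟨.var x, .eq, .const c⟩ := ⟨c, hx⟩
    obtain ⟨v, hv⟩ := hβ
    rw [eqRepr, dif_pos h']
    have h₁ := h'.choose_spec v hv
    have h₂ := hx v hv
    simp only [Comparison.Holds, CompOp.Rel, QTerm.val] at h₁ h₂
    exact congrArg _ (ι.injective (h₁.symm.trans h₂))
  cases s with
  | const c =>
    cases t with
    | const d =>
      obtain ⟨v, hv⟩ := hβ
      exact congrArg QTerm.const (ι.injective (h v hv))
    | var y => exact (hconst fun v hv => (h v hv).symm).symm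
  | var x =>
    cases t with
    | const d => exact hconst h
    | var y =>
      have hiff : ∀ t, Implied ι β ⟨.var x, .eq, t⟩ ↔ Implied ι β ⟨.var y, .eq, t⟩ := fun t =>
        ⟨fun h' v hv => (h v hv).symm.trans (h' v hv), fun h' v hv => (h v hv).trans (h' v hv)⟩
      by_cases hx : ∃ c : ℚ, Implied ι β ⟨.var x, .eq, .const c⟩
      · obtain ⟨c, hc⟩ := hx
        exact (hconst hc).trans (hconst ((hiff _).1 hc)).symm
      · have hy : ¬ ∃ c : ℚ, Implied ι β ⟨.var y, .eq, .const c⟩ := by simpa only [hiff] using hx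
        simp only [QTerm.subst, eqRepr, dif_neg hx, dif_neg hy, hiff]

/-! ### Generic models -/

section Perturbation

variable {D : Type*} [LinearOrder D] {ι : ℚ ↪o D}

theorem mem_acTerms_lhs {β : List Comparison} {a : Comparison} (h : a ∈ β) : a.lhs ∈ acTerms β :=
  mem_acTerms.2 ⟨a, h, .inl rfl⟩

theorem mem_acTerms_rhs {β : List Comparison} {a : Comparison} (h : a ∈ β) : a.rhs ∈ acTerms β :=
  mem_acTerms.2 ⟨a, h, .inr rfl⟩

theorem Refines.allHold {E : Type*} [LinearOrder E] {S : List QTerm} {w v : ℕ → D} {h : QTerm → E}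
    (H : Refines ι S w v h) {β : List Comparison} (hS : acTerms β ⊆ S) (hv : AllHold ι v β)
    (hh : ∀ a ∈ β, a.lhs.val ι v = a.rhs.val ι v → a.op.Rel (h a.lhs) (h a.rhs)) :
    AllHold ι w β := fun a ha =>
  H.rel (hS (mem_acTerms_lhs ha)) (hS (mem_acTerms_rhs ha)) (hv a ha) (hh a ha)

/-- A conjunction of comparisons has a model that violates simultaneously any finitely many
equations and upper bounds that do not follow from it. -/
theorem exists_generic_model [DenselyOrdered D] [NoMinOrder D] [NoMaxOrder D]
    {β : List Comparison} (hβ : Satisfiable ι β) (G : List Comparison)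
    (hG : ∀ a ∈ G, (a.op = .eq ∨ a.op = .le ∧ ∃ c, a.rhs = .const c) ∧ ¬ Implied ι β a) :
    ∃ v, AllHold ι v β ∧ ∀ a ∈ G, ¬ a.Holds ι v := by
  induction G with
  | nil => exact hβ.imp fun v hv => ⟨hv, by simp⟩
  | cons g G ih =>
    obtain ⟨v, hv, hvG⟩ := ih fun a ha => hG a (by simp [ha])
    obtain ⟨hg, hg'⟩ := hG g (by simp)
    simp only [Implied, not_forall] at hg'
    obtain ⟨m, hm, hmg⟩ := hg'
    set S := acTerms (g :: G) ++ acTerms β with hS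
    have hval : ∀ t : QTerm, t.val ι (fun x => max (v x) (m x)) = max (t.val ι v) (t.val ι m) := by
      intro t
      cases t <;> simp [QTerm.val]
    -- Apart from `≠`, comparisons are preserved by the pointwise maximum of two models, and the
    -- maximum violates an upper bound as soon as one of them does. Breaking the ties by `v` and
    -- then by `m` restores `≠` and falsifies every equation that fails in either model.
    obtain ⟨w₁, h₁⟩ := exists_refines ι S (fun x => max (v x) (m x)) (QTerm.val ι v)
    obtain ⟨w₂, h₂⟩ := exists_refines ι S w₁ (QTerm.val ι m)
    refine ⟨w₂, h₂.allHold (by simp [hS]) (fun a ha => ?_) fun a ha _ => hm a ha, fun a ha => ?_⟩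
    · have hl : a.lhs ∈ S := List.mem_append_right _ (mem_acTerms_lhs ha)
      have hr : a.rhs ∈ S := List.mem_append_right _ (mem_acTerms_rhs ha)
      have hva := hv a ha
      have hma := hm a ha
      by_cases ho : a.op = .ne
      · simp only [Comparison.Holds, ho, CompOp.Rel] at hva ⊢
        exact fun h => hva ((h₁.eq_iff hl hr).1 h).2
      · refine h₁.rel hl hr ?_ fun _ => hva
        rw [hval, hval]
        simp only [Comparison.Holds] at hva hma
        cases hop : a.op <;> simp only [hop, CompOp.Rel] at hva hma ⊢
        · exact max_lt_max hva hma
        · exact max_le_max hva hma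
        · exact max_lt_max hva hma
        · exact max_le_max hva hma
        · rw [hva, hma]
        · exact absurd hop ho
    · have hl : a.lhs ∈ S := List.mem_append_left _ (mem_acTerms_lhs ha)
      have hr : a.rhs ∈ S := List.mem_append_left _ (mem_acTerms_rhs ha)
      have hor : ¬ a.Holds ι v ∨ ¬ a.Holds ι m := by
        rcases List.mem_cons.1 ha with rfl | ha
        exacts [.inr hmg, .inl (hvG a ha)]
      obtain ⟨l, o, r⟩ := a
      simp only [Comparison.Holds] at hor ⊢
      rcases (hG _ ha).1 with ho | ⟨ho, c, hc⟩
      · simp only at ho hl hr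
        subst ho
        simp only [CompOp.Rel] at hor ⊢
        rw [h₂.eq_iff hl hr, h₁.eq_iff hl hr]
        tauto
      · simp only at ho hc hl hr
        subst ho hc
        simp only [CompOp.Rel, not_le] at hor ⊢
        refine (h₂.lt_iff hr hl).2 (.inl ((h₁.lt_iff hr hl).2 (.inl ?_)))
        rw [hval, hval]
        simpa [QTerm.val] using hor

/-- The conjunction `β` forces the term to be equal to some constant. -/
def Forced {D : Type*} [LinearOrder D] (ι : ℚ ↪o D) (β : List Comparison) (t : QTerm) : Prop :=
  ∃ c, Implied ι β ⟨t, .eq, .const c⟩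

theorem forced_const (β : List Comparison) (c : ℚ) : Forced ι β (.const c) :=
  ⟨c, fun _ _ => rfl⟩

open Classical in
/-- The values of an assignment, moved by `φ` where they are not forced by `β`. -/
noncomputable def shiftedVal {D : Type*} [LinearOrder D] (ι : ℚ ↪o D) (β : List Comparison)
    (φ : D → D) (v : ℕ → D) (t : QTerm) : D :=
  if Forced ι β t then t.val ι v else φ (t.val ι v)

/-- If `s` is forced to equal `c`, the inequality with `s` becomes an implied bound of `t` by `c`.
The tie at `v` shows that the strict bound is not implied, so `c` occurs in a closed SI and `φ`
fixes it. -/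
theorem shift_eq_self_of_forced {β : List Comparison} {φ : D → D}
    (hφ : ∀ c, InClosedSI ι β c → φ (ι c) = ι c) {v : ℕ → D} (hv : AllHold ι v β) {s t : QTerm}
    (hs : Forced ι β s) (ht : ¬ Forced ι β t) (hst : s.val ι v = t.val ι v)
    (h : Implied ι β ⟨s, .le, t⟩ ∨ Implied ι β ⟨t, .le, s⟩) : φ (t.val ι v) = t.val ι v := by
  obtain ⟨c, hc⟩ := hs
  have hsc : s.val ι v = ι c := hc v hv
  cases t with
  | const d => exact absurd (forced_const β d) ht
  | var x =>
    rw [← hst, hsc]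
    refine hφ c ⟨x, fun h => ht ⟨c, h⟩, ?_⟩
    rcases h with h | h
    · refine .inr ⟨fun w hw => ?_, fun h' => ?_⟩
      · have h₁ : s.val ι w ≤ (QTerm.var x).val ι w := h w hw
        have h₂ : s.val ι w = ι c := hc w hw
        rw [h₂] at h₁
        exact h₁
      · have h₁ : ι c < (QTerm.var x).val ι v := h' v hv
        rw [← hst, hsc] at h₁
        exact lt_irrefl _ h₁
    · refine .inl ⟨fun w hw => ?_, fun h' => ?_⟩
      · have h₁ : (QTerm.var x).val ι w ≤ s.val ι w := h w hw
        have h₂ : s.val ι w = ι c := hc w hw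
        rw [h₂] at h₁
        exact h₁
      · have h₁ : (QTerm.var x).val ι v < ι c := h' v hv
        rw [← hst, hsc] at h₁
        exact lt_irrefl _ h₁

theorem shiftedVal_eq {β : List Comparison} {φ : D → D}
    (hφ : ∀ c, InClosedSI ι β c → φ (ι c) = ι c) {v : ℕ → D} (hv : AllHold ι v β) {s t : QTerm}
    (hst : s.val ι v = t.val ι v) (h : Implied ι β ⟨s, .le, t⟩ ∨ Implied ι β ⟨t, .le, s⟩) :
    shiftedVal ι β φ v s = shiftedVal ι β φ v t := by
  unfold shiftedVal
  split_ifs with hs ht ht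
  · exact hst
  · rw [shift_eq_self_of_forced hφ hv hs ht hst h, hst]
  · rw [shift_eq_self_of_forced hφ hv ht hs hst.symm h.symm, hst]
  · rw [hst]

/-- Moving the values that are not forced preserves the models of `β` if the constants that occur
in closed semi-intervals of `β` stay fixed. -/
theorem shiftedVal_rel {β : List Comparison} {φ : D → D}
    (hφ : ∀ c, InClosedSI ι β c → φ (ι c) = ι c) {v : ℕ → D} (hv : AllHold ι v β)
    {a : Comparison} (ha : a ∈ β) (h : a.lhs.val ι v = a.rhs.val ι v) :
    a.op.Rel (shiftedVal ι β φ v a.lhs) (shiftedVal ι β φ v a.rhs) := by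
  have hva := hv a ha
  have himp := implied_of_mem (ι := ι) ha
  obtain ⟨l, o, r⟩ := a
  simp only [Comparison.Holds] at hva h ⊢
  cases o <;> simp only [CompOp.Rel] at hva ⊢
  · exact absurd h hva.ne
  · exact (shiftedVal_eq hφ hv h (.inl himp)).le
  · exact absurd h hva.ne'
  · exact (shiftedVal_eq hφ hv h (.inr himp)).ge
  · exact shiftedVal_eq hφ hv h (.inl fun w hw => (himp w hw).le)
  · exact absurd h hva

/-- A function that moves the constants of open left semi-intervals of `Q₁` up and the constants of
open right semi-intervals of `Q₁` down. -/
theorem exists_shift [DenselyOrdered D] [NoMinOrder D] [NoMaxOrder D]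
    {lsi rsi : CompOp} {Q₂ Q₁ : CQAC} (h : IsInstance ι lsi rsi Q₂ Q₁) :
    ∃ φ : D → D, (∀ c, (∀ a ∈ Q₁.acs, ¬ a.IsOpenSI c) → φ (ι c) = ι c) ∧
      (∀ a ∈ Q₁.acs, ∀ c, a.IsSI .lt c → ι c < φ (ι c)) ∧
      (∀ a ∈ Q₁.acs, ∀ c, a.IsSI .gt c → φ (ι c) < ι c) := by
  classical
  refine ⟨fun y => if ∃ a ∈ Q₁.acs, ∃ c, a.IsSI .lt c ∧ y = ι c then (exists_gt y).choose
    else if ∃ a ∈ Q₁.acs, ∃ c, a.IsSI .gt c ∧ y = ι c then (exists_lt y).choose else y,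
    fun c hc => ?_, fun a ha c hac => ?_, fun a ha c hac => ?_⟩
  · simp only
    rw [if_neg, if_neg]
    · rintro ⟨a, ha, d, had, hd⟩
      exact hc a ha (.inr (ι.injective hd ▸ had))
    · rintro ⟨a, ha, d, had, hd⟩
      exact hc a ha (.inl (ι.injective hd ▸ had))
  · simp only
    rw [if_pos ⟨a, ha, c, hac, rfl⟩]
    exact (exists_gt (ι c)).choose_spec
  · simp only
    rw [if_neg, if_pos ⟨a, ha, c, hac, rfl⟩]
    · exact (exists_lt (ι c)).choose_spec
    -- `rsi_ne_lsi` prevents a constant from having to move in both directions.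
    · rintro ⟨b, hb, d, hbd, hd⟩
      exact h.rsi_ne_lsi a ha b hb c d (.inl hac) (.inl hbd) (ι.injective hd)

/-! ### The containment test without normalization -/

theorem map_eq_map_of_imp {α β γ δ : Type*} {f : α → γ} {g : β → γ} {f' : α → δ} {g' : β → δ}
    {l : List α} {m : List β} (h : l.map f = m.map g)
    (himp : ∀ a ∈ l, ∀ b ∈ m, f a = g b → f' a = g' b) : l.map f' = m.map g' := by
  induction l generalizing m with
  | nil => cases m <;> simp_all
  | cons a l ih =>
    cases m with
    | nil => simp at h
    | cons b m =>
      simp only [List.map_cons, List.cons.injEq] at h ⊢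
      exact ⟨himp a (by simp) b (by simp) h.1,
        ih h.2 fun a ha b hb => himp a (by simp [ha]) b (by simp [hb])⟩

/-- The terms in the relational subgoals of a query. -/
def CQAC.bodyTerms (Q : CQAC) : List QTerm := Q.body.flatMap QAtom.args

theorem CQAC.mem_bodyTerms {Q : CQAC} {t : QTerm} :
    t ∈ Q.bodyTerms ↔ ∃ a ∈ Q.body, t ∈ a.args := by
  simp [CQAC.bodyTerms]

theorem CQAC.inBody_iff {Q : CQAC} {x : ℕ} : Q.InBody x ↔ .var x ∈ Q.bodyTerms :=
  CQAC.mem_bodyTerms.symm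

/-- Under an assignment that maps all relational subgoals of `Q₁` to subgoals of `Q₂`, the value of
each term of a subgoal of `Q₁` is the value of a term of `Q₂`. -/
theorem exists_bodyTerm {Q₂ Q₁ : CQAC} {u v : ℕ → D}
    (h : ∀ a ∈ Q₁.body, ∃ b ∈ Q₂.body, a.toFact ι u = b.toFact ι v) {s : QTerm}
    (hs : s ∈ Q₁.bodyTerms) : ∃ t ∈ Q₂.bodyTerms, s.val ι u = t.val ι v := by
  obtain ⟨a, ha, hsa⟩ := CQAC.mem_bodyTerms.1 hs
  obtain ⟨b, hb, hab⟩ := h a ha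
  simp only [QAtom.toFact, Prod.mk.injEq] at hab
  have : s.val ι u ∈ b.args.map (QTerm.val ι v) := hab.2 ▸ List.mem_map.2 ⟨s, hsa, rfl⟩
  obtain ⟨t, ht, hts⟩ := List.mem_map.1 this
  exact ⟨t, CQAC.mem_bodyTerms.2 ⟨b, hb, ht⟩, hts.symm⟩

/-- A model of the comparisons of `Q₂` takes equal values at a variable and its representative, so
it is a model of the collapsed comparisons too. The mapping obtained there gives an assignment for
`Q₁`: each variable receives the value of the image of its representative. -/
theorem contained_of_containmentEntailment {Q₂ Q₁ : CQAC}
    (h : ContainmentEntailment ι (Q₂.collapse ι) (Q₁.collapse ι)) : Contained ι Q₂ Q₁ := by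
  rw [contained_iff]
  intro v hv
  have hval : (fun x => (eqRepr ι Q₂.acs x).val ι v) = v :=
    funext fun x => (implied_eqRepr ι Q₂.acs x v hv).symm
  obtain ⟨μ, ⟨h₁, h₂⟩, h₃⟩ := h v (allHold_map_subst.2 (by rwa [hval]))
  refine ⟨fun x => ((eqRepr ι Q₁.acs x).subst μ).val ι v, fun a ha => ?_, ?_, ?_⟩
  · obtain ⟨b, hb, hab⟩ := List.mem_map.1 (h₁ _ (List.mem_map.2 ⟨a, ha, rfl⟩))
    refine ⟨b, hb, ?_⟩
    have := congrArg (QAtom.toFact ι v) hab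
    rw [QAtom.toFact_subst, hval, QAtom.toFact_subst, QAtom.toFact_subst] at this
    simp only [QTerm.val_subst]
    exact this.symm
  · have := allHold_map_subst.1 (allHold_map_subst.1 h₃)
    simpa only [QTerm.val_subst] using this
  · have := congrArg (List.map (QTerm.val ι v)) h₂
    simp only [CQAC.collapse, CQAC.subst, List.map_map, Function.comp_def, QTerm.val_subst,
      hval] at this
    simpa only [QTerm.val_subst] using this

/-- Containment is applied not to the given model but to a perturbation that has no accidental
equations and no accidental ties with constants of open SIs. The mapping found there is shown to
work for the given model. -/
theorem containmentEntailment_of_contained [DenselyOrdered D] [NoMinOrder D] [NoMaxOrder D]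
    {lsi rsi : CompOp}
    (hlsi : lsi = CompOp.le ∨ lsi = CompOp.lt) (hrsi : rsi = CompOp.ge ∨ rsi = CompOp.gt)
    {Q₂ Q₁ : CQAC} (h : IsInstance ι lsi rsi Q₂ Q₁) (hcon : Contained ι Q₂ Q₁) :
    ContainmentEntailment ι (Q₂.collapse ι) (Q₁.collapse ι) := by
  classical
  intro v hv
  set e₁ := eqRepr ι Q₁.acs with he₁
  set e₂ := eqRepr ι Q₂.acs with he₂
  set v₀ : ℕ → D := fun x => (e₂ x).val ι v with hv₀
  have hv₀' : AllHold ι v₀ Q₂.acs := allHold_map_subst.1 hv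
  obtain ⟨φ, hφ, hφl, hφr⟩ := exists_shift h
  have hφ' : ∀ c, InClosedSI ι Q₂.acs c → φ (ι c) = ι c := fun c hc =>
    hφ c fun a ha hac => h.open_closed a ha c hac hc
  set S := acTerms Q₂.acs ++ Q₂.bodyTerms ++ (Q₂.bodyTerms ++ Q₂.head).map (QTerm.subst e₂) ++
    (Q₁.bodyTerms ++ Q₁.head).map (QTerm.subst e₁) ++ acTerms Q₁.acs with hS
  have hSβ : acTerms Q₂.acs ⊆ S := fun t ht => by simp [hS, ht]
  -- In `g`, two terms of `S` are equal only if `β₂` forces them to be.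
  obtain ⟨g, hg, hgG⟩ := exists_generic_model h.wf₂.consistent
    (((allPairs S).map fun p => ⟨p.1, .eq, p.2⟩).filter fun a => ¬ Implied ι Q₂.acs a)
    fun a ha => by
      simp only [List.mem_filter, List.mem_map, decide_eq_true_eq] at ha
      obtain ⟨⟨p, _, rfl⟩, h⟩ := ha
      exact ⟨.inl rfl, h⟩
  -- Ties with constants of open SIs are broken first, by `φ`; the remaining accidental ties are
  -- then broken by `g`. All strict inequalities of `v₀` persist in `v₂`.
  obtain ⟨v₁, hv₁⟩ := exists_refines ι S v₀ (shiftedVal ι Q₂.acs φ v₀)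
  obtain ⟨v₂, hv₂⟩ := exists_refines ι S v₁ (QTerm.val ι g)
  have hv₁' : AllHold ι v₁ Q₂.acs :=
    hv₁.allHold hSβ hv₀' fun a ha => shiftedVal_rel hφ' hv₀' ha
  have hv₂' : AllHold ι v₂ Q₂.acs := hv₂.allHold hSβ hv₁' fun a ha _ => hg a ha
  have hinj : ∀ s ∈ S, ∀ t ∈ S, s.val ι v₂ = t.val ι v₂ → Implied ι Q₂.acs ⟨s, .eq, t⟩ := by
    intro s hs t ht hst
    by_contra himp
    refine hgG ⟨s, .eq, t⟩ ?_ ((hv₂.eq_iff hs ht).1 hst).2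
    simp only [List.mem_filter, List.mem_map, decide_eq_true_eq]
    exact ⟨⟨(s, t), mem_allPairs.2 ⟨hs, ht⟩, rfl⟩, himp⟩
  obtain ⟨u, hu₁, hu₂, hu₃⟩ := contained_iff.1 hcon v₂ hv₂'
  -- the containment mapping read off from `u`
  let μ : ℕ → QTerm := fun y =>
    if hy : ∃ t ∈ Q₂.bodyTerms, u y = t.val ι v₂ then hy.choose.subst e₂ else .const 0
  have hμ : ∀ s : QTerm, s ∈ Q₁.bodyTerms ++ Q₁.head → ∃ t : QTerm,
      (s.subst e₁).subst μ = t.subst e₂ ∧ t.subst e₂ ∈ S ∧ (t.subst e₂).val ι v₂ = s.val ι u := by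
    intro s hs
    have hsS : s.subst e₁ ∈ S := by
      simp only [hS, List.mem_append, List.mem_map]
      exact .inl (.inr ⟨s, by simpa using hs, rfl⟩)
    have hsv := val_subst_eqRepr hu₂ s
    rw [← he₁] at hsv
    cases hse : s.subst e₁ with
    | const c =>
      rw [hse] at hsS hsv
      exact ⟨.const c, rfl, hsS, hsv⟩
    | var y =>
      rw [hse] at hsv
      have hsb : s ∈ Q₁.bodyTerms := by
        rcases List.mem_append.1 hs with hs | hs
        · exact hs
        · cases s with
          | const c => simp [QTerm.subst] at hse
          | var x => exact CQAC.inBody_iff.1 (h.wf₁.head_safe x hs)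
      have hy : ∃ t ∈ Q₂.bodyTerms, u y = t.val ι v₂ := by
        obtain ⟨t, ht, hst⟩ := exists_bodyTerm hu₁ hsb
        exact ⟨t, ht, hsv.trans hst⟩
      refine ⟨hy.choose, by simp only [QTerm.subst, μ, dif_pos hy], ?_, ?_⟩
      · simp only [hS, List.mem_append, List.mem_map]
        exact .inl (.inl (.inr ⟨_, .inl hy.choose_spec.1, rfl⟩))
      · rw [he₂, val_subst_eqRepr hv₂', ← hy.choose_spec.2]
        exact hsv
  have hμeq : ∀ s ∈ Q₁.bodyTerms ++ Q₁.head, ∀ t ∈ Q₂.bodyTerms ++ Q₂.head,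
      s.val ι u = t.val ι v₂ → (s.subst e₁).subst μ = t.subst e₂ := by
    intro s hs t ht hst
    obtain ⟨r, hr, hrS, hrv⟩ := hμ s hs
    rw [hr]
    have htS : t.subst e₂ ∈ S := by
      simp only [hS, List.mem_append, List.mem_map]
      exact .inl (.inl (.inr ⟨t, by simpa using ht, rfl⟩))
    have himp := hinj _ hrS _ htS (by rw [hrv, hst, he₂, val_subst_eqRepr hv₂'])
    refine subst_eqRepr_eq h.wf₂.consistent fun w hw => ?_
    have := himp w hw
    simp only [Comparison.Holds, CompOp.Rel] at this ⊢
    rwa [he₂, val_subst_eqRepr hw, val_subst_eqRepr hw] at this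
  refine ⟨μ, ⟨fun a' ha' => ?_, ?_⟩, fun a'' ha'' => ?_⟩
  · obtain ⟨a, ha, rfl⟩ := List.mem_map.1 ha'
    obtain ⟨b, hb, hab⟩ := hu₁ a ha
    refine List.mem_map.2 ⟨b, hb, ?_⟩
    simp only [QAtom.toFact, Prod.mk.injEq] at hab
    simp only [QAtom.subst, List.map_map, Function.comp_def, hab.1, QAtom.mk.injEq, true_and]
    exact (map_eq_map_of_imp hab.2 fun s hs t ht => hμeq s
      (List.mem_append_left _ (CQAC.mem_bodyTerms.2 ⟨a, ha, hs⟩)) t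
      (List.mem_append_left _ (CQAC.mem_bodyTerms.2 ⟨b, hb, ht⟩))).symm
  · simp only [CQAC.collapse, CQAC.subst, List.map_map, Function.comp_def]
    exact map_eq_map_of_imp hu₃ fun s hs t ht => hμeq s
      (List.mem_append_right _ hs) t (List.mem_append_right _ ht)
  · obtain ⟨a', ha', rfl⟩ := List.mem_map.1 ha''
    obtain ⟨a, ha, rfl⟩ := List.mem_map.1 ha'
    obtain ⟨x, hx⟩ := h.wf₁.lhs_var a ha
    have hxb := CQAC.inBody_iff.1 (h.wf₁.acs_safe a ha x (.inl hx))
    have hua := hu₂ a ha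
    obtain ⟨t, ht, htS, htv⟩ := hμ (.var x) (List.mem_append_left _ hxb)
    -- values of the image of `x` under the three assignments
    have hcS : ∀ {c}, a.rhs = .const c → QTerm.const c ∈ S := fun {c} hc => by
      rw [← hc]
      exact List.mem_append_right _ (mem_acTerms_rhs ha)
    have hvt : (t.subst e₂).val ι v = (t.subst e₂).val ι v₀ := by
      rw [he₂, val_subst_eqRepr hv₀', ← he₂, QTerm.val_subst]
    have hlt : ∀ {c}, a.rhs = .const c → (t.subst e₂).val ι v < ι c → u x < ι c := by
      intro c hc hlt
      rw [hvt] at hlt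
      have := (hv₂.lt_iff htS (hcS hc)).2 (.inl ((hv₁.lt_iff htS (hcS hc)).2 (.inl hlt)))
      rw [htv] at this
      exact this
    have hgt : ∀ {c}, a.rhs = .const c → ι c < (t.subst e₂).val ι v → ι c < u x := by
      intro c hc hlt
      rw [hvt] at hlt
      have := (hv₂.lt_iff (hcS hc) htS).2 (.inl ((hv₁.lt_iff (hcS hc) htS).2 (.inl hlt)))
      rw [htv] at this
      exact this
    -- If the image of `x` is tied with `c` at `v`, then either it is forced to be `c` and has not
    -- moved, or it has been moved off `c` in the direction of `φ`.
    have heq : ∀ {c}, a.rhs = .const c → (t.subst e₂).val ι v = ι c →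
        u x = ι c ∨ ((ι c < φ (ι c) → ι c < u x) ∧ (φ (ι c) < ι c → u x < ι c)) := by
      intro c hc heq
      rw [hvt] at heq
      have hxv : u x = (t.subst e₂).val ι v₂ := htv.symm
      by_cases hf : Forced ι Q₂.acs (t.subst e₂)
      · obtain ⟨d, hd⟩ := hf
        have h₀ : (t.subst e₂).val ι v₀ = ι d := hd v₀ hv₀'
        have h₂ : (t.subst e₂).val ι v₂ = ι d := hd v₂ hv₂'
        exact .inl (by rw [hxv, h₂, ← h₀, heq])
      · have hs₁ : shiftedVal ι Q₂.acs φ v₀ (t.subst e₂) = φ (ι c) := by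
          rw [shiftedVal, if_neg hf, heq]
        have hs₂ : shiftedVal ι Q₂.acs φ v₀ (.const c) = ι c := if_pos (forced_const _ c)
        rw [hxv]
        refine .inr ⟨fun hlt => ?_, fun hlt => ?_⟩
        · exact (hv₂.lt_iff (hcS hc) htS).2 (.inl ((hv₁.lt_iff (hcS hc) htS).2
            (.inr ⟨heq.symm, by rwa [hs₁, hs₂]⟩)))
        · exact (hv₂.lt_iff htS (hcS hc)).2 (.inl ((hv₁.lt_iff htS (hcS hc)).2
            (.inr ⟨heq, by rwa [hs₁, hs₂]⟩)))
    rcases h.inClass.1 a ha with ⟨c, y, rfl⟩ | ⟨c, y, rfl⟩ | ho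
    · simp only [QTerm.var.injEq] at hx
      subst hx
      change lsi.Rel ((((QTerm.var y).subst e₁).subst μ).val ι v) (ι c)
      change lsi.Rel (u y) (ι c) at hua
      rw [ht]
      rcases hlsi with rfl | rfl
      · exact le_of_not_gt fun h' => (hgt rfl h').not_ge hua
      · refine lt_of_not_ge fun h' => ?_
        rcases h'.lt_or_eq with h' | h'
        · exact (hgt rfl h').not_gt hua
        · rcases heq rfl h'.symm with h'' | h''
          · exact hua.ne h''
          · exact (h''.1 (hφl _ ha c ⟨y, rfl⟩)).not_gt hua
    · simp only [QTerm.var.injEq] at hx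
      subst hx
      change rsi.Rel ((((QTerm.var y).subst e₁).subst μ).val ι v) (ι c)
      change rsi.Rel (u y) (ι c) at hua
      rw [ht]
      rcases hrsi with rfl | rfl
      · exact le_of_not_gt fun h' => (hlt rfl h').not_ge hua
      · refine lt_of_not_ge fun h' => ?_
        rcases h'.lt_or_eq with h' | h'
        · exact (hlt rfl h').not_gt hua
        · rcases heq rfl h' with h'' | h''
          · exact hua.ne h''.symm
          · exact (h''.2 (hφr _ ha c ⟨y, rfl⟩)).not_gt hua
    -- Both sides of an equation of `Q₁` have the same representative, so its image is trivial.
    · have : a.lhs.subst e₁ = a.rhs.subst e₁ := by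
        refine subst_eqRepr_eq h.wf₁.consistent ?_
        have := implied_of_mem (ι := ι) ha
        rwa [show a = ⟨a.lhs, .eq, a.rhs⟩ by rw [← ho]] at this
      change a.op.Rel (((a.lhs.subst e₁).subst μ).val ι v) (((a.rhs.subst e₁).subst μ).val ι v)
      rw [this, ho]
      rfl

end Perturbation

/-! ### The verifier -/

/-- The list whose members are the left subtrees along the right spine of a tree. -/
def BTree.toList : BTree → List BTree
  | .nil => []
  | .cons l r => l :: r.toList

theorem BTree.code_toList (x : BTree) : code x.toList = x := by
  induction x with
  | nil => rfl
  | cons l r _ ih => rw [toList, code_cons, ih]; rfl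

theorem BTree.toList_code (l : List BTree) : (code l).toList = l := by
  induction l with
  | nil => rfl
  | cons a l ih => rw [code_cons, toList, ih]; rfl

/-- The term that the certificate `m`, a list of pairs of terms, assigns to `t`, restricted to the
candidates in `cands`. -/
def lookupTerm (m : BTree) (cands : List QTerm) (t : QTerm) : QTerm :=
  -- The search runs over the candidates and compares codes, so that trees in the certificate need
  -- not be decoded into terms.
  (cands.filter fun s => memCode (BTree.cons (code t) (code s)) m.toList).headD (.const 0)

/-- The substitution of variables that is described by a certificate. -/
def certSubst (m : BTree) (cands : List QTerm) (x : ℕ) : QTerm := lookupTerm m cands (.var x)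

/-- Tests whether the comparison is of the form `X op c`. -/
def Comparison.siTest (op : CompOp) (a : Comparison) : Bool :=
  !a.lhs.isConst && PolyTime.sameCode a.op op && a.rhs.isConst

/-- Tests whether the comparison is a right semi-interval. -/
def Comparison.rsiTest (a : Comparison) : Bool := a.siTest .gt || a.siTest .ge

/-- Tests whether the comparison is a left semi-interval. -/
def Comparison.lsiTest (a : Comparison) : Bool := a.siTest .lt || a.siTest .le

/-- Tests whether the comparison is an open semi-interval. -/
def Comparison.openTest (a : Comparison) : Bool := a.siTest .lt || a.siTest .gt

/-- A comparison that is always false. -/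
def falseComparison : Comparison := ⟨.const 0, .ne, .const 0⟩

/-- The negation of the image of the right semi-interval in `β`, if there is one. -/
def negatedRSI (σ : ℕ → QTerm) (β : List Comparison) : Comparison :=
  -- Without an RSI, a mapping that passes the test settles every model, and the false comparison as
  -- default closes the refutation at once.
  ((β.filter Comparison.rsiTest).map fun a => (a.subst σ).neg).headD falseComparison

/-- Tests a property of corresponding members of two lists of the same length. -/
def allTwo {α β : Type*} (p : α → β → Bool) : List α → List β → Bool
  | [], [] => true
  | a :: l, b :: m => p a b && allTwo p l m
  | [], _ :: _ => false
  | _ :: _, [] => false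

theorem allTwo_iff {α β : Type*} {p : α → β → Bool} {l : List α} {m : List β} :
    allTwo p l m = true ↔ List.Forall₂ (fun a b => p a b = true) l m := by
  induction l generalizing m with
  | nil => cases m <;> simp [allTwo]
  | cons a l ih => cases m <;> simp [allTwo, ih]

/-- Tests whether two lists of terms are equal under `σ` by the equations that `β` implies. -/
def equalTest (β : List Comparison) (σ : ℕ → QTerm) (l m : List QTerm) : Bool :=
  allTwo (fun s t => impTest β ⟨s.subst σ, .eq, t⟩) l m

/-- Tests whether `σ` is a containment mapping from `Q₁` to `Q₂` modulo the equations that `β`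
implies, and `β` implies the images of all comparisons of `Q₁` except right semi-intervals. -/
def mappingTest (Q₂ Q₁ : CQAC) (β : List Comparison) (σ : ℕ → QTerm) : Bool :=
  (Q₁.body.all fun a => Q₂.body.any fun b =>
      PolyTime.sameCode a.rel b.rel && equalTest β σ a.args b.args) &&
    equalTest β σ Q₁.head Q₂.head &&
    Q₁.acs.all fun a => a.rsiTest || impTest β (a.subst σ)

/-- Tests whether a list of mappings refutes `β`: each mapping yields the negation of a right
semi-interval, which is added to `β`, until a contradiction is reached. -/
def refutationTest (Q₂ Q₁ : CQAC) : List BTree → List Comparison → Bool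
  | [], β => !satTest β
  | m :: ms, β => mappingTest Q₂ Q₁ β (certSubst m Q₂.bodyTerms) &&
      refutationTest Q₂ Q₁ ms (negatedRSI (certSubst m Q₂.bodyTerms) Q₁.acs :: β)

/-- Decision procedure for `CQAC.WellFormed`. -/
def wellFormedTest (Q : CQAC) : Bool :=
  (Q.head.all fun t => t.isConst || memCode t Q.bodyTerms) &&
    (Q.acs.all fun a => !a.lhs.isConst) &&
    ((acTerms Q.acs).all fun t => t.isConst || memCode t Q.bodyTerms) && satTest Q.acs

/-- Decision procedure for `InClassRSI1`. -/
def classTest (lsi rsi : CompOp) (Q : CQAC) : Bool :=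
  (Q.acs.all fun a => a.siTest lsi || a.siTest rsi || PolyTime.sameCode a.op .eq) &&
    PolyTime.sameCode (Q.acs.filter Comparison.rsiTest).tail []

/-- Tests whether `β` implies a closed semi-interval with term `t` and constant `c`, and nothing
stronger. -/
def closedTest (β : List Comparison) (t c : QTerm) : Bool :=
  !impTest β ⟨t, .eq, c⟩ && ((impTest β ⟨t, .le, c⟩ && !impTest β ⟨t, .lt, c⟩) ||
    (impTest β ⟨t, .ge, c⟩ && !impTest β ⟨t, .gt, c⟩))

/-- Decision procedure for `IsInstance`. -/
def instanceTest (lsi rsi : CompOp) (Q₂ Q₁ : CQAC) : Bool :=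
  wellFormedTest Q₂ && wellFormedTest Q₁ && classTest lsi rsi Q₁ &&
    (Q₁.acs.all fun a => Q₁.acs.all fun b =>
      !(a.rsiTest && b.lsiTest && PolyTime.sameCode a.rhs b.rhs)) &&
    Q₁.acs.all fun a => !a.openTest ||
      (acTerms Q₂.acs).all fun t => t.isConst || !closedTest Q₂.acs t a.rhs

/-- The verifier. -/
def verify (lsi rsi : CompOp) (x : (CQAC × CQAC) × BTree) : Bool :=
  instanceTest lsi rsi x.1.1 x.1.2 && refutationTest x.1.1 x.1.2 x.2.toList x.1.1.acs

/-! ### The verifier runs in polynomial time. -/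

namespace PolyTime

variable {α β γ δ : Type*} [TreeCode α] [TreeCode β] [TreeCode γ] [TreeCode δ]

theorem headD {l : α → List β} {d : α → β} (hl : PolyTime l) (hd : PolyTime d) :
    PolyTime fun a => (l a).headD (d a) := by
  refine (foldr_of_additive (step := fun _ e _ => e) hl hd (snd (snd .id))
    ⟨Polynomial.X, fun a acc e => ?_⟩).recode fun a => by cases l a <;> rfl
  rw [Polynomial.eval_X, codeSize_pair]
  omega

/-- The simultaneous recursion becomes a fold over the first list that carries along the rest of the
second. -/
theorem allTwo {l : α → List γ} {m : α → List δ} {p : α → γ → δ → Bool} (hl : PolyTime l)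
    (hm : PolyTime m) (hp : PolyTime fun z : (α × γ) × δ => p z.1.1 z.1.2 z.2) :
    PolyTime fun a => allTwo (p a) (l a) (m a) := by
  have hstep : PolyTime fun z : α × (Bool × List δ) × γ =>
      (z.2.1.1 && (z.2.1.2.map fun d => p z.1 z.2.2 d).headD false, z.2.1.2.tail) := by
    refine .pair (.and (fst (fst (snd .id))) (.headD (.map (f := fun z d => p z.1 z.2.2 d)
      (snd (fst (snd .id))) ?_) (.const false))) (.tail (snd (fst (snd .id))))
    exact hp.comp (f := fun z : (α × (Bool × List δ) × γ) × δ => ((z.1.1, z.1.2.2), z.2))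
      (.pair (.pair (fst (fst .id)) (snd (snd (fst .id)))) (snd .id))
  have key := foldl_of_additive (step := fun a (s : Bool × List δ) e =>
    (s.1 && (s.2.map fun d => p a e d).headD false, s.2.tail)) hl (.pair (.const true) hm) hstep
    ⟨3, fun a s e => by
      have h₁ := codeSize_bool_le (s.1 && (s.2.map fun d => p a e d).headD false)
      have h₂ : codeSize s.2.tail ≤ codeSize s.2 := by
        cases s.2
        · exact le_rfl
        · rw [List.tail_cons, codeSize_cons]; omega
      obtain ⟨c, r⟩ := s
      rw [codeSize_pair, codeSize_pair, Polynomial.eval_ofNat]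
      simp only at *
      omega⟩
  refine (key.fst.and (key.snd.same (.const []))).recode fun a => ?_
  congr 1
  have : ∀ (l : List γ) (m : List δ) (c : Bool), (c && _root_.allTwo (p a) l m) =
      ((l.foldl (fun (s : Bool × List δ) e =>
        (s.1 && (s.2.map fun d => p a e d).headD false, s.2.tail)) (c, m)).1 &&
      sameCode (l.foldl (fun (s : Bool × List δ) e =>
        (s.1 && (s.2.map fun d => p a e d).headD false, s.2.tail)) (c, m)).2 []) := by
    intro l
    induction l with
    | nil => intro m c; cases m <;> simp [_root_.allTwo, sameCode, code_cons, code_nil]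
    | cons e l ih =>
      intro m c
      rw [List.foldl_cons, ← ih]
      cases m <;> simp [_root_.allTwo, Bool.and_assoc]
  simpa using this (l a) (m a) true

theorem treeToList {f : α → BTree} (hf : PolyTime f) : PolyTime fun a => (f a).toList :=
  hf.recode fun a => BTree.code_toList (f a)

theorem bodyTerms {f : α → CQAC} (hf : PolyTime f) : PolyTime fun a => (f a).bodyTerms :=
  hf.queryBody.flatMap (f := fun _ => QAtom.args) (.atomArgs (.snd .id))

theorem lookupTerm {m : α → BTree} {cands : α → List QTerm} {t : α → QTerm} (hm : PolyTime m)
    (hc : PolyTime cands) (ht : PolyTime t) :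
    PolyTime fun a => lookupTerm (m a) (cands a) (t a) := by
  refine headD (hc.filter (p := fun a s =>
    _root_.memCode (BTree.cons (code (t a)) (code s)) (m a).toList) ?_) (.const _)
  refine .memCode ?_ (hm.comp (fst .id)).treeToList
  exact ((ht.comp (fst .id)).pair (snd .id)).recode fun _ => rfl

theorem certSubst {m : α → BTree} {cands : α → List QTerm} {t : α → QTerm} (hm : PolyTime m)
    (hc : PolyTime cands) (ht : PolyTime t) :
    PolyTime fun a => (t a).subst (certSubst (m a) (cands a)) :=
  (ht.isConst.cond ht (lookupTerm hm hc ht)).recode fun a => by cases t a <;> rfl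

theorem compSubst {m : α → BTree} {cands : α → List QTerm} {c : α → Comparison} (hm : PolyTime m)
    (hc : PolyTime cands) (h : PolyTime c) :
    PolyTime fun a => (c a).subst (_root_.certSubst (m a) (cands a)) :=
  compMk (certSubst hm hc h.compLhs) h.compOp (certSubst hm hc h.compRhs)

theorem siTest (op : CompOp) {f : α → Comparison} (hf : PolyTime f) :
    PolyTime fun a => (f a).siTest op :=
  .and (.and (.not hf.compLhs.isConst) (hf.compOp.same (.const op))) hf.compRhs.isConst

theorem rsiTest {f : α → Comparison} (hf : PolyTime f) : PolyTime fun a => (f a).rsiTest :=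
  .or (hf.siTest .gt) (hf.siTest .ge)

theorem lsiTest {f : α → Comparison} (hf : PolyTime f) : PolyTime fun a => (f a).lsiTest :=
  .or (hf.siTest .lt) (hf.siTest .le)

theorem openTest {f : α → Comparison} (hf : PolyTime f) : PolyTime fun a => (f a).openTest :=
  .or (hf.siTest .lt) (hf.siTest .gt)

theorem negatedRSI {m : α → BTree} {cands : α → List QTerm} {f : α → List Comparison}
    (hm : PolyTime m) (hc : PolyTime cands) (hf : PolyTime f) :
    PolyTime fun a => negatedRSI (_root_.certSubst (m a) (cands a)) (f a) :=
  headD ((hf.filter (p := fun _ => Comparison.rsiTest) (rsiTest (snd .id))).map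
    (f := fun a c => (c.subst (_root_.certSubst (m a) (cands a))).neg)
    (compNeg (compSubst (hm.comp (fst .id)) (hc.comp (fst .id)) (snd .id)))) (.const _)

theorem equalTest {m : α → BTree} {cands : α → List QTerm} {f : α → List Comparison}
    {l₁ l₂ : α → List QTerm} (hm : PolyTime m) (hc : PolyTime cands) (hf : PolyTime f)
    (h₁ : PolyTime l₁) (h₂ : PolyTime l₂) :
    PolyTime fun a => equalTest (f a) (_root_.certSubst (m a) (cands a)) (l₁ a) (l₂ a) := by
  have hz : PolyTime fun z : (α × QTerm) × QTerm => z.1.1 := fst (fst .id)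
  have hs : PolyTime fun z : (α × QTerm) × QTerm =>
      z.1.2.subst (_root_.certSubst (m z.1.1) (cands z.1.1)) :=
    certSubst (hm.comp hz) (hc.comp hz) (snd (fst .id))
  have hi : PolyTime fun z : (α × QTerm) × QTerm => _root_.impTest (f z.1.1)
      ⟨z.1.2.subst (_root_.certSubst (m z.1.1) (cands z.1.1)), .eq, z.2⟩ :=
    impTest (hf.comp hz) (compMk hs (.const CompOp.eq) (snd .id))
  exact allTwo (γ := QTerm) (δ := QTerm) (p := fun a s t =>
    _root_.impTest (f a) ⟨s.subst (_root_.certSubst (m a) (cands a)), .eq, t⟩) h₁ h₂ hi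

theorem mappingTest {m : α → BTree} {Q₂ Q₁ : α → CQAC} {f : α → List Comparison}
    (hm : PolyTime m) (h₂ : PolyTime Q₂) (h₁ : PolyTime Q₁) (hf : PolyTime f) :
    PolyTime fun a => mappingTest (Q₂ a) (Q₁ a) (f a)
      (_root_.certSubst (m a) (Q₂ a).bodyTerms) := by
  have hbody : PolyTime fun a => (Q₁ a).body.all fun c => (Q₂ a).body.any fun b =>
      sameCode c.rel b.rel && _root_.equalTest (f a) (_root_.certSubst (m a) (Q₂ a).bodyTerms)
        c.args b.args := by
    have hz : PolyTime fun z : (α × QAtom) × QAtom => z.1.1 := fst (fst .id)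
    have hc : PolyTime fun z : (α × QAtom) × QAtom => z.1.2 := snd (fst .id)
    have hb : PolyTime fun z : (α × QAtom) × QAtom => z.2 := snd .id
    have he := PolyTime.equalTest (hm.comp hz) (h₂.bodyTerms.comp hz) (hf.comp hz)
      (.atomArgs hc) (.atomArgs hb)
    have hany : PolyTime fun z : α × QAtom => (Q₂ z.1).body.any fun b =>
        sameCode z.2.rel b.rel && _root_.equalTest (f z.1)
          (_root_.certSubst (m z.1) (Q₂ z.1).bodyTerms) z.2.args b.args :=
      PolyTime.any (γ := QAtom) (p := fun (z : α × QAtom) b => sameCode z.2.rel b.rel &&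
        _root_.equalTest (f z.1) (_root_.certSubst (m z.1) (Q₂ z.1).bodyTerms) z.2.args b.args)
        (h₂.comp (fst .id)).queryBody (.and (.same (.atomRel hc) (.atomRel hb)) he)
    exact PolyTime.all (γ := QAtom) (p := fun a c => (Q₂ a).body.any fun b =>
      sameCode c.rel b.rel && _root_.equalTest (f a) (_root_.certSubst (m a) (Q₂ a).bodyTerms)
        c.args b.args) h₁.queryBody hany
  have hacs : PolyTime fun a => (Q₁ a).acs.all fun c => c.rsiTest ||
      _root_.impTest (f a) (c.subst (_root_.certSubst (m a) (Q₂ a).bodyTerms)) := by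
    have hz : PolyTime fun z : α × Comparison => z.1 := fst .id
    have hc : PolyTime fun z : α × Comparison => z.2 := snd .id
    exact PolyTime.all (γ := Comparison) (p := fun a c => c.rsiTest ||
      _root_.impTest (f a) (c.subst (_root_.certSubst (m a) (Q₂ a).bodyTerms))) h₁.queryAcs
      (.or (rsiTest hc) (impTest (hf.comp hz) (compSubst (hm.comp hz) (h₂.bodyTerms.comp hz) hc)))
  exact .and (.and hbody (equalTest hm h₂.bodyTerms hf h₁.queryHead h₂.queryHead)) hacs

/-- A fold over the mappings whose state is the verdict so far and the comparisons collected so far.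
Each mapping adds one comparison, of a size independent of those before it. -/
theorem refutationTest {Q₂ Q₁ : α → CQAC} {ms : α → List BTree} {f : α → List Comparison}
    (h₂ : PolyTime Q₂) (h₁ : PolyTime Q₁) (hms : PolyTime ms) (hf : PolyTime f) :
    PolyTime fun a => refutationTest (Q₂ a) (Q₁ a) (ms a) (f a) := by
  have hneg : PolyTime fun z : α × BTree => _root_.negatedRSI
      (_root_.certSubst z.2 (Q₂ z.1).bodyTerms) (Q₁ z.1).acs :=
    negatedRSI (snd .id) (h₂.comp (fst .id)).bodyTerms (h₁.comp (fst .id)).queryAcs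
  obtain ⟨r, hr⟩ := hneg.codeSize_le
  have key := foldl_of_additive (step := fun a (s : Bool × List Comparison) e =>
    (s.1 && _root_.mappingTest (Q₂ a) (Q₁ a) s.2 (_root_.certSubst e (Q₂ a).bodyTerms),
      _root_.negatedRSI (_root_.certSubst e (Q₂ a).bodyTerms) (Q₁ a).acs :: s.2)) hms
    (.pair (.const true) hf)
    (.pair (.and (fst (fst (snd .id))) (mappingTest (snd (snd .id)) (h₂.comp (fst .id))
      (h₁.comp (fst .id)) (snd (fst (snd .id)))))
      (.cons (hneg.comp (.pair (fst .id) (snd (snd .id)))) (snd (fst (snd .id)))))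
    ⟨r + 4, fun a s e => by
      have h₁ := codeSize_bool_le (s.1 && _root_.mappingTest (Q₂ a) (Q₁ a) s.2
        (_root_.certSubst e (Q₂ a).bodyTerms))
      have h₂ := hr (a, e)
      obtain ⟨c, b⟩ := s
      rw [codeSize_pair, codeSize_pair, codeSize_cons, Polynomial.eval_add, Polynomial.eval_ofNat]
      simp only at *
      omega⟩
  refine (key.fst.and key.snd.satTest.not).recode fun a => ?_
  congr 1
  have : ∀ (ms : List BTree) (b : List Comparison) (c : Bool),
      (c && _root_.refutationTest (Q₂ a) (Q₁ a) ms b) =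
      ((ms.foldl (fun (s : Bool × List Comparison) e =>
        (s.1 && _root_.mappingTest (Q₂ a) (Q₁ a) s.2 (_root_.certSubst e (Q₂ a).bodyTerms),
          _root_.negatedRSI (_root_.certSubst e (Q₂ a).bodyTerms) (Q₁ a).acs :: s.2)) (c, b)).1 &&
      !_root_.satTest (ms.foldl (fun (s : Bool × List Comparison) e =>
        (s.1 && _root_.mappingTest (Q₂ a) (Q₁ a) s.2 (_root_.certSubst e (Q₂ a).bodyTerms),
          _root_.negatedRSI (_root_.certSubst e (Q₂ a).bodyTerms) (Q₁ a).acs :: s.2))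
        (c, b)).2) := by
    intro ms
    induction ms with
    | nil => intro b c; rfl
    | cons e ms ih =>
      intro b c
      rw [List.foldl_cons, ← ih, _root_.refutationTest, Bool.and_assoc]
  simpa using this (ms a) (f a) true

theorem wellFormedTest {f : α → CQAC} (hf : PolyTime f) : PolyTime fun a => wellFormedTest (f a) :=
  have h : PolyTime fun z : α × QTerm =>
      z.2.isConst || _root_.memCode z.2 (f z.1).bodyTerms :=
    .or (.isConst (snd .id)) (.memCode (snd .id) (hf.comp (fst .id)).bodyTerms)
  .and (.and (.and
    (hf.queryHead.all (p := fun a t => t.isConst || _root_.memCode t (f a).bodyTerms) h)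
    (hf.queryAcs.all (p := fun _ c => !c.lhs.isConst) (.not (.isConst (.compLhs (snd .id))))))
    (hf.queryAcs.acTerms.all
      (p := fun a t => t.isConst || _root_.memCode t (f a).bodyTerms) h)) hf.queryAcs.satTest

theorem classTest (lsi rsi : CompOp) {f : α → CQAC} (hf : PolyTime f) :
    PolyTime fun a => classTest lsi rsi (f a) :=
  .and (hf.queryAcs.all
      (p := fun _ c => c.siTest lsi || c.siTest rsi || sameCode c.op .eq)
      (.or (.or (siTest lsi (snd .id)) (siTest rsi (snd .id)))
        (.same (.compOp (snd .id)) (.const _))))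
    (.same (.tail (hf.queryAcs.filter (p := fun _ => Comparison.rsiTest) (rsiTest (snd .id))))
      (.const []))

theorem closedTest {f : α → List Comparison} {t c : α → QTerm} (hf : PolyTime f)
    (ht : PolyTime t) (hc : PolyTime c) : PolyTime fun a => closedTest (f a) (t a) (c a) :=
  have h : ∀ o, PolyTime fun a => _root_.impTest (f a) ⟨t a, o, c a⟩ := fun o =>
    impTest hf (compMk ht (.const o) hc)
  .and (h .eq).not (.or (.and (h .le) (h .lt).not) (.and (h .ge) (h .gt).not))

theorem instanceTest (lsi rsi : CompOp) {Q₂ Q₁ : α → CQAC} (h₂ : PolyTime Q₂)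
    (h₁ : PolyTime Q₁) : PolyTime fun a => instanceTest lsi rsi (Q₂ a) (Q₁ a) := by
  refine .and (.and (.and (.and h₂.wellFormedTest h₁.wellFormedTest) (h₁.classTest lsi rsi))
    (h₁.queryAcs.all (p := fun a c => (Q₁ a).acs.all fun b =>
      !(c.rsiTest && b.lsiTest && sameCode c.rhs b.rhs)) ?_))
    (h₁.queryAcs.all (p := fun a c => !c.openTest || (_root_.acTerms (Q₂ a).acs).all fun t =>
      t.isConst || !_root_.closedTest (Q₂ a).acs t c.rhs) ?_)
  · exact (h₁.comp (fst .id)).queryAcs.all (p := fun (z : α × Comparison) b =>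
      !(z.2.rsiTest && b.lsiTest && sameCode z.2.rhs b.rhs))
      (.not (.and (.and (rsiTest (snd (fst .id))) (lsiTest (snd .id)))
        (.same (.compRhs (snd (fst .id))) (.compRhs (snd .id)))))
  · exact .or (.not (openTest (snd .id))) ((h₂.comp (fst .id)).queryAcs.acTerms.all
      (p := fun (z : α × Comparison) t => t.isConst ||
        !_root_.closedTest (Q₂ z.1).acs t z.2.rhs)
      (.or (.isConst (snd .id)) (.not (closedTest (h₂.comp (fst (fst .id))).queryAcs (snd .id)
        (.compRhs (snd (fst .id)))))))

theorem verify (lsi rsi : CompOp) : PolyTime (verify lsi rsi) :=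
  .and (instanceTest lsi rsi (fst (fst .id)) (snd (fst .id)))
    (refutationTest (fst (fst .id)) (snd (fst .id)) (.treeToList (snd .id))
      (.queryAcs (fst (fst .id))))

end PolyTime

/-! ### Correctness of the verifier -/

theorem Comparison.siTest_iff {op : CompOp} {a : Comparison} :
    a.siTest op = true ↔ ∃ c, a.IsSI op c := by
  obtain ⟨l, o, r⟩ := a
  cases l <;> cases r <;>
    simp [siTest, IsSI, QTerm.isConst, PolyTime.sameCode_iff]

theorem Comparison.rsiTest_iff {a : Comparison} : a.rsiTest = true ↔ ∃ c, a.IsRSI c := by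
  simp [rsiTest, siTest_iff, IsRSI, exists_or]

theorem Comparison.lsiTest_iff {a : Comparison} : a.lsiTest = true ↔ ∃ c, a.IsLSI c := by
  simp [lsiTest, siTest_iff, IsLSI, exists_or]

theorem Comparison.openTest_iff {a : Comparison} : a.openTest = true ↔ ∃ c, a.IsOpenSI c := by
  simp [openTest, siTest_iff, IsOpenSI, exists_or]

theorem Comparison.IsSI.rhs_eq {a : Comparison} {op : CompOp} {c : ℚ} (h : a.IsSI op c) :
    a.rhs = .const c := by
  obtain ⟨x, rfl⟩ := h
  rfl

theorem Comparison.IsRSI.rhs_eq {a : Comparison} {c : ℚ} (h : a.IsRSI c) : a.rhs = .const c :=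
  h.elim IsSI.rhs_eq IsSI.rhs_eq

theorem Comparison.IsLSI.rhs_eq {a : Comparison} {c : ℚ} (h : a.IsLSI c) : a.rhs = .const c :=
  h.elim IsSI.rhs_eq IsSI.rhs_eq

theorem Comparison.IsOpenSI.rhs_eq {a : Comparison} {c : ℚ} (h : a.IsOpenSI c) :
    a.rhs = .const c :=
  h.elim IsSI.rhs_eq IsSI.rhs_eq

theorem safe_iff {Q : CQAC} {t : QTerm} :
    (t.isConst || memCode t Q.bodyTerms) = true ↔ ∀ x, t = .var x → Q.InBody x := by
  cases t <;> simp [QTerm.isConst, memCode_iff, CQAC.inBody_iff]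

theorem classTest_iff {lsi rsi : CompOp} {Q : CQAC} :
    classTest lsi rsi Q = true ↔ InClassRSI1 lsi rsi Q := by
  have hcount : ((Q.acs.filter Comparison.rsiTest).tail = []) ↔
      Q.acs.countP Comparison.rsiTest ≤ 1 := by
    rw [List.countP_eq_length_filter]
    rcases Q.acs.filter Comparison.rsiTest with _ | ⟨a, _ | ⟨b, l⟩⟩ <;> simp
  have hdec : ∀ a : Comparison, a.rsiTest = @decide (∃ c, a.IsRSI c) (Classical.propDecidable _) :=
    fun a => by classical rw [Bool.eq_iff_iff, decide_eq_true_iff, Comparison.rsiTest_iff]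
  rw [classTest, Bool.and_eq_true, PolyTime.sameCode_iff, hcount, InClassRSI1,
    show Comparison.rsiTest = _ from funext hdec]
  refine and_congr ?_ Iff.rfl
  simp [List.all_eq_true, Comparison.siTest_iff, PolyTime.sameCode_iff, or_assoc]

section

variable {D : Type*} [LinearOrder D] {ι : ℚ ↪o D}

/-- A variable that is absent from `β` can take any value, so no bound on it is implied. Hence
condition (b), which concerns all variables, can be tested on the terms of `β`. -/
theorem mem_acTerms_of_inClosedSI [DenselyOrdered D] [NoMinOrder D] [NoMaxOrder D]
    {β : List Comparison} (hβ : Satisfiable ι β) {x : ℕ} {c : ℚ}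
    (h : Implied ι β ⟨.var x, .le, .const c⟩ ∨ Implied ι β ⟨.var x, .ge, .const c⟩) :
    QTerm.var x ∈ acTerms β := by
  by_contra hx
  obtain ⟨v, hv⟩ := hβ
  have hupd : ∀ d, AllHold ι (Function.update v x d) β := by
    intro d a ha
    have hval : ∀ t ∈ acTerms β, t.val ι (Function.update v x d) = t.val ι v := by
      intro t ht
      cases t with
      | const c => rfl
      | var y => exact Function.update_of_ne (fun hy : y = x => hx (by rwa [← hy])) _ _
    rw [Comparison.Holds, hval _ (mem_acTerms_lhs ha), hval _ (mem_acTerms_rhs ha)]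
    exact hv a ha
  rcases h with h | h
  · obtain ⟨d, hd⟩ := exists_gt (ι c)
    have := h _ (hupd d)
    simp only [Comparison.Holds, CompOp.Rel, QTerm.val, Function.update_self] at this
    exact this.not_gt hd
  · obtain ⟨d, hd⟩ := exists_lt (ι c)
    have := h _ (hupd d)
    simp only [Comparison.Holds, CompOp.Rel, QTerm.val, Function.update_self] at this
    exact this.not_gt hd

/-- The negations of images of right semi-intervals of `Q₁` under mappings to the terms of `Q₂`,
and a false comparison. -/
def refutationCandidates (Q₂ Q₁ : CQAC) : List Comparison :=
  falseComparison :: (Q₁.acs.filter Comparison.rsiTest).flatMap fun r =>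
    Q₂.bodyTerms.map fun t => ⟨t, r.op.neg, r.rhs⟩

/-- A single RSI contributes at most one negated image for each term in the body of `Q₂`; the
remaining candidate is the false comparison. This bounds the number of mappings in a certificate. -/
theorem length_refutationCandidates {Q₂ Q₁ : CQAC}
    (hr : (Q₁.acs.filter Comparison.rsiTest).tail = []) :
    (refutationCandidates Q₂ Q₁).length ≤ Q₂.bodyTerms.length + 1 := by
  rw [refutationCandidates]
  generalize Q₁.acs.filter Comparison.rsiTest = l at hr
  rcases l with _ | ⟨b, l⟩
  · simp
  · rw [List.tail_cons] at hr
    simp [hr]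

theorem negatedRSI_mem_refutationCandidates {Q₂ Q₁ : CQAC}
    (hwf : Q₁.WellFormed ι) {σ : ℕ → QTerm}
    (hσ : ∀ x, Q₁.InBody x → σ x ∈ Q₂.bodyTerms) :
    negatedRSI σ Q₁.acs ∈ refutationCandidates Q₂ Q₁ := by
  rw [negatedRSI, refutationCandidates]
  have hmem : ∀ a ∈ Q₁.acs.filter Comparison.rsiTest, a ∈ Q₁.acs ∧ a.rsiTest = true :=
    fun a => List.mem_filter.1
  generalize Q₁.acs.filter Comparison.rsiTest = l at hmem
  rcases l with _ | ⟨b, l⟩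
  · simp
  · obtain ⟨hb, hbr⟩ := hmem b (by simp)
    obtain ⟨c, hc⟩ := Comparison.rsiTest_iff.1 hbr
    obtain ⟨x, hx⟩ := hwf.lhs_var b hb
    refine List.mem_cons_of_mem _ (List.mem_flatMap.2 ⟨b, by simp, List.mem_map.2
      ⟨σ x, hσ x (hwf.acs_safe b hb x (.inl hx)), ?_⟩⟩)
    simp only [List.map_cons, List.headD_cons, Comparison.neg, Comparison.subst, hx, hc.rhs_eq,
      QTerm.subst]

variable [DenselyOrdered D] [NoMinOrder D] [NoMaxOrder D]

theorem wellFormedTest_iff (ι : ℚ ↪o D) {Q : CQAC} :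
    wellFormedTest Q = true ↔ Q.WellFormed ι := by
  simp only [wellFormedTest, Bool.and_eq_true, List.all_eq_true, safe_iff, satTest_iff ι]
  constructor
  · rintro ⟨⟨⟨h₁, h₂⟩, h₃⟩, h₄⟩
    refine ⟨fun x hx => h₁ _ hx x rfl, fun a ha => ?_, fun a ha x hx => ?_, h₄⟩
    · have := h₂ a ha
      cases h : a.lhs with
      | var x => exact ⟨x, rfl⟩
      | const c => simp [h, QTerm.isConst] at this
    · rcases hx with hx | hx
      · exact h₃ _ (mem_acTerms_lhs ha) x hx
      · exact h₃ _ (mem_acTerms_rhs ha) x hx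
  · rintro ⟨h₁, h₂, h₃, h₄⟩
    refine ⟨⟨⟨fun t ht x hx => h₁ x (hx ▸ ht), fun a ha => ?_⟩, fun t ht x hx => ?_⟩, h₄⟩
    · obtain ⟨x, hx⟩ := h₂ a ha
      simp [hx, QTerm.isConst]
    · obtain ⟨a, ha, hat⟩ := mem_acTerms.1 ht
      exact h₃ a ha x (hx ▸ hat.imp Eq.symm Eq.symm)

theorem closedTest_all_iff {β : List Comparison} (hβ : Satisfiable ι β) {c : ℚ} :
    ((acTerms β).all fun t => t.isConst || !closedTest β t (.const c)) = true ↔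
      ¬ InClosedSI ι β c := by
  simp only [List.all_eq_true, InClosedSI, not_exists]
  constructor
  · intro h x ⟨h₁, h₂⟩
    have := h (.var x) (mem_acTerms_of_inClosedSI hβ (h₂.imp And.left And.left))
    simp [QTerm.isConst, closedTest, ← Bool.not_eq_true, impTest_iff ι] at this
    tauto
  · intro h t _
    cases t with
    | const d => rfl
    | var x =>
      have := h x
      simp only [QTerm.isConst, closedTest, Bool.false_or, Bool.not_eq_true', ← Bool.not_eq_true,
        Bool.and_eq_true, Bool.or_eq_true, impTest_iff ι]
      exact this

theorem instanceTest_iff (ι : ℚ ↪o D) {lsi rsi : CompOp} {Q₂ Q₁ : CQAC} :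
    instanceTest lsi rsi Q₂ Q₁ = true ↔ IsInstance ι lsi rsi Q₂ Q₁ := by
  simp only [instanceTest, Bool.and_eq_true, wellFormedTest_iff ι, classTest_iff]
  constructor
  · rintro ⟨⟨⟨⟨h₁, h₂⟩, h₃⟩, h₄⟩, h₅⟩
    refine ⟨h₁, h₂, h₃, fun a ha b hb c d hac hbd hcd => ?_, fun a ha c hac => ?_⟩
    · have := List.all_eq_true.1 (List.all_eq_true.1 h₄ a ha) b hb
      rw [Comparison.rsiTest_iff.2 ⟨c, hac⟩, Comparison.lsiTest_iff.2 ⟨d, hbd⟩, hac.rhs_eq,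
        hbd.rhs_eq, hcd, PolyTime.sameCode_iff.2 rfl] at this
      exact absurd this (by decide)
    · have := List.all_eq_true.1 h₅ a ha
      rw [Comparison.openTest_iff.2 ⟨c, hac⟩, hac.rhs_eq] at this
      exact (closedTest_all_iff h₁.consistent).1 this
  · rintro ⟨h₁, h₂, h₃, h₄, h₅⟩
    refine ⟨⟨⟨⟨h₁, h₂⟩, h₃⟩, ?_⟩, ?_⟩
    · refine List.all_eq_true.2 fun a ha => List.all_eq_true.2 fun b hb => ?_
      rw [Bool.not_eq_true', ← Bool.not_eq_true, Bool.and_eq_true, Bool.and_eq_true,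
        Comparison.rsiTest_iff, Comparison.lsiTest_iff, PolyTime.sameCode_iff]
      rintro ⟨⟨⟨c, hc⟩, d, hd⟩, h⟩
      rw [hc.rhs_eq, hd.rhs_eq] at h
      exact h₄ a ha b hb c d hc hd (QTerm.const.inj h)
    · refine List.all_eq_true.2 fun a ha => ?_
      by_cases hop : a.openTest = true
      · obtain ⟨c, hc⟩ := Comparison.openTest_iff.1 hop
        rw [hc.rhs_eq, (closedTest_all_iff h₁.consistent).2 (h₅ a ha c hc), Bool.or_true]
      · rw [Bool.not_eq_true] at hop
        rw [hop]
        rfl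

/-! #### Soundness -/

theorem equalTest_iff (ι : ℚ ↪o D) {β : List Comparison} {σ : ℕ → QTerm} {l m : List QTerm} :
    equalTest β σ l m = true ↔
      List.Forall₂ (fun s t => Implied ι β ⟨s.subst σ, .eq, t⟩) l m := by
  simp only [equalTest, allTwo_iff, impTest_iff ι]

theorem map_val_eq_of_equalTest {β : List Comparison} {σ : ℕ → QTerm} {l m : List QTerm}
    (h : equalTest β σ l m = true) {v : ℕ → D} (hv : AllHold ι v β) :
    l.map (QTerm.val ι fun x => (σ x).val ι v) = m.map (QTerm.val ι v) := by
  rw [equalTest_iff ι] at h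
  induction h with
  | nil => rfl
  | cons h _ ih =>
    rw [List.map_cons, List.map_cons, ih, ← QTerm.val_subst]
    exact congrArg (· :: _) (h v hv)

theorem mappingTest_iff (ι : ℚ ↪o D) {Q₂ Q₁ : CQAC} {β : List Comparison} {σ : ℕ → QTerm} :
    mappingTest Q₂ Q₁ β σ = true ↔
      (∀ a ∈ Q₁.body, ∃ b ∈ Q₂.body, a.rel = b.rel ∧ equalTest β σ a.args b.args = true) ∧
      equalTest β σ Q₁.head Q₂.head = true ∧
      ∀ a ∈ Q₁.acs, a.rsiTest = true ∨ Implied ι β (a.subst σ) := by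
  simp only [mappingTest, Bool.and_eq_true, List.all_eq_true, List.any_eq_true, Bool.or_eq_true,
    PolyTime.sameCode_iff, impTest_iff ι, and_assoc]

/-- The final comparisons are contradictory, so `v` violates one of the negations that were added.
At the first of these the image of the RSI holds, and the images of the other comparisons are
implied by comparisons that `v` satisfies. -/
theorem exists_assignment_of_refutationTest {Q₂ Q₁ : CQAC}
    (hr : (Q₁.acs.filter Comparison.rsiTest).tail = []) {v : ℕ → D} (ms : List BTree)
    {β : List Comparison} (h : refutationTest Q₂ Q₁ ms β = true) (hv : AllHold ι v β) :
    ∃ u : ℕ → D, (∀ a ∈ Q₁.body, ∃ b ∈ Q₂.body, a.toFact ι u = b.toFact ι v) ∧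
      AllHold ι u Q₁.acs ∧ Q₁.head.map (QTerm.val ι u) = Q₂.head.map (QTerm.val ι v) := by
  induction ms generalizing β with
  | nil =>
    rw [refutationTest, Bool.not_eq_true', ← Bool.not_eq_true, satTest_iff ι] at h
    exact absurd ⟨v, hv⟩ h
  | cons m ms ih =>
    rw [refutationTest, Bool.and_eq_true] at h
    set σ := certSubst m Q₂.bodyTerms
    by_cases hneg : (negatedRSI σ Q₁.acs).Holds ι v
    · exact ih h.2 (allHold_cons.2 ⟨hneg, hv⟩)
    obtain ⟨h₁, h₂, h₃⟩ := (mappingTest_iff ι).1 h.1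
    refine ⟨fun x => (σ x).val ι v, fun a ha => ?_, fun a ha => ?_,
      map_val_eq_of_equalTest h₂ hv⟩
    · obtain ⟨b, hb, hrel, hab⟩ := h₁ a ha
      exact ⟨b, hb, Prod.ext hrel (map_val_eq_of_equalTest hab hv)⟩
    · rw [← Comparison.holds_subst]
      rcases h₃ a ha with hra | himp
      · have hmem : a ∈ Q₁.acs.filter Comparison.rsiTest := List.mem_filter.2 ⟨ha, hra⟩
        by_contra hna
        refine hneg ?_
        rw [negatedRSI]
        generalize Q₁.acs.filter Comparison.rsiTest = l at hr hmem
        rcases l with _ | ⟨b, l⟩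
        · simp at hmem
        -- There is only one RSI, so the violated negation belongs to `a`.
        · rw [List.tail_cons] at hr
          rw [hr, List.mem_singleton] at hmem
          rw [← hmem]
          exact (Comparison.neg_holds ι v _).2 hna
      · exact himp v hv

/-! #### Completeness -/

/-- Adding negated images of right semi-intervals of `Q₁` does not turn an open left semi-interval of `Q₁`
into a closed one. -/
theorem implied_lt_or_eq_of_implied_le {lsi rsi : CompOp} {Q₂ Q₁ : CQAC}
    (h : IsInstance ι lsi rsi Q₂ Q₁) {N : List Comparison}
    (hN : N ⊆ refutationCandidates Q₂ Q₁) {a : Comparison} (ha : a ∈ Q₁.acs) {c : ℚ}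
    (hac : a.IsSI .lt c) {t : QTerm} (hle : Implied ι (N ++ Q₂.acs) ⟨t, .le, .const c⟩) :
    Implied ι (N ++ Q₂.acs) ⟨t, .lt, .const c⟩ ∨ Implied ι (N ++ Q₂.acs) ⟨t, .eq, .const c⟩ := by
  by_contra hcon
  rw [not_or] at hcon
  obtain ⟨hlt, heq⟩ := hcon
  simp only [Implied, not_forall] at hlt
  obtain ⟨v, hv, hvt⟩ := hlt
  have hvc : t.val ι v = ι c := by
    have h₁ : t.val ι v ≤ ι c := hle v hv
    have h₂ : ¬ t.val ι v < ι c := hvt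
    exact le_antisymm h₁ (not_lt.1 h₂)
  have hv₂ : AllHold ι v Q₂.acs := fun b hb => hv b (List.mem_append_right _ hb)
  obtain ⟨φ, hφ, hφl, hφr⟩ := exists_shift h
  have hφ' : ∀ c, InClosedSI ι Q₂.acs c → φ (ι c) = ι c := fun c hc =>
    hφ c fun a ha hac => h.open_closed a ha c hac hc
  -- A forced value would have to be `c`, because `t` equals `c` at `v`; but the equation is not
  -- implied.
  have hnf : ¬ Forced ι Q₂.acs t := by
    rintro ⟨d, hd⟩
    have h₁ : t.val ι v = ι d := hd v hv₂
    have h₂ : d = c := ι.injective (h₁.symm.trans hvc)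
    subst h₂
    exact heq fun w hw => hd w fun b hb => hw b (List.mem_append_right _ hb)
  -- The tie between `t` and `c` is broken upwards, which will contradict the bound `t ≤ c`. The
  -- members of `N` survive: a negated open RSI with constant `d` is a bound `s ≤ d`, and `φ` moves
  -- `d` down; a negated closed RSI is strict and has no tie.
  obtain ⟨w, hw⟩ := exists_refines ι (acTerms (N ++ Q₂.acs) ++ [t, .const c]) v
    (shiftedVal ι Q₂.acs φ v)
  have hconst : ∀ d, shiftedVal ι Q₂.acs φ v (.const d) = ι d := fun d =>
    if_pos (forced_const _ d)
  have hwβ : AllHold ι w (N ++ Q₂.acs) := by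
    refine hw.allHold (by simp) hv fun b hb hbe => ?_
    rcases List.mem_append.1 hb with hb' | hb'
    · have hvb := hv b hb
      rcases List.mem_cons.1 (hN hb') with rfl | hmem
      · exact absurd rfl hvb
      · obtain ⟨r, hr, hmem⟩ := List.mem_flatMap.1 hmem
        obtain ⟨s, _, rfl⟩ := List.mem_map.1 hmem
        obtain ⟨hr, hrt⟩ := List.mem_filter.1 hr
        obtain ⟨d, hd⟩ := Comparison.rsiTest_iff.1 hrt
        rcases hd with ⟨x, rfl⟩ | ⟨x, rfl⟩
        · change s.val ι v = ι d at hbe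
          change shiftedVal ι Q₂.acs φ v s ≤ shiftedVal ι Q₂.acs φ v (.const d)
          rw [hconst, shiftedVal]
          split_ifs
          · exact hbe.le
          · rw [hbe]
            exact (hφr _ hr d ⟨x, rfl⟩).le
        · exact absurd hbe (show s.val ι v < ι d from hvb).ne
    · exact shiftedVal_rel hφ' hv₂ hb' hbe
  have h₁ : t.val ι w ≤ ι c := hle w hwβ
  have h₂ : (QTerm.const c).val ι w < t.val ι w :=
    (hw.lt_iff (by simp) (by simp)).2 (.inr ⟨hvc.symm, by
      rw [hconst, shiftedVal, if_neg hnf, hvc]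
      exact hφl a ha c hac⟩)
  exact h₁.not_gt h₂

/-- A consistent extension of the comparisons of `Q₂` by negated images of the right semi-interval
admits a mapping that contributes a new negated image. -/
theorem exists_mapping {lsi rsi : CompOp} (hlsi : lsi = CompOp.le ∨ lsi = CompOp.lt)
    (hrsi : rsi = CompOp.ge ∨ rsi = CompOp.gt) {Q₂ Q₁ : CQAC}
    (h : IsInstance ι lsi rsi Q₂ Q₁) (hcon : Contained ι Q₂ Q₁) {N : List Comparison}
    (hN : N ⊆ refutationCandidates Q₂ Q₁) (hsat : Satisfiable ι (N ++ Q₂.acs)) :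
    ∃ τ : QTerm → QTerm, (∀ s ∈ Q₁.bodyTerms, τ s ∈ Q₂.bodyTerms) ∧
      ∀ σ : ℕ → QTerm, (∀ x, .var x ∈ Q₁.bodyTerms → σ x = τ (.var x)) →
        mappingTest Q₂ Q₁ (N ++ Q₂.acs) σ = true ∧ negatedRSI σ Q₁.acs ∉ N := by
  classical
  set S := Q₂.bodyTerms ++ (Q₂.head ++ (Q₁.bodyTerms ++ (Q₁.head ++ acTerms Q₁.acs))) with hS
  -- Every equation between terms of `S`, and every bound of such a term by a constant in `S`, that
  -- holds in this model is implied.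
  obtain ⟨v, hv, hgen⟩ := exists_generic_model hsat
    (((allPairs S).map (fun p : QTerm × QTerm => (⟨p.1, .eq, p.2⟩ : Comparison)) ++
      ((allPairs S).filter fun p : QTerm × QTerm => p.2.isConst).map
        fun p : QTerm × QTerm => (⟨p.1, .le, p.2⟩ : Comparison)).filter
        fun a => ¬ Implied ι (N ++ Q₂.acs) a) fun a ha => by
      simp only [List.mem_filter, List.mem_append, List.mem_map, decide_eq_true_eq] at ha
      refine ⟨?_, ha.2⟩
      obtain ⟨⟨p, _, rfl⟩ | ⟨⟨s, t⟩, ⟨_, hp⟩, rfl⟩, _⟩ := ha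
      · exact .inl rfl
      · cases t with
        | var x => simp [QTerm.isConst] at hp
        | const c => exact .inr ⟨rfl, c, rfl⟩
  have heq : ∀ s ∈ S, ∀ t ∈ S, s.val ι v = t.val ι v → Implied ι (N ++ Q₂.acs) ⟨s, .eq, t⟩ := by
    intro s hs t ht hst
    by_contra himp
    refine hgen ⟨s, .eq, t⟩ ?_ hst
    simp only [List.mem_filter, List.mem_append, List.mem_map, decide_eq_true_eq]
    exact ⟨.inl ⟨(s, t), mem_allPairs.2 ⟨hs, ht⟩, rfl⟩, himp⟩
  have hle : ∀ s ∈ S, ∀ c, .const c ∈ S → s.val ι v ≤ ι c →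
      Implied ι (N ++ Q₂.acs) ⟨s, .le, .const c⟩ := by
    intro s hs c hc hsc
    by_contra himp
    refine hgen ⟨s, .le, .const c⟩ ?_ hsc
    simp only [List.mem_filter, List.mem_append, List.mem_map, decide_eq_true_eq]
    exact ⟨.inr ⟨(s, .const c), ⟨mem_allPairs.2 ⟨hs, hc⟩, rfl⟩, rfl⟩, himp⟩
  obtain ⟨u, hu₁, hu₂, hu₃⟩ := contained_iff.1 hcon v fun b hb =>
    hv b (List.mem_append_right _ hb)
  have hτ : ∀ s, ∃ t, s ∈ Q₁.bodyTerms → t ∈ Q₂.bodyTerms ∧ s.val ι u = t.val ι v := by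
    intro s
    by_cases hs : s ∈ Q₁.bodyTerms
    · obtain ⟨t, ht⟩ := exists_bodyTerm hu₁ hs
      exact ⟨t, fun _ => ht⟩
    · exact ⟨s, fun h => absurd h hs⟩
  choose τ hτ using hτ
  -- Only the values on body variables are prescribed, since a certificate determines the
  -- substitution only there.
  refine ⟨τ, fun s hs => (hτ s hs).1, fun σ hσ => ?_⟩
  have hσ' : ∀ s ∈ S, (∀ x, s = .var x → Q₁.InBody x) →
      s.subst σ ∈ S ∧ (s.subst σ).val ι v = s.val ι u := by
    intro s hs hsx
    cases s with
    | const c => exact ⟨hs, rfl⟩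
    | var x =>
      have hx := CQAC.inBody_iff.1 (hsx x rfl)
      rw [QTerm.subst, hσ x hx]
      exact ⟨List.mem_append_left _ (hτ _ hx).1, (hτ _ hx).2.symm⟩
  have hequal : ∀ {l m : List QTerm}, l ⊆ S → m ⊆ S →
      (∀ s ∈ l, ∀ x, s = .var x → Q₁.InBody x) →
      l.map (QTerm.val ι u) = m.map (QTerm.val ι v) → equalTest (N ++ Q₂.acs) σ l m = true := by
    intro l m hl hm hlx hlm
    rw [equalTest_iff ι]
    induction l generalizing m with
    | nil =>
      cases m with
      | nil => exact .nil
      | cons => simp at hlm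
    | cons s l ih =>
      cases m with
      | nil => simp at hlm
      | cons t m =>
        rw [List.map_cons, List.map_cons, List.cons.injEq] at hlm
        have hs := hσ' s (hl (by simp)) (hlx s (by simp))
        exact .cons (heq _ hs.1 _ (hm (by simp)) (hs.2.trans hlm.1))
          (ih (fun r hr => hl (by simp [hr])) (fun r hr => hm (by simp [hr]))
            (fun r hr => hlx r (by simp [hr])) hlm.2)
  have hacS : acTerms Q₁.acs ⊆ S := fun t ht => by simp [hS, ht]
  have hacs : ∀ a ∈ Q₁.acs, (a.lhs.subst σ ∈ S ∧ (a.lhs.subst σ).val ι v = a.lhs.val ι u) ∧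
      (a.rhs.subst σ ∈ S ∧ (a.rhs.subst σ).val ι v = a.rhs.val ι u) := fun a ha =>
    ⟨hσ' _ (hacS (mem_acTerms_lhs ha)) fun x hx => h.wf₁.acs_safe a ha x (.inl hx),
      hσ' _ (hacS (mem_acTerms_rhs ha)) fun x hx => h.wf₁.acs_safe a ha x (.inr hx)⟩
  refine ⟨(mappingTest_iff ι).2 ⟨fun a ha => ?_, ?_, fun a ha => ?_⟩, fun hmem => ?_⟩
  · obtain ⟨b, hb, hab⟩ := hu₁ a ha
    simp only [QAtom.toFact, Prod.mk.injEq] at hab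
    have hat : ∀ s ∈ a.args, s ∈ Q₁.bodyTerms := fun s hs => CQAC.mem_bodyTerms.2 ⟨a, ha, hs⟩
    refine ⟨b, hb, hab.1, hequal (fun s hs => ?_) (fun t ht => ?_) (fun s hs x hx => ?_) hab.2⟩
    · simp [hS, hat s hs]
    · exact List.mem_append_left _ (CQAC.mem_bodyTerms.2 ⟨b, hb, ht⟩)
    · exact CQAC.inBody_iff.2 (hx ▸ hat s hs)
  · exact hequal (fun s hs => by simp [hS, hs]) (fun s hs => by simp [hS, hs])
      (fun s hs x hx => h.wf₁.head_safe x (hx ▸ hs)) hu₃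
  · have hua := hu₂ a ha
    obtain ⟨⟨hl, hlv⟩, hr, hrv⟩ := hacs a ha
    rcases h.inClass.1 a ha with ⟨c, y, rfl⟩ | ⟨c, hac⟩ | ho
    · right
      change lsi.Rel (u y) (ι c) at hua
      have hlec := hle _ hl c hr (by
        rw [hlv]
        rcases hlsi with rfl | rfl
        exacts [hua, le_of_lt hua])
      rcases hlsi with rfl | rfl
      · exact hlec
      -- Genericity yields only the implied non-strict bound. It can be sharpened to `<`, as the
      -- alternative of an implied equation contradicts `u y < c`.
      · rcases implied_lt_or_eq_of_implied_le h hN ha ⟨y, rfl⟩ hlec with h' | h'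
        · exact h'
        · have : ((QTerm.var y).subst σ).val ι v = ι c := h' v hv
          rw [hlv] at this
          exact absurd this hua.ne
    · left
      rw [Comparison.rsiTest_iff]
      rcases hrsi with rfl | rfl
      exacts [⟨c, .inr hac⟩, ⟨c, .inl hac⟩]
    · right
      have := heq _ hl _ hr (by
        rw [hlv, hrv]
        rwa [Comparison.Holds, ho] at hua)
      rw [Comparison.subst, ho]
      exact this
  -- A negated image already in `N` would hold at `v`, whereas `u` satisfies the RSI itself.
  · have hneg := hv _ (List.mem_append_left _ hmem)
    rw [negatedRSI] at hneg
    have hrs : ∀ a ∈ Q₁.acs.filter Comparison.rsiTest, a ∈ Q₁.acs := fun a ha =>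
      (List.mem_filter.1 ha).1
    generalize Q₁.acs.filter Comparison.rsiTest = l at hneg hrs
    rcases l with _ | ⟨b, l⟩
    · exact hneg rfl
    · have hb := hrs b (by simp)
      obtain ⟨⟨-, hlv⟩, -, hrv⟩ := hacs b hb
      refine (Comparison.neg_holds ι v _).1 hneg ?_
      change b.op.Rel ((b.lhs.subst σ).val ι v) ((b.rhs.subst σ).val ι v)
      rw [hlv, hrv]
      exact hu₂ b hb

/-- The certificate that describes the mapping `τ` of the terms in `l`. -/
def mappingCode (l : List QTerm) (τ : QTerm → QTerm) : BTree :=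
  code (l.map fun s => BTree.cons (code s) (code (τ s)))

theorem lookupTerm_mappingCode {l cands : List QTerm} {τ : QTerm → QTerm} {s : QTerm} (hs : s ∈ l)
    (hτ : τ s ∈ cands) : lookupTerm (mappingCode l τ) cands s = τ s := by
  rw [lookupTerm, mappingCode, BTree.toList_code]
  have hall : ∀ t ∈ cands.filter (fun t => memCode (BTree.cons (code s) (code t))
      (l.map fun s => BTree.cons (code s) (code (τ s)))), t = τ s := by
    intro t ht
    obtain ⟨r, _, hr⟩ := List.mem_map.1 (memCode_iff.1 (List.mem_filter.1 ht).2)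
    rw [BTree.cons.injEq] at hr
    rw [← code_injective hr.1, code_injective hr.2]
  have hmem : τ s ∈ cands.filter (fun t => memCode (BTree.cons (code s) (code t))
      (l.map fun s => BTree.cons (code s) (code (τ s)))) :=
    List.mem_filter.2 ⟨hτ, memCode_iff.2 (List.mem_map.2 ⟨s, hs, rfl⟩)⟩
  generalize cands.filter _ = m at hall hmem
  rcases m with _ | ⟨t, m⟩
  · simp at hmem
  · exact hall t (by simp)

theorem exists_refutation {lsi rsi : CompOp} (hlsi : lsi = CompOp.le ∨ lsi = CompOp.lt)
    (hrsi : rsi = CompOp.ge ∨ rsi = CompOp.gt) {Q₂ Q₁ : CQAC}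
    (h : IsInstance ι lsi rsi Q₂ Q₁) (hcon : Contained ι Q₂ Q₁) :
    ∃ ms : List BTree, ms.length ≤ Q₂.bodyTerms.length + 1 ∧
      (∀ m ∈ ms, ∃ τ : QTerm → QTerm, (∀ s ∈ Q₁.bodyTerms, τ s ∈ Q₂.bodyTerms) ∧
        m = mappingCode Q₁.bodyTerms τ) ∧
      refutationTest Q₂ Q₁ ms Q₂.acs = true := by
  classical
  -- Induction on the number of candidates missing from `N`: as long as the comparisons are
  -- satisfiable, a mapping supplies a missing one.
  have key : ∀ n, ∀ N : List Comparison, N ⊆ refutationCandidates Q₂ Q₁ →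
      ((refutationCandidates Q₂ Q₁).toFinset \ N.toFinset).card ≤ n →
      ∃ ms : List BTree, ms.length ≤ n ∧
        (∀ m ∈ ms, ∃ τ : QTerm → QTerm, (∀ s ∈ Q₁.bodyTerms, τ s ∈ Q₂.bodyTerms) ∧
          m = mappingCode Q₁.bodyTerms τ) ∧
        refutationTest Q₂ Q₁ ms (N ++ Q₂.acs) = true := by
    intro n
    induction n using Nat.strong_induction_on with | _ n ih => ?_
    intro N hN hcard
    by_cases hsat : Satisfiable ι (N ++ Q₂.acs)
    · obtain ⟨τ, hτ, hσ⟩ := exists_mapping hlsi hrsi h hcon hN hsat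
      have hcert : ∀ x, .var x ∈ Q₁.bodyTerms →
          certSubst (mappingCode Q₁.bodyTerms τ) Q₂.bodyTerms x = τ (.var x) := fun x hx =>
        lookupTerm_mappingCode hx (hτ _ hx)
      obtain ⟨hmap, hnew⟩ := hσ _ hcert
      have hcand := negatedRSI_mem_refutationCandidates (Q₂ := Q₂) h.wf₁ fun x hx =>
        (hcert x (CQAC.inBody_iff.1 hx)).symm ▸ hτ _ (CQAC.inBody_iff.1 hx)
      set e := negatedRSI (certSubst (mappingCode Q₁.bodyTerms τ) Q₂.bodyTerms) Q₁.acs with he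
      have hlt : ((refutationCandidates Q₂ Q₁).toFinset \ (e :: N).toFinset).card <
          ((refutationCandidates Q₂ Q₁).toFinset \ N.toFinset).card := by
        refine Finset.card_lt_card (Finset.ssubset_iff_of_subset
          (Finset.sdiff_subset_sdiff subset_rfl fun x hx => ?_) |>.2 ⟨e, ?_, ?_⟩)
        · simp only [List.mem_toFinset] at hx ⊢
          exact List.mem_cons_of_mem _ hx
        · simp [hcand, hnew]
        · simp
      obtain ⟨ms, h₁, h₂, h₃⟩ := ih (n - 1) (by omega) (e :: N)
        (List.cons_subset.2 ⟨hcand, hN⟩) (by omega)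
      refine ⟨mappingCode Q₁.bodyTerms τ :: ms, ?_, fun m hm => ?_, ?_⟩
      · rw [List.length_cons]
        omega
      · rcases List.mem_cons.1 hm with rfl | hm
        exacts [⟨τ, hτ, rfl⟩, h₂ m hm]
      · rw [refutationTest, hmap, Bool.true_and]
        exact h₃
    · refine ⟨[], Nat.zero_le _, by simp, ?_⟩
      rwa [refutationTest, Bool.not_eq_true', ← Bool.not_eq_true, satTest_iff ι]
  have hr := classTest_iff.2 h.inClass
  rw [classTest, Bool.and_eq_true, PolyTime.sameCode_iff] at hr
  obtain ⟨ms, h₁, h₂, h₃⟩ := key _ [] (by simp) le_rfl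
  refine ⟨ms, h₁.trans ?_, h₂, h₃⟩
  refine le_trans ?_ (length_refutationCandidates hr.2)
  simpa using List.toFinset_card_le _

end

/-! ### Membership in NP -/

/-- Determinism makes the halting run provided by `PolyTime` the only one, so it alone decides
acceptance. -/
theorem WProg.Run.store_unique {p : WProg} {s s₁ s₂ : Store} {t₁ t₂ : ℕ} (h₁ : p.Run s s₁ t₁)
    (h₂ : p.Run s s₂ t₂) : s₁ = s₂ := by
  induction h₁ generalizing s₂ t₂ with
  | assign => cases h₂; rfl
  | seq _ _ ih ih' =>
    cases h₂ with
    | seq h h' => cases ih h; exact ih' h'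
  | cond_true he _ ih =>
    cases h₂ with
    | cond_true _ h => exact ih h
    | cond_false he' => exact absurd he' he
  | cond_false he _ ih =>
    cases h₂ with
    | cond_true he' => exact absurd he he'
    | cond_false _ h => exact ih h
  | loop_done he =>
    cases h₂ with
    | loop_done => rfl
    | loop_step he' => exact absurd he he'
  | loop_step he _ _ ih ih' =>
    cases h₂ with
    | loop_done he' => exact absurd he' he
    | loop_step _ h h' => cases ih h; exact ih' h'

theorem codeSize_le_of_forall_mem {α : Type*} [TreeCode α] {l : List α} {B : ℕ}
    (h : ∀ a ∈ l, codeSize a ≤ B) : codeSize l ≤ l.length * (B + 1) + 1 := by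
  induction l with
  | nil => simp [codeSize_nil]
  | cons a l ih =>
    have h₁ := h a (by simp)
    have h₂ := ih fun b hb => h b (by simp [hb])
    rw [codeSize_cons, List.length_cons, Nat.succ_mul]
    omega

/-- A set is in NP if membership is equivalent to the existence of a certificate of polynomial size
that is accepted by a function that is computable in polynomial time. -/
theorem inNP_of_polyTime {α : Type*} [TreeCode α] {f : α × BTree → Bool} (hf : PolyTime f)
    {L : Set α} (q : Polynomial ℕ) (hL : ∀ a w, f (a, w) = true → a ∈ L)
    (hL' : ∀ a ∈ L, ∃ w : BTree, w.size ≤ q.eval (codeSize a) ∧ f (a, w) = true) :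
    InNP (code (α := α)) L := by
  obtain ⟨V, k, p, -, hV⟩ := hf
  have hacc : ∀ a w, V.Accepts (.cons (code a) w) ↔ f (a, w) = true := by
    intro a w
    obtain ⟨s, t, hrun, -, hs, -⟩ := hV (a, w) (inputStore (.cons (code a) w)) rfl
    have hne : s 0 ≠ .nil ↔ f (a, w) = true := by
      rw [hs]
      cases f (a, w) <;> simp [code, BTree.ofBool]
    refine ⟨fun ⟨s', t', hrun', hs'⟩ => ?_, fun h => ⟨s, t, hrun, hne.2 h⟩⟩
    rw [hrun'.store_unique hrun] at hs'
    exact hne.1 hs'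
  -- `InNP` uses one polynomial for the running time and the certificate size; the sum bounds both.
  refine ⟨V, p + q, fun a w => ?_, fun a => ⟨fun ha => ?_, fun ⟨w, _, hw⟩ =>
    hL a w ((hacc a w).1 hw)⟩⟩
  · obtain ⟨s, t, hrun, ht, -⟩ := hV (a, w) (inputStore (.cons (code a) w)) rfl
    refine ⟨s, t, hrun, ht.trans ?_⟩
    rw [Polynomial.eval_add]
    exact Nat.le_add_right _ _
  · obtain ⟨w, hw, h⟩ := hL' a ha
    refine ⟨w, hw.trans ?_, (hacc a w).2 h⟩
    rw [Polynomial.eval_add]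
    exact Nat.le_add_left _ _

theorem codeSize_mappingCode_le {l m : List QTerm} {τ : QTerm → QTerm} (hτ : ∀ s ∈ l, τ s ∈ m) :
    codeSize (mappingCode l τ) ≤ codeSize l * (codeSize l + codeSize m + 2) + 1 := by
  have : codeSize (mappingCode l τ) ≤ _ := codeSize_le_of_forall_mem
    (l := l.map fun s => BTree.cons (code s) (code (τ s)))
    (B := codeSize l + codeSize m + 1) fun x hx => by
      obtain ⟨s, hs, rfl⟩ := List.mem_map.1 hx
      have h₁ := codeSize_le_of_mem hs
      have h₂ := codeSize_le_of_mem (hτ s hs)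
      change codeSize s + codeSize (τ s) + 1 ≤ _
      omega
  rw [List.length_map] at this
  refine this.trans ?_
  gcongr
  exact (length_lt_codeSize l).le

theorem inNP_containment {D : Type*} [LinearOrder D] [DenselyOrdered D] [NoMinOrder D]
    [NoMaxOrder D] (ι : ℚ ↪o D) (lsi rsi : CompOp)
    (hlsi : lsi = CompOp.le ∨ lsi = CompOp.lt) (hrsi : rsi = CompOp.ge ∨ rsi = CompOp.gt) :
    InNP encQueryPair
      {P : CQAC × CQAC | IsInstance ι lsi rsi P.1 P.2 ∧ Contained ι P.1 P.2} := by
  obtain ⟨p₂, hp₂⟩ := (PolyTime.bodyTerms (α := CQAC × CQAC) (.fst .id)).codeSize_le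
  obtain ⟨p₁, hp₁⟩ := (PolyTime.bodyTerms (α := CQAC × CQAC) (.snd .id)).codeSize_le
  -- `p₁` and `p₂` bound the codes of the body terms of `Q₁` and `Q₂`. There are at most `p₂`
  -- mappings, each coded in size at most `p₁ * (p₁ + p₂ + 2) + 1`.
  refine inNP_of_polyTime (PolyTime.verify lsi rsi) (p₂ * (p₁ * (p₁ + p₂ + 2) + 2) + 1)
    (fun P w h => ?_) fun P ⟨hinst, hcon⟩ => ?_
  · rw [verify, Bool.and_eq_true, instanceTest_iff ι] at h
    refine ⟨h.1, contained_iff.2 fun v hv => exists_assignment_of_refutationTest ?_ _ h.2 hv⟩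
    have hr := classTest_iff.2 h.1.inClass
    rw [classTest, Bool.and_eq_true, PolyTime.sameCode_iff] at hr
    exact hr.2
  · obtain ⟨ms, hlen, hms, href⟩ := exists_refutation hlsi hrsi hinst hcon
    refine ⟨code ms, ?_, ?_⟩
    · have h₁ := hp₁ P
      have h₂ := hp₂ P
      have hlt := length_lt_codeSize P.1.bodyTerms
      have hsize := codeSize_le_of_forall_mem (l := ms)
        (B := codeSize P.2.bodyTerms * (codeSize P.2.bodyTerms + codeSize P.1.bodyTerms + 2) + 1)
        fun m hm => by
          obtain ⟨τ, hτ, rfl⟩ := hms m hm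
          exact codeSize_mappingCode_le hτ
      refine hsize.trans ?_
      simp only [Polynomial.eval_add, Polynomial.eval_mul, Polynomial.eval_ofNat,
        Polynomial.eval_one]
      have hle : ms.length ≤ p₂.eval (codeSize P) := by omega
      exact Nat.add_le_add_right (Nat.mul_le_mul hle
        (Nat.add_le_add_right (Nat.mul_le_mul h₁ (by omega)) 2)) 1
    · rw [verify, Bool.and_eq_true, instanceTest_iff ι, BTree.toList_code]
      exact ⟨hinst, href⟩

theorem mainTheorem6 {D : Type*} [LinearOrder D] [DenselyOrdered D] [NoMinOrder D] [NoMaxOrder D]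
    (ι : ℚ ↪o D) (lsi rsi : CompOp)
    (hlsi : lsi = CompOp.le ∨ lsi = CompOp.lt) (hrsi : rsi = CompOp.ge ∨ rsi = CompOp.gt) :
    InNP encQueryPair
      {P : CQAC × CQAC | IsInstance ι lsi rsi P.1 P.2 ∧ Contained ι P.1 P.2} ∧
    ∀ Q₂ Q₁ : CQAC, IsInstance ι lsi rsi Q₂ Q₁ →
      (Contained ι Q₂ Q₁ ↔ ContainmentEntailment ι (Q₂.collapse ι) (Q₁.collapse ι)) :=
  ⟨inNP_containment ι lsi rsi hlsi hrsi, fun _ _ h =>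
    ⟨containmentEntailment_of_contained hlsi hrsi h, contained_of_containmentEntailment⟩⟩
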